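/- **Setting.** A spin system is a probability measure $\mu$ on $\mathcal Y=\mathcal X^{\mathcal I}$ with $\mathcal X$ (spins) and $\mathcal I\neq\emptyset$ (sites) finite. Its Glauber dynamics is the Markov chain on $\operatorname{supp}\mu$ with transition matrix $$P(x,y)=|\mathcal I|^{-1}\sum_{i\in\mathcal I}\mu(y_i\mid \bar x_i)\prod_{j\ne i}\delta_{x_j=y_j},\qquad \bar x_i=(x_j)_{j\neq i},$$ with generator $L=P-I$ and Glauber semigroup $P_t=e^{tL}$, $t\ge 0$. Let $\operatorname{Ent}_\mu(f)=\mathbb E_\mu[f\log f]-\mathbb E_\mu[f]\log\mathbb E_\mu[f]$ and $\mathcal E(f,g)=\mathbb E_\mu[f(-Lg)]$. The dynamics satisfies $\mathrm{mLSI}(\rho_0)$ if $\operatorname{Ent}_\mu(f)\le\frac{\rho_0}{2}\mathcal E(f,\log f)$ for all $f:\operatorname{supp}\mu\to(0,\infty)$. The mixing time is $$t_{\mathrm{mix}}=\inf\{t\ge 0:\ \max_{y\in\operatorname{supp}\mu}d_{\mathrm{TV}}(P_t(y,\cdot),\mu)\le e^{-1}\}.$$ For a function $H$ on $\mathcal Y$,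 the Gibbs measure of $H$ is $\mu(\sigma)=Z^{-1}e^{H(\sigma)}$. **Theorem.** In each of the following four models there is a constant $C$, depending only on the parameters listed for that model (in particular not on $n$, nor on the graph in (3) and (4)), such that every spin system $\mu$ of the model, with site set $\mathcal I$, has the properties (a), (b), (c) below. 1. *Exponential random graph model* (parameters $\beta\in\mathbb R^s$ and finite simple connected graphs $G_1,\dots,G_s$, $G_i=(V_i,E_i)$): for $n\ge2$, the Gibbs measure on $\{0,1\}^{\mathcal I_n}$, $\mathcal I_n=\{(i,j):1\le i<j\le n\}$, of $H(x)=n^2\sum_{i}\beta_i N_{G_i}(x)\,n^{-|V_i|}$, where $N_{G_i}(x)$ is the number of injective edge-preserving maps from $V_i$ into the vertices of the graph $x$. Assumption: $\frac12\Phi_{|\beta|}'(1)<1$, where $\Phi_{|\beta|}(x)=\sum_i|\beta_i||E_i|x^{|E_i|-1}$. 2. *Vertex-weighted exponential random graph model* (parameters $\beta_1,\beta_2\in\mathbb R$, $p\in(0,1)$): for $n\ge1$, the Gibbs measure on $\{0,1\}^n$ of $$H(\sigma)=\log\Big(\frac p{1-p}\Big)\sum_i\sigma_i+\frac{\beta_1}{n}\sum_{i\ne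 j}\sigma_i\sigma_j+\frac{\beta_2}{n^2}\sum_{i,j,k\text{ distinct}}\sigma_i\sigma_j\sigma_k,$$ with sums over ordered pairs and ordered triples. Assumption: $\sup_{x\in(0,1)}|\phi_\beta'(x)|<1$, where $\phi_\beta=\frac{e^{h}}{1+e^{h}}$ and $h(x)=2\beta_1x+3\beta_2x^2+\log\frac p{1-p}$. 3. *Random colorings* (parameters $\Delta,k\in\mathbb N$): the uniform distribution on the proper colorings, with $k$ colors, of the vertices of a nonempty finite simple graph of maximum degree at most $\Delta$. Assumption: $k\ge2\Delta+1$. 4. *Hard-core model* (parameters $\Delta\in\mathbb N$, $\lambda>0$): for a nonempty finite simple graph $G=(V,E)$ of maximum degree at most $\Delta$, the measure on $\{0,1\}^V$ proportional to $\prod_v\lambda^{\sigma_v}$ on the configurations with $\sigma_v\sigma_w=0$ for all $\{v,w\}\in E$, and zero elsewhere. Assumption: $\lambda<\frac1{\Delta-1}$ (no condition if $\Delta\le1$), that is, $\lambda(\Delta-1)<1$. (a) The Glauber dynamics satisfies $\mathrm{mLSI}(\rho_0)$ for some $0<\rho_0\le C|\mathcal I|$. (b) For every $\rho_0>0$ for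 which it satisfies $\mathrm{mLSI}(\rho_0)$, every $\mu$-density $f$ and every $t\ge0$, $\operatorname{Ent}_\mu(P_tf)\le e^{-2t/\rho_0}\operatorname{Ent}_\mu(f)$. (c) The Glauber dynamics is rapidly mixing: if $|\mathcal I|\ge2$, then $t_{\mathrm{mix}}\le C\,|\mathcal I|\log|\mathcal I|$. -/

import Mathlib

open scoped ENNReal NNReal

/-! ### Entropy, modified logarithmic Sobolev inequality and mixing time of a finite Markov chain -/

namespace MarkovChain

variable {Ω : Type*} [Fintype Ω]

/-- Expectation of `f` under the probability mass function `μ`. -/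
noncomputable def expect (μ : Ω → ℝ) (f : Ω → ℝ) : ℝ :=
  ∑ x, μ x * f x

/-- `Ent_μ(f) = E_μ[f log f] - E_μ[f] log E_μ[f]`, for `f ≥ 0` (with `0 log 0 = 0`). -/
noncomputable def entropy (μ : Ω → ℝ) (f : Ω → ℝ) : ℝ :=
  expect μ (fun x => f x * Real.log (f x)) - expect μ f * Real.log (expect μ f)

/-- A probability density with respect to `μ`. -/
def IsDensity (μ : Ω → ℝ) (f : Ω → ℝ) : Prop :=
  (∀ x, 0 ≤ f x) ∧ expect μ f = 1

/-- Total variation distance of two probability mass functions. -/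
noncomputable def dTV (μ ν : Ω → ℝ) : ℝ :=
  (1 / 2) * ∑ x, |μ x - ν x|

variable [DecidableEq Ω]

/-- The generator `L = P - I` of the chain with transition matrix `P`. -/
def generator (P : Matrix Ω Ω ℝ) : Matrix Ω Ω ℝ :=
  P - 1

/-- The Dirichlet form `E(f, g) = E_μ[f (-L g)]`. -/
noncomputable def dirichletForm (P : Matrix Ω Ω ℝ) (μ : Ω → ℝ) (f g : Ω → ℝ) : ℝ :=
  expect μ (fun x => f x * (-(generator P).mulVec g x))

/-- `mLSI(ρ)`: `Ent_μ(f) ≤ (ρ / 2) E(f, log f)`. The test functions are strictly positive, so that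
`log f` is finite; for nonnegative `f` the inequality is the limit of the one for `f + ε`. -/
def MLSI (P : Matrix Ω Ω ℝ) (μ : Ω → ℝ) (ρ : ℝ) : Prop :=
  ∀ f : Ω → ℝ, (∀ x, 0 < f x) →
    entropy μ f ≤ ρ / 2 * dirichletForm P μ f (fun x => Real.log (f x))

/-- The continuous-time semigroup `P_t = exp (t L)`; row `y` of `P_t` is the law at time `t` of the
chain started in `y`. -/
noncomputable def semigroup (P : Matrix Ω Ω ℝ) (t : ℝ) : Matrix Ω Ω ℝ :=
  NormedSpace.exp (t • generator P)

/-- Exponential decay of the relative entropy along the semigroup: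
`Ent_μ(P_t f) ≤ exp(-2 t / ρ) Ent_μ(f)` for every `μ`-density `f` and all `t ≥ 0`. -/
def EntropyDecay (P : Matrix Ω Ω ℝ) (μ : Ω → ℝ) (ρ : ℝ) : Prop :=
  ∀ f : Ω → ℝ, IsDensity μ f → ∀ t : ℝ, 0 ≤ t →
    entropy μ ((semigroup P t).mulVec f) ≤ Real.exp (-2 * t / ρ) * entropy μ f

/-- The mixing time `inf {t ≥ 0 : max_y d_TV(P_t(y, ·), μ) ≤ e⁻¹}` (`∞` if there is no such `t`). -/
noncomputable def mixingTime (P : Matrix Ω Ω ℝ) (μ : Ω → ℝ) : ℝ≥0∞ :=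
  ⨅ (t : ℝ≥0) (_ : ∀ y, dTV (semigroup P t y) μ ≤ Real.exp (-1)), (t : ℝ≥0∞)

end MarkovChain

/-! ### Spin systems and their Glauber dynamics

A spin system with sites `I` and spins `X` is given by its probability mass function
`μ : (I → X) → ℝ`. -/

namespace SpinSystem

variable {I X : Type*}

/-- The support of a spin system, the state space of the Glauber dynamics. -/
abbrev Supp (μ : (I → X) → ℝ) : Type _ :=
  {x : I → X // 0 < μ x}

/-- The spin system as a probability mass function on its support. -/
def onSupp (μ : (I → X) → ℝ) (x : Supp μ) : ℝ :=
  μ x.1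

variable [Fintype X] [DecidableEq I]

/-- The conditional probability `μ(a | x̄_i)` that site `i` has spin `a` given the spins of `x` at all
the other sites. -/
noncomputable def condProb (μ : (I → X) → ℝ) (i : I) (a : X) (x : I → X) : ℝ :=
  μ (Function.update x i a) / ∑ b, μ (Function.update x i b)

variable [Fintype I] [DecidableEq X]

/-- Transition matrix of the Glauber dynamics:
`P(x, y) = |I|⁻¹ ∑_i μ(y_i | x̄_i) ∏_{j ≠ i} δ(x_j = y_j)`. -/
noncomputable def glauber (μ : (I → X) → ℝ) : Matrix (Supp μ) (Supp μ) ℝ :=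
  fun x y => (Fintype.card I : ℝ)⁻¹ * ∑ i, condProb μ i (y.1 i) x.1 *
    ∏ j ∈ Finset.univ.erase i, if x.1 j = y.1 j then 1 else 0

/-- The properties of the Glauber dynamics of `μ`, with constant `C`: it satisfies `mLSI(ρ₀)` for some
`ρ₀ ≤ C |I|`; whenever it satisfies `mLSI(ρ₀)`, the relative entropy decays along the semigroup at
rate `2 / ρ₀`; and, if there are at least two sites, `t_mix ≤ C |I| log |I|`. -/
def RapidMixingWith (μ : (I → X) → ℝ) (C : ℝ) : Prop :=
  (∃ ρ₀ : ℝ, 0 < ρ₀ ∧ ρ₀ ≤ C * Fintype.card I ∧ MarkovChain.MLSI (glauber μ) (onSupp μ) ρ₀) ∧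
  (∀ ρ₀ : ℝ, 0 < ρ₀ → MarkovChain.MLSI (glauber μ) (onSupp μ) ρ₀ →
    MarkovChain.EntropyDecay (glauber μ) (onSupp μ) ρ₀) ∧
  (2 ≤ Fintype.card I → MarkovChain.mixingTime (glauber μ) (onSupp μ) ≤
    ENNReal.ofReal (C * (Fintype.card I * Real.log (Fintype.card I))))

/-- The Gibbs measure `μ_H(σ) = Z⁻¹ exp(H(σ))`. -/
noncomputable def gibbs (H : (I → X) → ℝ) (σ : I → X) : ℝ :=
  Real.exp (H σ) / ∑ τ, Real.exp (H τ)

/-! ### The exponential random graph model -/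

/-- The sites of the exponential random graph model on `n` vertices: pairs `(i, j)` with `i < j`. -/
abbrev EdgeSite (n : ℕ) : Type :=
  {e : Fin n × Fin n // e.1 < e.2}

/-- The simple graph on `n` vertices encoded by a configuration. -/
def toGraph {n : ℕ} (x : EdgeSite n → Fin 2) : SimpleGraph (Fin n) :=
  SimpleGraph.fromRel fun i j => ∃ h : i < j, x ⟨(i, j), h⟩ = 1

/-- `N_G(G')`: the number of injective maps of the vertices which preserve edges. -/
noncomputable def injHomCount {V W : Type*} (G : SimpleGraph V) (G' : SimpleGraph W) : ℕ :=
  Nat.card {φ : V → W // Function.Injective φ ∧ ∀ a b, G.Adj a b → G'.Adj (φ a) (φ b)}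

/-- `H_β(x) = n² ∑_i β_i N_{G_i}(x) / n^{|V_i|}`. -/
noncomputable def ergmHamiltonian {s : ℕ} {V : Fin s → Type*} (G : ∀ i, SimpleGraph (V i))
    (β : Fin s → ℝ) (n : ℕ) (x : EdgeSite n → Fin 2) : ℝ :=
  (n : ℝ) ^ 2 * ∑ i, β i * ((injHomCount (G i) (toGraph x) : ℝ) / (n : ℝ) ^ Nat.card (V i))

/-- The exponential random graph model with parameters `(β, G_1, …, G_s)` on `n` vertices. -/
noncomputable def ergm {s : ℕ} {V : Fin s → Type*} (G : ∀ i, SimpleGraph (V i))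
    (β : Fin s → ℝ) (n : ℕ) : (EdgeSite n → Fin 2) → ℝ :=
  gibbs (ergmHamiltonian G β n)

/-- `Φ_β(x) = ∑_i β_i |E_i| x^{|E_i| - 1}`. -/
noncomputable def ergmPhi {s : ℕ} {V : Fin s → Type*} (G : ∀ i, SimpleGraph (V i))
    (β : Fin s → ℝ) (x : ℝ) : ℝ :=
  ∑ i, β i * (Nat.card (G i).edgeSet : ℝ) * x ^ (Nat.card (G i).edgeSet - 1)

/-! ### The vertex-weighted exponential random graph model -/

/-- `H(σ) = log(p / (1 - p)) ∑_i σ_i + (β₁ / n) ∑ σ_i σ_j + (β₂ / n²) ∑ σ_i σ_j σ_k`, the sums running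
over ordered pairs, respectively triples, of pairwise distinct sites. -/
noncomputable def vertexWeightedHamiltonian (β₁ β₂ p : ℝ) (n : ℕ) (σ : Fin n → Fin 2) : ℝ :=
  Real.log (p / (1 - p)) * ∑ i, ((σ i : ℕ) : ℝ)
    + β₁ / n * ∑ i, ∑ j, (if i ≠ j then ((σ i : ℕ) : ℝ) * ((σ j : ℕ) : ℝ) else 0)
    + β₂ / (n : ℝ) ^ 2 * ∑ i, ∑ j, ∑ k, (if i ≠ j ∧ j ≠ k ∧ i ≠ k then
        ((σ i : ℕ) : ℝ) * ((σ j : ℕ) : ℝ) * ((σ k : ℕ) : ℝ) else 0)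

/-- The vertex-weighted exponential random graph model on `n` vertices. -/
noncomputable def vertexWeighted (β₁ β₂ p : ℝ) (n : ℕ) : (Fin n → Fin 2) → ℝ :=
  gibbs (vertexWeightedHamiltonian β₁ β₂ p n)

/-- `φ_β = exp(h) / (1 + exp(h))` with `h(x) = 2 β₁ x + 3 β₂ x² + log(p / (1 - p))`. Up to
`O(1 / n)`, `h(x)` is the discrete derivative of the Hamiltonian at a configuration with `x n` ones. -/
noncomputable def vertexWeightedPhi (β₁ β₂ p : ℝ) (x : ℝ) : ℝ :=
  Real.exp (2 * β₁ * x + 3 * β₂ * x ^ 2 + Real.log (p / (1 - p))) /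
    (1 + Real.exp (2 * β₁ * x + 3 * β₂ * x ^ 2 + Real.log (p / (1 - p))))

/-! ### Random colorings and the hard-core model -/

/-- A proper coloring. -/
def IsProper {V : Type*} (G : SimpleGraph V) {k : ℕ} (σ : V → Fin k) : Prop :=
  ∀ v w, G.Adj v w → σ v ≠ σ w

open Classical in
/-- The random coloring model: the uniform distribution on the proper colorings with `k` colors. -/
noncomputable def randomColoring {V : Type*} (G : SimpleGraph V) (k : ℕ) (σ : V → Fin k) : ℝ :=
  if IsProper G σ then (Nat.card {τ : V → Fin k // IsProper G τ} : ℝ)⁻¹ else 0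

/-- An admissible (hard-core) configuration: `σ_v σ_w = 0` for every edge `{v, w}`. -/
def IsAdmissible {V : Type*} (G : SimpleGraph V) (σ : V → Fin 2) : Prop :=
  ∀ v w, G.Adj v w → (σ v : ℕ) * (σ w : ℕ) = 0

open Classical in
/-- The weight `∏_v lam^{σ_v}` of an admissible configuration, and `0` for the others. -/
noncomputable def hardCoreWeight {V : Type*} [Fintype V] (G : SimpleGraph V) (lam : ℝ)
    (σ : V → Fin 2) : ℝ :=
  if IsAdmissible G σ then ∏ v, lam ^ (σ v : ℕ) else 0

open Classical in
/-- The hard-core model with fugacity `lam`. -/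
noncomputable def hardCore {V : Type*} [Fintype V] (G : SimpleGraph V) (lam : ℝ)
    (σ : V → Fin 2) : ℝ :=
  hardCoreWeight G lam σ / ∑ τ, hardCoreWeight G lam τ

end SpinSystem

set_option linter.unusedSectionVars false

/-! ### Total variation and relative entropy on a finite set -/

namespace MarkovChain

variable {Ω : Type*} [Fintype Ω]

/-! All four models satisfy Dobrushin's uniqueness condition with a gap independent of the size: the
influence of the spin at `j` on the conditional distribution at `i` is at most `A i j`, where the
rows and columns of `A` sum to at most `1 - δ`. Moreover, whatever spins are pinned, the marginal at
a free site gives each spin probability zero or at least `b`. These two facts imply approximate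
tensorization of entropy, `Ent(f) ≤ K ∑_i E[Ent_i(f)]` with `K = |X| / (b δ²)`, where `Ent_i` is the
entropy in the spin at `i` given the others (`blockSum_localEnt_le`).

Tensorization is proved by induction on the block `J` of free sites. For each `i ∈ J`, the chain
rule splits the entropy into that of the block `J.erase i`, with the spin at `i` pinned, and the
relative entropy of the marginal at `i`. Summed over `i`, the induction hypothesis uses `|J| - 1` of
the `|J|` available copies of `K ∑_j E[Ent_j(f)]`, since each `j` is absent from exactly one of the
smaller blocks. The remaining copy pays for the marginals: the bound `b` turns their relative
entropies into squared distances (`sum_mul_log_div_le`); Dobrushin's comparison theorem bounds the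
distances by a solution of `a = d + A a`, where `d i` is the mean distance of the conditional
distributions at `i` (`exists_isEstimate`); the gap bounds `a` by `d` in `ℓ²`
(`sum_sq_le_of_eq_add`); and Pinsker's inequality bounds `d` by the local entropies.

By Jensen's inequality the Dirichlet form `E(f, log f)` of the Glauber dynamics is at least `|I|⁻¹
∑_i E[Ent_i(f)]`, so tensorization is a modified logarithmic Sobolev inequality with `ρ = 2 K |I|`
(`mLSI_glauber`). Differentiating the entropy along the reversible semigroup gives its exponential
decay. A chain started at `y` has initial relative entropy `-log μ(y)`, of order `|I|`, and
Pinsker's inequality yields mixing after a time of order `|I| log |I|`.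

It remains to bound the row sums. They are at most `½ Φ'(1)` for exponential random graphs, by
counting embeddings through two edges; at most `sup |φ'| + O(1/n)` for the vertex-weighted model,
whose finitely many small `n` are covered by comparison with the uniform measure; at most `Δ / (Δ +
1)` for colorings; and at most `Δ λ / (1 + λ)` for the hard-core model. -/

theorem dTV_nonneg (u v : Ω → ℝ) : 0 ≤ dTV u v :=
  mul_nonneg (by norm_num) (Finset.sum_nonneg fun _ _ => abs_nonneg _)

theorem dTV_comm (u v : Ω → ℝ) : dTV u v = dTV v u := by
  simp only [dTV, abs_sub_comm]

/-- A function whose oscillation is at most `c` is integrated equally, up to `c` times the total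
variation distance, by two functions with the same sum. -/
theorem abs_sum_mul_sub_sum_mul_le (u v g : Ω → ℝ) (c : ℝ) (huv : ∑ a, u a = ∑ a, v a)
    (hg : ∀ a b, |g a - g b| ≤ c) :
    |∑ a, u a * g a - ∑ a, v a * g a| ≤ dTV u v * c := by
  rcases isEmpty_or_nonempty Ω with h | h
  · simp [dTV]
  obtain ⟨a₁, -, h₁⟩ := Finset.exists_max_image Finset.univ g Finset.univ_nonempty
  obtain ⟨a₂, -, h₂⟩ := Finset.exists_min_image Finset.univ g Finset.univ_nonempty
  -- As the two sums agree, `g` may be shifted by its midrange. This leaves values of size at most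
  -- `c / 2`, and the half is absorbed by the one in `dTV`.
  have hm : ∀ a, |g a - (g a₁ + g a₂) / 2| ≤ c / 2 := fun a => by
    have h3 := h₁ a (Finset.mem_univ _)
    have h4 := h₂ a (Finset.mem_univ _)
    have h5 := (le_abs_self _).trans (hg a₁ a₂)
    rw [abs_le]; constructor <;> linarith
  have key : ∑ a, u a * g a - ∑ a, v a * g a
      = ∑ a, (u a - v a) * (g a - (g a₁ + g a₂) / 2) := by
    simp only [sub_mul, mul_sub, Finset.sum_sub_distrib, ← Finset.sum_mul, huv]
    ring
  rw [key]
  calc |∑ a, (u a - v a) * (g a - (g a₁ + g a₂) / 2)|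
      ≤ ∑ a, |(u a - v a) * (g a - (g a₁ + g a₂) / 2)| := Finset.abs_sum_le_sum_abs _ _
    _ ≤ ∑ a, |u a - v a| * (c / 2) := Finset.sum_le_sum fun a _ => by
        rw [abs_mul]; exact mul_le_mul_of_nonneg_left (hm a) (abs_nonneg _)
    _ = dTV u v * c := by rw [dTV, ← Finset.sum_mul]; ring

/-- Pointwise comparison of the squared Hellinger distance with relative entropy: write `log (u / v)
= -2 log (√v / √u)` and use `log z ≤ z - 1`. The terms `- u + v` cancel when summed over two
probability measures. -/
theorem sq_sqrt_sub_sqrt_le {u v : ℝ} (hu : 0 ≤ u) (hv : 0 ≤ v) (huv : v = 0 → u = 0) :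
    (√u - √v) ^ 2 ≤ u * Real.log (u / v) - u + v := by
  rcases hv.eq_or_lt with h | hv'
  · simp [← h, huv h.symm]
  rcases hu.eq_or_lt with h | hu'
  · simp [← h, Real.sq_sqrt hv]
  have su := Real.sqrt_pos.2 hu'
  have sv := Real.sqrt_pos.2 hv'
  have e1 := Real.sq_sqrt hu
  have e2 := Real.sq_sqrt hv
  have h1 : Real.log (u / v) = -2 * Real.log (√v / √u) := by
    rw [Real.log_div hu'.ne' hv'.ne', Real.log_div sv.ne' su.ne', Real.log_sqrt hu,
      Real.log_sqrt hv]
    ring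
  have h2 : Real.log (√v / √u) ≤ √v / √u - 1 := Real.log_le_sub_one_of_pos (by positivity)
  have h3 : u * Real.log (√v / √u) ≤ √v * √u - u := by
    calc u * Real.log (√v / √u) ≤ u * (√v / √u - 1) := mul_le_mul_of_nonneg_left h2 hu
      _ = √u ^ 2 * (√v / √u) - u := by rw [e1]; ring
      _ = √v * √u - u := by field_simp
  rw [h1]
  nlinarith

/-- A form of Pinsker's inequality. -/
theorem sq_dTV_le (u v : Ω → ℝ) (hu : ∀ a, 0 ≤ u a) (hv : ∀ a, 0 ≤ v a)
    (hu1 : ∑ a, u a = 1) (hv1 : ∑ a, v a = 1) (huv : ∀ a, v a = 0 → u a = 0) :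
    dTV u v ^ 2 ≤ ∑ a, u a * Real.log (u a / v a) := by
  have h1 : ∑ a, (√(u a) - √(v a)) ^ 2 ≤ ∑ a, u a * Real.log (u a / v a) := by
    calc ∑ a, (√(u a) - √(v a)) ^ 2
        ≤ ∑ a, (u a * Real.log (u a / v a) - u a + v a) :=
          Finset.sum_le_sum fun a _ => sq_sqrt_sub_sqrt_le (hu a) (hv a) (huv a)
      _ = _ := by rw [Finset.sum_add_distrib, Finset.sum_sub_distrib, hu1, hv1]; ring
  have h2 : ∑ a, (√(u a) + √(v a)) ^ 2 ≤ 4 := by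
    calc ∑ a, (√(u a) + √(v a)) ^ 2 ≤ ∑ a, (2 * u a + 2 * v a) :=
          Finset.sum_le_sum fun a _ => by
            have e1 := Real.sq_sqrt (hu a)
            have e2 := Real.sq_sqrt (hv a)
            nlinarith [sq_nonneg (√(u a) - √(v a))]
      _ = 4 := by
        rw [Finset.sum_add_distrib, ← Finset.mul_sum, ← Finset.mul_sum, hu1, hv1]; norm_num
  have h3 : ∑ a, |u a - v a| = ∑ a, |√(u a) - √(v a)| * (√(u a) + √(v a)) :=
    Finset.sum_congr rfl fun a _ => by
      have e1 := Real.sq_sqrt (hu a)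
      have e2 := Real.sq_sqrt (hv a)
      have e3 : 0 ≤ √(u a) + √(v a) := by positivity
      rw [show u a - v a = (√(u a) - √(v a)) * (√(u a) + √(v a)) by nlinarith, abs_mul,
        abs_of_nonneg e3]
  -- Cauchy-Schwarz for `|u - v| = |√u - √v| (√u + √v)`. The second factor contributes at most 4,
  -- which is offset by the square of the factor 1/2 in `dTV`.
  have h4 := Finset.sum_mul_sq_le_sq_mul_sq Finset.univ (fun a => |√(u a) - √(v a)|)
    (fun a => √(u a) + √(v a))
  simp only [sq_abs] at h4
  rw [← h3] at h4
  have h5 : 0 ≤ ∑ a, (√(u a) - √(v a)) ^ 2 := Finset.sum_nonneg fun _ _ => sq_nonneg _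
  rw [dTV]
  nlinarith

/-- Relative entropy is at most a multiple of the squared distance when the reference measure is
bounded below on its support. -/
theorem sum_mul_log_div_le (u v : Ω → ℝ) {b : ℝ} (hb : 0 < b) (hu : ∀ a, 0 ≤ u a)
    (hu1 : ∑ a, u a = 1) (hv1 : ∑ a, v a = 1) (huv : ∀ a, v a = 0 → u a = 0)
    (hvb : ∀ a, v a = 0 ∨ b ≤ v a) :
    ∑ a, u a * Real.log (u a / v a) ≤ b⁻¹ * ∑ a, (u a - v a) ^ 2 := by
  -- The inequality `log z ≤ z - 1` bounds the relative entropy by the chi-square distance, up to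
  -- the terms `u a - v a`, whose sum is zero.
  calc ∑ a, u a * Real.log (u a / v a)
      ≤ ∑ a, (b⁻¹ * (u a - v a) ^ 2 + u a - v a) := Finset.sum_le_sum fun a _ => by
        rcases hvb a with h | h
        · simp [h, huv a h]
        have hv : 0 < v a := hb.trans_le h
        rcases (hu a).eq_or_lt with h0 | h0
        · rw [← h0]
          have : 1 ≤ b⁻¹ * v a := by rw [← div_eq_inv_mul]; exact (one_le_div hb).2 h
          nlinarith
        have h1 : Real.log (u a / v a) ≤ u a / v a - 1 :=
          Real.log_le_sub_one_of_pos (by positivity)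
        have h2 : (u a - v a) ^ 2 / v a ≤ (u a - v a) ^ 2 / b := by gcongr
        calc u a * Real.log (u a / v a) ≤ u a * (u a / v a - 1) :=
              mul_le_mul_of_nonneg_left h1 h0.le
          _ = (u a - v a) ^ 2 / v a + u a - v a := by field_simp; ring
          _ ≤ _ := by rw [div_eq_inv_mul _ b] at h2; linarith
    _ = _ := by
      rw [Finset.sum_sub_distrib, Finset.sum_add_distrib, hu1, hv1, Finset.mul_sum]; ring

end MarkovChain

/-! ### Sums over the configurations with prescribed values off a set of sites -/

namespace SpinSystem

variable {I X : Type*} [Fintype I] [DecidableEq I] [Fintype X] [DecidableEq X]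

/-- The sum of `g` over all configurations which agree with `y` off `J`. -/
def blockSum (J : Finset I) (g : (I → X) → ℝ) (y : I → X) : ℝ :=
  ∑ x, if ∀ k, k ∉ J → x k = y k then g x else 0

/-- The sum of `g` over all spins at the site `i`. -/
def siteSum (i : I) (g : (I → X) → ℝ) (y : I → X) : ℝ :=
  ∑ a, g (Function.update y i a)

theorem blockSum_empty (g : (I → X) → ℝ) (y : I → X) : blockSum ∅ g y = g y := by
  simp [blockSum, ← funext_iff]

theorem blockSum_univ (g : (I → X) → ℝ) (y : I → X) :
    blockSum Finset.univ g y = ∑ x, g x := by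
  simp [blockSum]

theorem blockSum_eq_of_agree {J : Finset I} (g : (I → X) → ℝ) {x y : I → X}
    (h : ∀ k, k ∉ J → x k = y k) : blockSum J g x = blockSum J g y :=
  Finset.sum_congr rfl fun z _ => by
    have : (∀ k, k ∉ J → z k = x k) ↔ (∀ k, k ∉ J → z k = y k) :=
      forall₂_congr fun k hk => by rw [h k hk]
    simp only [this]

theorem blockSum_congr {J : Finset I} {g g' : (I → X) → ℝ} {y : I → X}
    (h : ∀ x, (∀ k, k ∉ J → x k = y k) → g x = g' x) : blockSum J g y = blockSum J g' y :=
  Finset.sum_congr rfl fun x _ => by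
    split_ifs with hx
    · exact h x hx
    · rfl

theorem blockSum_mono {J : Finset I} {g g' : (I → X) → ℝ} {y : I → X}
    (h : ∀ x, (∀ k, k ∉ J → x k = y k) → g x ≤ g' x) : blockSum J g y ≤ blockSum J g' y :=
  Finset.sum_le_sum fun x _ => by
    split_ifs with hx
    · exact h x hx
    · rfl

theorem blockSum_nonneg {J : Finset I} {g : (I → X) → ℝ} {y : I → X} (h : ∀ x, 0 ≤ g x) :
    0 ≤ blockSum J g y :=
  Finset.sum_nonneg fun x _ => by
    split_ifs
    · exact h x
    · rfl

theorem blockSum_add (J : Finset I) (g g' : (I → X) → ℝ) (y : I → X) :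
    blockSum J (fun x => g x + g' x) y = blockSum J g y + blockSum J g' y := by
  simp only [blockSum, ← Finset.sum_add_distrib]
  exact Finset.sum_congr rfl fun x _ => by split_ifs <;> simp

theorem blockSum_sub (J : Finset I) (g g' : (I → X) → ℝ) (y : I → X) :
    blockSum J (fun x => g x - g' x) y = blockSum J g y - blockSum J g' y := by
  simp only [blockSum, ← Finset.sum_sub_distrib]
  exact Finset.sum_congr rfl fun x _ => by split_ifs <;> simp

theorem blockSum_mul_const (J : Finset I) (g : (I → X) → ℝ) (c : ℝ) (y : I → X) :
    blockSum J (fun x => g x * c) y = blockSum J g y * c := by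
  simp only [blockSum, Finset.sum_mul, ite_mul, zero_mul]

theorem blockSum_const_mul (J : Finset I) (g : (I → X) → ℝ) (c : ℝ) (y : I → X) :
    blockSum J (fun x => c * g x) y = c * blockSum J g y := by
  simp only [blockSum, Finset.mul_sum, mul_ite, mul_zero]

theorem blockSum_sum {ι : Type*} (s : Finset ι) (J : Finset I) (g : ι → (I → X) → ℝ)
    (y : I → X) :
    blockSum J (fun x => ∑ i ∈ s, g i x) y = ∑ i ∈ s, blockSum J (g i) y := by
  simp only [blockSum]
  rw [Finset.sum_comm]
  exact Finset.sum_congr rfl fun x _ => by split_ifs <;> simp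

theorem blockSum_eq_zero_iff {J : Finset I} {g : (I → X) → ℝ} {y : I → X} (h : ∀ x, 0 ≤ g x) :
    blockSum J g y = 0 ↔ ∀ x, (∀ k, k ∉ J → x k = y k) → g x = 0 := by
  rw [blockSum, Finset.sum_eq_zero_iff_of_nonneg]
  · simp
  · intro x _
    split_ifs
    · exact h x
    · rfl

theorem le_blockSum {J : Finset I} {g : (I → X) → ℝ} (h : ∀ x, 0 ≤ g x) (y : I → X) :
    g y ≤ blockSum J g y := by
  have := Finset.single_le_sum (s := Finset.univ)
    (f := fun x => if ∀ k, k ∉ J → x k = y k then g x else 0)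
    (fun x _ => by split_ifs; exacts [h x, le_rfl]) (Finset.mem_univ y)
  simpa [blockSum] using this

/-- Changing the value of the boundary condition at a site outside the block. -/
theorem blockSum_update {J : Finset I} {i : I} (hi : i ∉ J) (g : (I → X) → ℝ) (y : I → X) (a : X) :
    blockSum J g (Function.update y i a) =
      blockSum J (fun x => g (Function.update x i a)) y := by
  simp only [blockSum, ← Finset.sum_filter]
  refine Finset.sum_bij' (fun x _ => Function.update x i (y i))
    (fun x _ => Function.update x i a) ?_ ?_ ?_ ?_ ?_
  · intro x hx
    simp only [Finset.mem_filter, Finset.mem_univ, true_and] at hx ⊢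
    intro k hk
    by_cases hki : k = i
    · subst hki; simp
    · simpa [hki] using hx k hk
  · intro x hx
    simp only [Finset.mem_filter, Finset.mem_univ, true_and] at hx ⊢
    intro k hk
    by_cases hki : k = i
    · subst hki; simp
    · simpa [hki] using hx k hk
  · intro x hx
    simp only [Finset.mem_filter, Finset.mem_univ, true_and] at hx
    have := hx i hi
    simp only [Function.update_self] at this
    simp [← this]
  · intro x hx
    simp only [Finset.mem_filter, Finset.mem_univ, true_and] at hx
    simp [← hx i hi]
  · intro x hx
    simp only [Finset.mem_filter, Finset.mem_univ, true_and] at hx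
    have := hx i hi
    simp only [Function.update_self] at this
    simp [← this]

theorem blockSum_eq_sum_update {J : Finset I} {i : I} (hi : i ∈ J) (g : (I → X) → ℝ)
    (y : I → X) :
    blockSum J g y = ∑ a, blockSum (J.erase i) g (Function.update y i a) := by
  simp only [blockSum]
  rw [Finset.sum_comm]
  refine Finset.sum_congr rfl fun x _ => ?_
  have : ∀ a, (∀ k, k ∉ J.erase i → x k = Function.update y i a k) ↔
      x i = a ∧ ∀ k, k ∉ J → x k = y k := fun a => by
    constructor
    · intro h
      refine ⟨by simpa using h i (by simp), fun k hk => ?_⟩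
      have hki : k ≠ i := fun h => hk (h ▸ hi)
      simpa [hki] using h k (by simp [hk])
    · rintro ⟨h1, h2⟩ k hk
      by_cases hki : k = i
      · subst hki; simp [h1]
      · simpa [hki] using h2 k (by simpa [hki] using hk)
  simp only [this]
  by_cases h : ∀ k, k ∉ J → x k = y k
  · have h' : ∀ a, (x i = a ∧ ∀ k, k ∉ J → x k = y k) ↔ x i = a := fun a => and_iff_left h
    simp only [if_pos h, h', Finset.sum_ite_eq, Finset.mem_univ, if_true]
  · simp [h]

theorem blockSum_eq_blockSum_siteSum {J : Finset I} {i : I} (hi : i ∈ J) (g : (I → X) → ℝ)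
    (y : I → X) : blockSum J g y = blockSum (J.erase i) (siteSum i g) y := by
  rw [blockSum_eq_sum_update hi]
  change _ = blockSum (J.erase i) (fun x => ∑ a, g (Function.update x i a)) y
  rw [blockSum_sum]
  exact Finset.sum_congr rfl fun a _ => blockSum_update (by simp) g y a

theorem blockSum_singleton (i : I) (g : (I → X) → ℝ) (y : I → X) :
    blockSum {i} g y = siteSum i g y := by
  rw [blockSum_eq_blockSum_siteSum (Finset.mem_singleton_self i), Finset.erase_singleton,
    blockSum_empty]

theorem siteSum_update (i : I) (g : (I → X) → ℝ) (y : I → X) (a : X) :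
    siteSum i g (Function.update y i a) = siteSum i g y := by
  simp [siteSum]

theorem siteSum_nonneg {i : I} {g : (I → X) → ℝ} {y : I → X} (h : ∀ x, 0 ≤ g x) :
    0 ≤ siteSum i g y :=
  Finset.sum_nonneg fun _ _ => h _

theorem le_siteSum {g : (I → X) → ℝ} (h : ∀ x, 0 ≤ g x) (i : I) (y : I → X) :
    g y ≤ siteSum i g y := by
  rw [← blockSum_singleton]; exact le_blockSum h y

/-- A block sum depends only on the site sums at a site of the block. -/
theorem blockSum_congr_siteSum {J : Finset I} {i : I} (hi : i ∈ J) {g g' : (I → X) → ℝ}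
    (h : ∀ x, siteSum i g x = siteSum i g' x) (y : I → X) : blockSum J g y = blockSum J g' y := by
  rw [blockSum_eq_blockSum_siteSum hi, blockSum_eq_blockSum_siteSum hi]
  exact blockSum_congr fun x _ => h x

end SpinSystem

/-! ### Dobrushin's comparison theorem -/

namespace SpinSystem

open MarkovChain

variable {I X : Type*} [Fintype I] [DecidableEq I] [Fintype X] [DecidableEq X]

/-- `κ i x` is a version of the conditional distribution of the spin at `i` under `q` given the other
spins of `x`, defined for all configurations `x`. -/
structure IsSpecification (q : (I → X) → ℝ) (κ : I → (I → X) → X → ℝ) : Prop where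
  nonneg : ∀ i x a, 0 ≤ κ i x a
  sum_eq_one : ∀ i x, ∑ a, κ i x a = 1
  update : ∀ i x b, κ i (Function.update x i b) = κ i x
  consistent : ∀ i x a, q (Function.update x i a) = κ i x a * siteSum i q x

/-- `A i j` bounds the influence of the spin at `j` on the conditional distribution at `i`, and the
rows and columns of `A` sum up to at most `1 - δ`. -/
structure IsDobrushin (κ : I → (I → X) → X → ℝ) (A : I → I → ℝ) (δ : ℝ) : Prop where
  pos : 0 < δ
  nonneg : ∀ i j, 0 ≤ A i j
  influence : ∀ i j x b, i ≠ j → dTV (κ i x) (κ i (Function.update x j b)) ≤ A i j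
  row : ∀ i, ∑ j, A i j ≤ 1 - δ
  col : ∀ j, ∑ i, A i j ≤ 1 - δ

/-- Normalized average of `g` over a block, with weights `q`. -/
noncomputable def blockAvg (J : Finset I) (q g : (I → X) → ℝ) (y : I → X) : ℝ :=
  blockSum J (fun x => q x * g x) y / blockSum J q y

/-- Averaging over the spin at the site `i`. -/
def siteAvg (κ : I → (I → X) → X → ℝ) (i : I) (g : (I → X) → ℝ) (x : I → X) : ℝ :=
  ∑ a, κ i x a * g (Function.update x i a)

/-- Resampling the spin at `i` from its conditional distribution preserves `q`. The identity holds
on each fibre of the site, hence also on every block containing `i`. -/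
theorem IsSpecification.siteSum_mul_siteAvg {q : (I → X) → ℝ} {κ : I → (I → X) → X → ℝ}
    (h : IsSpecification q κ) (i : I) (g : (I → X) → ℝ) (x : I → X) :
    siteSum i (fun x => q x * siteAvg κ i g x) x = siteSum i (fun x => q x * g x) x := by
  have : ∀ a, siteAvg κ i g (Function.update x i a) = siteAvg κ i g x := fun a => by
    simp [siteAvg, h.update]
  simp only [siteSum, this, ← Finset.sum_mul]
  simp only [siteAvg, Finset.mul_sum]
  refine Finset.sum_congr rfl fun a _ => ?_
  rw [h.consistent i x a]
  simp only [siteSum]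
  ring

/-- A change of the spin at `j` acts on the average in two ways: through the argument of `g`, at
cost `cj`, and through the distribution of the resampled spin, which moves by at most `A i j` and is
integrated against a function of oscillation at most `ci`. -/
theorem IsSpecification.abs_siteAvg_sub_le {q : (I → X) → ℝ} {κ : I → (I → X) → X → ℝ}
    (h : IsSpecification q κ) {A : I → I → ℝ} {δ : ℝ} (hA : IsDobrushin κ A δ)
    {g : (I → X) → ℝ} {ci cj : ℝ} {i j : I} (hij : i ≠ j)
    (hi : ∀ x b, |g x - g (Function.update x i b)| ≤ ci)
    (hj : ∀ x b, |g x - g (Function.update x j b)| ≤ cj) (x : I → X) (b : X) :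
    |siteAvg κ i g x - siteAvg κ i g (Function.update x j b)| ≤ cj + A i j * ci := by
  set x' := Function.update x j b
  have h0 : 0 ≤ ci := (abs_nonneg _).trans (hi x b)
  have e : siteAvg κ i g x - siteAvg κ i g x' =
      ∑ a, κ i x a * (g (Function.update x i a) - g (Function.update x' i a)) +
      (∑ a, κ i x a * g (Function.update x' i a) -
        ∑ a, κ i x' a * g (Function.update x' i a)) := by
    simp only [siteAvg, mul_sub, Finset.sum_sub_distrib]; ring
  rw [e]
  refine (abs_add_le _ _).trans (add_le_add ?_ ?_)
  · calc |∑ a, κ i x a * (g (Function.update x i a) - g (Function.update x' i a))|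
        ≤ ∑ a, κ i x a * cj := by
          refine (Finset.abs_sum_le_sum_abs _ _).trans (Finset.sum_le_sum fun a _ => ?_)
          rw [abs_mul, abs_of_nonneg (h.nonneg i x a)]
          refine mul_le_mul_of_nonneg_left ?_ (h.nonneg i x a)
          have := hj (Function.update x i a) b
          rwa [Function.update_comm hij] at this
      _ = cj := by rw [← Finset.sum_mul, h.sum_eq_one, one_mul]
  · refine (abs_sum_mul_sub_sum_mul_le _ _ _ ci (by rw [h.sum_eq_one, h.sum_eq_one]) ?_).trans ?_
    · intro a a'
      have := hi (Function.update x' i a) a'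
      simpa using this
    · exact mul_le_mul_of_nonneg_right (hA.influence i j x b hij) h0

/-- Telescoping over the sites of a block. -/
theorem abs_sub_le_sum_of_agree {g : (I → X) → ℝ} (c : I → ℝ) (J : Finset I)
    (hg : ∀ i ∈ J, ∀ x b, |g x - g (Function.update x i b)| ≤ c i) (x y : I → X)
    (hxy : ∀ k, k ∉ J → x k = y k) : |g x - g y| ≤ ∑ i ∈ J, c i := by
  induction J using Finset.induction_on generalizing x with
  | empty =>
    have : x = y := funext fun k => hxy k (by simp)
    simp [this]
  | insert i J hi ih =>
    rw [Finset.sum_insert hi]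
    have h1 := hg i (Finset.mem_insert_self i J) x (y i)
    have h2 := ih (fun j hj => hg j (Finset.mem_insert_of_mem hj)) (Function.update x i (y i))
      (fun k hk => by
        by_cases hki : k = i
        · subst hki; simp
        · simpa [hki] using hxy k (by simp [hki, hk]))
    calc |g x - g y| ≤ |g x - g (Function.update x i (y i))| +
          |g (Function.update x i (y i)) - g y| := abs_sub_le _ _ _
      _ ≤ _ := add_le_add h1 h2

theorem abs_blockAvg_sub_le {q g : (I → X) → ℝ} {J : Finset I} {y : I → X}
    (hq : ∀ x, 0 ≤ q x) (hQ : 0 < blockSum J q y) {r t : ℝ}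
    (hg : ∀ x, (∀ k, k ∉ J → x k = y k) → |g x - t| ≤ r) : |blockAvg J q g y - t| ≤ r := by
  have e : blockAvg J q g y - t = blockSum J (fun x => q x * (g x - t)) y / blockSum J q y := by
    simp only [mul_sub, blockSum_sub, blockSum_mul_const, blockAvg]
    field_simp
  rw [e, abs_div, abs_of_pos hQ, div_le_iff₀ hQ, mul_comm r, ← blockSum_mul_const, abs_le,
    ← neg_one_mul, ← blockSum_const_mul]
  constructor
  · refine blockSum_mono fun x hx => ?_
    have := (abs_le.1 (hg x hx)).1
    nlinarith [mul_le_mul_of_nonneg_left this (hq x)]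
  · refine blockSum_mono fun x hx => ?_
    exact mul_le_mul_of_nonneg_left (abs_le.1 (hg x hx)).2 (hq x)

/-- The distance between the conditional distribution under `p` and the specification. -/
noncomputable def siteDist (p : (I → X) → ℝ) (κ : I → (I → X) → X → ℝ) (i : I) (x : I → X) : ℝ :=
  dTV (fun a => p (Function.update x i a) / siteSum i p x) (κ i x)

theorem siteDist_update {q : (I → X) → ℝ} {κ : I → (I → X) → X → ℝ}
    (h : IsSpecification q κ) (p : (I → X) → ℝ) (i : I) (x : I → X) (a : X) :
    siteDist p κ i (Function.update x i a) = siteDist p κ i x := by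
  simp [siteDist, siteSum_update, h.update]

/-- `a` bounds the difference of the averages of `g` under `p` and `q` in terms of the
oscillations of `g`. -/
def IsEstimate (p q : (I → X) → ℝ) (J : Finset I) (y : I → X) (a : I → ℝ) : Prop :=
  ∀ (g : (I → X) → ℝ) (c : I → ℝ),
    (∀ i ∈ J, ∀ x b, |g x - g (Function.update x i b)| ≤ c i) →
    |blockAvg J p g y - blockAvg J q g y| ≤ ∑ i ∈ J, a i * c i

/-- Both averages lie within `∑ i ∈ J, c i` of `g y`. This crude estimate is the starting point of
the iteration leading to `exists_isEstimate`. -/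
theorem isEstimate_two {p q : (I → X) → ℝ} {J : Finset I} {y : I → X}
    (hp : ∀ x, 0 ≤ p x) (hq : ∀ x, 0 ≤ q x) (hP : 0 < blockSum J p y) (hQ : 0 < blockSum J q y) :
    IsEstimate p q J y (fun _ => 2) := fun g c hg => by
  have h1 := abs_blockAvg_sub_le (t := g y) hp hP
    (fun x hx => abs_sub_le_sum_of_agree c J hg x y hx)
  have h2 := abs_blockAvg_sub_le (t := g y) hq hQ
    (fun x hx => abs_sub_le_sum_of_agree c J hg x y hx)
  rw [← Finset.mul_sum, two_mul]
  rw [abs_sub_comm] at h2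
  exact (abs_sub_le _ (g y) _).trans (add_le_add h1 h2)

/-- Replacing `g` by its average over the spin at `i`. -/
theorem abs_blockAvg_sub_siteAvg_le {p q : (I → X) → ℝ} {κ : I → (I → X) → X → ℝ}
    (h : IsSpecification q κ) {J : Finset I} {y : I → X} {i : I} (hi : i ∈ J)
    (hp : ∀ x, 0 ≤ p x) (hP : 0 < blockSum J p y) {g : (I → X) → ℝ} {c : ℝ}
    (hg : ∀ x b, |g x - g (Function.update x i b)| ≤ c) :
    |blockAvg J p g y - blockAvg J p (siteAvg κ i g) y| ≤
      blockAvg J p (siteDist p κ i) y * c := by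
  -- `D` averages `g` with the conditional distribution of `p` at `i`, so `g` and `D` have the same
  -- `p`-average, while `D - siteAvg κ i g` integrates `g` against the difference of two conditional
  -- distributions. Where the denominator vanishes, `p` vanishes on the whole fibre and the value of
  -- `D` is immaterial.
  set D : (I → X) → ℝ := fun x =>
    ∑ a, p (Function.update x i a) / siteSum i p x * g (Function.update x i a) with hD
  have hDu : ∀ x a, D (Function.update x i a) = D x := fun x a => by
    simp [hD, siteSum_update]
  have e1 : blockSum J (fun x => p x * g x) y = blockSum J (fun x => p x * D x) y := by
    refine blockSum_congr_siteSum hi (fun x => ?_) y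
    simp only [siteSum, hDu, ← Finset.sum_mul]
    by_cases h0 : siteSum i p x = 0
    · have h1 : ∀ a, p (Function.update x i a) = 0 := fun a => by
        have := (Finset.sum_eq_zero_iff_of_nonneg (fun a _ => hp (Function.update x i a))).1 h0
        exact this a (Finset.mem_univ a)
      simp [h1]
    · rw [hD, Finset.mul_sum]
      refine Finset.sum_congr rfl fun a _ => ?_
      change _ = siteSum i p x * _
      field_simp
  have e2 : blockAvg J p g y - blockAvg J p (siteAvg κ i g) y =
      blockSum J (fun x => p x * (D x - siteAvg κ i g x)) y / blockSum J p y := by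
    simp only [blockAvg, e1, mul_sub, blockSum_sub, sub_div]
  have key : ∀ x, 0 < p x → |D x - siteAvg κ i g x| ≤ siteDist p κ i x * c := fun x hx => by
    have hs : 0 < siteSum i p x := hx.trans_le (le_siteSum hp i x)
    refine abs_sum_mul_sub_sum_mul_le _ _ _ c ?_ fun a a' => ?_
    · rw [h.sum_eq_one, ← Finset.sum_div]
      exact div_self hs.ne'
    · simpa using hg (Function.update x i a) a'
  rw [e2, blockAvg, div_mul_eq_mul_div, ← blockSum_mul_const, abs_div, abs_of_pos hP]
  refine div_le_div_of_nonneg_right ?_ hP.le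
  rw [abs_le, ← neg_one_mul, ← blockSum_const_mul]
  constructor
  · refine blockSum_mono fun x _ => ?_
    rcases (hp x).eq_or_lt with h0 | h0
    · simp [← h0]
    · nlinarith [(abs_le.1 (key x h0)).1]
  · refine blockSum_mono fun x _ => ?_
    rcases (hp x).eq_or_lt with h0 | h0
    · simp [← h0]
    · nlinarith [(abs_le.1 (key x h0)).2]

theorem blockAvg_siteAvg {q : (I → X) → ℝ} {κ : I → (I → X) → X → ℝ}
    (h : IsSpecification q κ) {J : Finset I} {i : I} (hi : i ∈ J) (g : (I → X) → ℝ) (y : I → X) :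
    blockAvg J q (siteAvg κ i g) y = blockAvg J q g y := by
  rw [blockAvg, blockAvg, blockSum_congr_siteSum hi (fun x => h.siteSum_mul_siteAvg i g x)]

/-- One step of the averaging dynamics improves an estimate. -/
theorem IsEstimate.step {p q : (I → X) → ℝ} {κ : I → (I → X) → X → ℝ}
    (h : IsSpecification q κ) {A : I → I → ℝ} {δ : ℝ} (hA : IsDobrushin κ A δ)
    {J : Finset I} {y : I → X} (hp : ∀ x, 0 ≤ p x) (hP : 0 < blockSum J p y) {a : I → ℝ}
    (ha : IsEstimate p q J y a) (ha0 : ∀ i, 0 ≤ a i) (hJ : J.Nonempty) :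
    IsEstimate p q J y (fun i => a i +
      (J.card : ℝ)⁻¹ * (blockAvg J p (siteDist p κ i) y + ∑ j ∈ J, A i j * a j - a i)) := by
  intro g c hg
  have hc : ∀ i ∈ J, 0 ≤ c i := fun i hi => (abs_nonneg _).trans (hg i hi y (y i))
  have key : ∀ i ∈ J, |blockAvg J p g y - blockAvg J q g y| ≤ ∑ j ∈ J, a j * c j +
      (blockAvg J p (siteDist p κ i) y + ∑ j ∈ J, A i j * a j - a i) * c i := by
    intro i hi
    have h1 := abs_blockAvg_sub_siteAvg_le h hi hp hP (hg i hi)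
    -- The averaged function does not depend on the spin at `i`, so its oscillation there is zero,
    -- and each other oscillation grows by at most `A i j * c i`.
    have h2 := ha (siteAvg κ i g) (fun j => if j = i then 0 else c j + A i j * c i)
      (fun j hj x b => by
        by_cases hji : j = i
        · subst hji
          simp [siteAvg, h.update]
        · simp only [hji, if_false]
          exact h.abs_siteAvg_sub_le hA (Ne.symm hji) (hg i hi) (hg j hj) x b)
    rw [blockAvg_siteAvg h hi] at h2
    have h3 : ∑ j ∈ J, a j * (if j = i then 0 else c j + A i j * c i) ≤
        ∑ j ∈ J, (a j * c j + A i j * a j * c i - if j = i then a i * c i else 0) := by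
      refine Finset.sum_le_sum fun j _ => ?_
      split_ifs with hji
      · subst hji
        nlinarith [mul_nonneg (mul_nonneg (hA.nonneg j j) (ha0 j)) (hc j hi)]
      · apply le_of_eq; ring
    rw [Finset.sum_sub_distrib, Finset.sum_add_distrib, Finset.sum_ite_eq' J i, if_pos hi,
      ← Finset.sum_mul] at h3
    have h4 := abs_sub_le (blockAvg J p g y) (blockAvg J p (siteAvg κ i g) y) (blockAvg J q g y)
    nlinarith
  have hm : (0 : ℝ) < J.card := by exact_mod_cast hJ.card_pos
  -- The bounds obtained from the different sites are averaged with equal weights, which distributes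
  -- the gain `- a i` over all `i ∈ J`.
  have h5 := Finset.sum_le_sum key
  rw [Finset.sum_const, nsmul_eq_mul, Finset.sum_add_distrib, Finset.sum_const, nsmul_eq_mul] at h5
  have h6 : |blockAvg J p g y - blockAvg J q g y| ≤ ∑ j ∈ J, a j * c j + (J.card : ℝ)⁻¹ *
      ∑ i ∈ J, (blockAvg J p (siteDist p κ i) y + ∑ j ∈ J, A i j * a j - a i) * c i := by
    rw [← mul_le_mul_iff_right₀ hm]
    rw [mul_add, mul_inv_cancel_left₀ hm.ne']
    exact h5
  refine h6.trans (le_of_eq ?_)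
  rw [Finset.mul_sum, ← Finset.sum_add_distrib]
  exact Finset.sum_congr rfl fun i _ => by ring

/-- Dobrushin's comparison theorem: there is an estimate which solves `a = b + A a`, where `b i` is
the average distance of the conditional distributions at the site `i`. -/
theorem exists_isEstimate {p q : (I → X) → ℝ} {κ : I → (I → X) → X → ℝ}
    (h : IsSpecification q κ) {A : I → I → ℝ} {δ : ℝ} (hA : IsDobrushin κ A δ)
    {J : Finset I} {y : I → X} (hp : ∀ x, 0 ≤ p x) (hq : ∀ x, 0 ≤ q x)
    (hP : 0 < blockSum J p y) (hQ : 0 < blockSum J q y) (hJ : J.Nonempty) :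
    ∃ a : I → ℝ, (∀ i, 0 ≤ a i) ∧ IsEstimate p q J y a ∧
      ∀ i ∈ J, a i = blockAvg J p (siteDist p κ i) y + ∑ j ∈ J, A i j * a j := by
  have hm : (1 : ℝ) ≤ J.card := by exact_mod_cast hJ.card_pos
  have hm0 : (0 : ℝ) < J.card := by linarith
  have hm1 : (J.card : ℝ)⁻¹ ≤ 1 := inv_le_one_of_one_le₀ hm
  have hmi : (0 : ℝ) < (J.card : ℝ)⁻¹ := inv_pos.2 hm0
  set m : ℝ := (J.card : ℝ)⁻¹ with hmdef
  set b : I → ℝ := fun i => blockAvg J p (siteDist p κ i) y with hb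
  have hb0 : ∀ i, 0 ≤ b i := fun i =>
    div_nonneg (blockSum_nonneg fun x => mul_nonneg (hp x) (dTV_nonneg _ _)) hP.le
  -- `T` is the improvement map of `IsEstimate.step`. It preserves the closed set `S` of nonnegative
  -- estimates and is a sup-norm contraction with constant `1 - m * δ` by the row sums; its fixed
  -- point is an estimate solving the equation. Coordinates off `J` play no role in an estimate and
  -- are set to zero so that `T` also contracts there.
  set T : (I → ℝ) → (I → ℝ) := fun a i =>
    if i ∈ J then a i + m * (b i + ∑ j ∈ J, A i j * a j - a i) else 0 with hT
  set S : Set (I → ℝ) := {a | (∀ i, 0 ≤ a i) ∧ IsEstimate p q J y a} with hS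
  have hSc : IsComplete S := by
    refine IsClosed.isComplete ?_
    have : S = (⋂ i, {a : I → ℝ | 0 ≤ a i}) ∩ ⋂ (g : (I → X) → ℝ) (c : I → ℝ)
        (_ : ∀ i ∈ J, ∀ x b, |g x - g (Function.update x i b)| ≤ c i),
        {a : I → ℝ | |blockAvg J p g y - blockAvg J q g y| ≤ ∑ i ∈ J, a i * c i} := by
      ext a; simp [hS, IsEstimate]
    rw [this]
    refine (isClosed_iInter fun i => isClosed_le continuous_const (continuous_apply i)).inter ?_
    refine isClosed_iInter fun g => isClosed_iInter fun c => isClosed_iInter fun _ => ?_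
    exact isClosed_le continuous_const (by fun_prop)
  have hTS : Set.MapsTo T S S := by
    rintro a ⟨ha0, ha⟩
    constructor
    · intro i
      simp only [hT]
      split_ifs
      · have : 0 ≤ ∑ j ∈ J, A i j * a j :=
          Finset.sum_nonneg fun j _ => mul_nonneg (hA.nonneg i j) (ha0 j)
        nlinarith [ha0 i, hb0 i, mul_nonneg (sub_nonneg.2 hm1) (ha0 i)]
      · rfl
    · intro g c hg
      refine (IsEstimate.step h hA hp hP ha ha0 hJ g c hg).trans (le_of_eq ?_)
      exact Finset.sum_congr rfl fun i hi => by simp only [hT, if_pos hi, hb, hmdef]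
  have hδ : δ ≤ 1 := by
    obtain ⟨i, hi⟩ := hJ
    have := (Finset.sum_nonneg fun j _ => hA.nonneg i j).trans (hA.row i)
    linarith
  have hr0 : 0 ≤ 1 - m * δ := by nlinarith [hA.pos]
  have hr1 : 1 - m * δ < 1 := by nlinarith [mul_pos hmi hA.pos]
  have hrow : ∀ i, ∑ j ∈ J, A i j ≤ 1 - δ := fun i =>
    (Finset.sum_le_sum_of_subset_of_nonneg (Finset.subset_univ J)
      fun j _ _ => hA.nonneg i j).trans (hA.row i)
  have hlip : LipschitzWith (Real.toNNReal (1 - m * δ)) T := by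
    refine LipschitzWith.of_dist_le_mul fun a a' => ?_
    rw [Real.coe_toNNReal _ hr0]
    refine (dist_pi_le_iff (mul_nonneg hr0 dist_nonneg)).2 fun i => ?_
    simp only [hT]
    have hd : ∀ j, |a j - a' j| ≤ dist a a' := fun j => by
      rw [← Real.dist_eq]; exact dist_le_pi_dist a a' j
    split_ifs
    · rw [Real.dist_eq]
      have e : a i + m * (b i + ∑ j ∈ J, A i j * a j - a i) -
          (a' i + m * (b i + ∑ j ∈ J, A i j * a' j - a' i)) =
          (1 - m) * (a i - a' i) + m * ∑ j ∈ J, A i j * (a j - a' j) := by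
        simp only [mul_sub, Finset.sum_sub_distrib]; ring
      rw [e]
      have h1 : |∑ j ∈ J, A i j * (a j - a' j)| ≤ (1 - δ) * dist a a' := by
        calc |∑ j ∈ J, A i j * (a j - a' j)| ≤ ∑ j ∈ J, A i j * dist a a' := by
              refine (Finset.abs_sum_le_sum_abs _ _).trans (Finset.sum_le_sum fun j _ => ?_)
              rw [abs_mul, abs_of_nonneg (hA.nonneg i j)]
              exact mul_le_mul_of_nonneg_left (hd j) (hA.nonneg i j)
          _ ≤ _ := by
              rw [← Finset.sum_mul]
              exact mul_le_mul_of_nonneg_right (hrow i) dist_nonneg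
      calc |(1 - m) * (a i - a' i) + m * ∑ j ∈ J, A i j * (a j - a' j)|
          ≤ (1 - m) * |a i - a' i| + m * |∑ j ∈ J, A i j * (a j - a' j)| := by
            refine (abs_add_le _ _).trans (le_of_eq ?_)
            rw [abs_mul, abs_mul, abs_of_nonneg (sub_nonneg.2 hm1), abs_of_pos hmi]
        _ ≤ (1 - m) * dist a a' + m * ((1 - δ) * dist a a') :=
            add_le_add (mul_le_mul_of_nonneg_left (hd i) (sub_nonneg.2 hm1))
              (mul_le_mul_of_nonneg_left h1 hmi.le)
        _ = _ := by ring
    · rw [dist_self]; exact mul_nonneg hr0 dist_nonneg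
  have hcon : ContractingWith (Real.toNNReal (1 - m * δ)) (hTS.restrict T S S) := by
    refine ⟨?_, fun x y => hlip x y⟩
    rw [← NNReal.coe_lt_coe, Real.coe_toNNReal _ hr0]
    exact_mod_cast hr1
  have h2 : (fun _ => 2 : I → ℝ) ∈ S := ⟨fun _ => by norm_num, isEstimate_two hp hq hP hQ⟩
  obtain ⟨a, ⟨ha0, ha⟩, hfix, -⟩ := hcon.exists_fixedPoint' hSc hTS h2 (edist_ne_top _ _)
  refine ⟨a, ha0, ha, fun i hi => ?_⟩
  have h3 : T a i = a i := congrFun hfix i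
  simp only [hT, if_pos hi] at h3
  have h4 : m * (b i + ∑ j ∈ J, A i j * a j - a i) = 0 := by linarith
  rcases mul_eq_zero.1 h4 with h5 | h5
  · exact absurd h5 hmi.ne'
  · simp only [hb] at h5; linarith

/-- The solution of `a = b + A a` is bounded in `ℓ²`. -/
theorem sum_sq_le_of_eq_add {A : I → I → ℝ} {δ : ℝ} {J : Finset I} {a b : I → ℝ} (hδ : 0 < δ)
    (hA0 : ∀ i j, 0 ≤ A i j) (hrow : ∀ i, ∑ j, A i j ≤ 1 - δ) (hcol : ∀ j, ∑ i, A i j ≤ 1 - δ)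
    (hab : ∀ i ∈ J, a i = b i + ∑ j ∈ J, A i j * a j) :
    ∑ i ∈ J, a i ^ 2 ≤ (δ ^ 2)⁻¹ * ∑ i ∈ J, b i ^ 2 := by
  have hrow' : ∀ i, ∑ j ∈ J, A i j ≤ 1 - δ := fun i =>
    (Finset.sum_le_sum_of_subset_of_nonneg (Finset.subset_univ J)
      fun j _ _ => hA0 i j).trans (hrow i)
  have hcol' : ∀ j, ∑ i ∈ J, A i j ≤ 1 - δ := fun j =>
    (Finset.sum_le_sum_of_subset_of_nonneg (Finset.subset_univ J)
      fun i _ _ => hA0 i j).trans (hcol j)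
  -- Schur's test: pair the equation with `a` and use `a i * a j ≤ (a i ^ 2 + a j ^ 2) / 2`. Row
  -- sums control the first half and column sums the second, so the quadratic form of `A` is at most
  -- `1 - δ` times the square norm.
  have h1 : ∑ i ∈ J, a i ^ 2 ≤ ∑ i ∈ J, a i * b i +
      ∑ i ∈ J, ∑ j ∈ J, (A i j * a i ^ 2 / 2 + A i j * a j ^ 2 / 2) := by
    rw [← Finset.sum_add_distrib]
    refine Finset.sum_le_sum fun i hi => ?_
    have e : a i ^ 2 = a i * b i + ∑ j ∈ J, A i j * (a i * a j) := by
      nth_rewrite 1 [sq, hab i hi]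
      rw [add_mul, mul_comm (b i), Finset.sum_mul]
      congr 1
      exact Finset.sum_congr rfl fun j _ => by ring
    refine e.le.trans (add_le_add le_rfl (Finset.sum_le_sum fun j _ => ?_))
    nlinarith [mul_nonneg (hA0 i j) (sq_nonneg (a i - a j))]
  have h2 : ∑ i ∈ J, ∑ j ∈ J, A i j * a i ^ 2 / 2 ≤ (1 - δ) / 2 * ∑ i ∈ J, a i ^ 2 := by
    rw [Finset.mul_sum]
    refine Finset.sum_le_sum fun i _ => ?_
    rw [← Finset.sum_div, ← Finset.sum_mul]
    nlinarith [mul_le_mul_of_nonneg_right (hrow' i) (sq_nonneg (a i))]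
  have h3 : ∑ i ∈ J, ∑ j ∈ J, A i j * a j ^ 2 / 2 ≤ (1 - δ) / 2 * ∑ i ∈ J, a i ^ 2 := by
    rw [Finset.sum_comm, Finset.mul_sum]
    refine Finset.sum_le_sum fun j _ => ?_
    rw [← Finset.sum_div, ← Finset.sum_mul]
    nlinarith [mul_le_mul_of_nonneg_right (hcol' j) (sq_nonneg (a j))]
  simp only [Finset.sum_add_distrib] at h1
  -- Young's inequality weighted so that half of the gap `δ` absorbs the `a`-part.
  have h4 : ∑ i ∈ J, a i * b i ≤ δ / 2 * ∑ i ∈ J, a i ^ 2 + 1 / (2 * δ) * ∑ i ∈ J, b i ^ 2 := by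
    rw [Finset.mul_sum, Finset.mul_sum, ← Finset.sum_add_distrib]
    refine Finset.sum_le_sum fun i _ => ?_
    have : δ / 2 * a i ^ 2 + 1 / (2 * δ) * b i ^ 2 - a i * b i = (δ * a i - b i) ^ 2 / (2 * δ) := by
      field_simp; ring
    have h5 : 0 ≤ (δ * a i - b i) ^ 2 / (2 * δ) := by positivity
    linarith
  have h6 : δ / 2 * ∑ i ∈ J, a i ^ 2 ≤ 1 / (2 * δ) * ∑ i ∈ J, b i ^ 2 := by linarith
  have h7 : 2 / δ * (δ / 2 * ∑ i ∈ J, a i ^ 2) ≤ 2 / δ * (1 / (2 * δ) * ∑ i ∈ J, b i ^ 2) :=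
    mul_le_mul_of_nonneg_left h6 (by positivity)
  calc ∑ i ∈ J, a i ^ 2 = 2 / δ * (δ / 2 * ∑ i ∈ J, a i ^ 2) := by field_simp
    _ ≤ _ := h7
    _ = _ := by field_simp

end SpinSystem

/-! ### Approximate tensorization of entropy -/

namespace SpinSystem

open MarkovChain

variable {I X : Type*} [Fintype I] [DecidableEq I] [Fintype X] [DecidableEq X]

/-- In each system obtained by pinning the spins off `J`, the probability of a spin at a site is
either zero or at least `b`. -/
def MarginalLowerBound (q : (I → X) → ℝ) (b : ℝ) : Prop :=
  ∀ (J : Finset I) (y : I → X), ∀ i ∈ J, ∀ a,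
    blockSum (J.erase i) q (Function.update y i a) = 0 ∨
      b * blockSum J q y ≤ blockSum (J.erase i) q (Function.update y i a)

/-- The density of the entropy of `f` within the blocks of `J`. -/
noncomputable def localEnt (q f : (I → X) → ℝ) (J : Finset I) (x : I → X) : ℝ :=
  q x * f x * (Real.log (f x) - Real.log (blockAvg J q f x))

theorem blockAvg_eq_of_agree {J : Finset I} (q g : (I → X) → ℝ) {x y : I → X}
    (h : ∀ k, k ∉ J → x k = y k) : blockAvg J q g x = blockAvg J q g y := by
  rw [blockAvg, blockAvg, blockSum_eq_of_agree _ h, blockSum_eq_of_agree _ h]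

theorem blockSum_mul_eq_zero {J : Finset I} {q f : (I → X) → ℝ} {y : I → X} (hq : ∀ x, 0 ≤ q x)
    (h : blockSum J q y = 0) : blockSum J (fun x => q x * f x) y = 0 := by
  rw [blockSum_eq_zero_iff hq] at h
  rw [blockSum_congr (g' := fun _ => 0) fun x hx => by rw [h x hx, zero_mul]]
  simp [blockSum]

theorem blockSum_mul_pos {J : Finset I} {q f : (I → X) → ℝ} {y : I → X} (hq : ∀ x, 0 ≤ q x)
    (hf : ∀ x, 0 < f x) (h : 0 < blockSum J q y) : 0 < blockSum J (fun x => q x * f x) y := by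
  have hp : ∀ x, 0 ≤ q x * f x := fun x => mul_nonneg (hq x) (hf x).le
  refine lt_of_le_of_ne (blockSum_nonneg hp) fun h0 => h.ne' ?_
  rw [blockSum_eq_zero_iff hq]
  intro x hx
  have := (blockSum_eq_zero_iff hp).1 h0.symm x hx
  exact (mul_eq_zero.1 this).resolve_right (hf x).ne'

theorem blockSum_localEnt_eq_zero {J K : Finset I} {q f : (I → X) → ℝ} {y : I → X}
    (hq : ∀ x, 0 ≤ q x) (h : blockSum J q y = 0) : blockSum J (localEnt q f K) y = 0 := by
  rw [← blockSum_mul_eq_zero (f := fun x => f x * (Real.log (f x) -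
    Real.log (blockAvg K q f x))) hq h]
  exact blockSum_congr fun x _ => by rw [localEnt]; ring

/-- Pinsker's inequality for the conditional distributions. -/
theorem siteSum_siteDist_sq_le {q f : (I → X) → ℝ} {κ : I → (I → X) → X → ℝ}
    (h : IsSpecification q κ) (hq : ∀ x, 0 ≤ q x) (hf : ∀ x, 0 < f x) (i : I) (x : I → X) :
    siteSum i (fun x => q x * f x * siteDist (fun x => q x * f x) κ i x ^ 2) x ≤
      siteSum i (localEnt q f {i}) x := by
  have hp : ∀ x, 0 ≤ q x * f x := fun x => mul_nonneg (hq x) (hf x).le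
  rcases (siteSum_nonneg (i := i) (y := x) hq).eq_or_lt with h0 | h0
  · have h1 : ∀ a, q (Function.update x i a) = 0 := fun a => by
      rw [h.consistent, ← h0, mul_zero]
    simp [siteSum, localEnt, h1]
  set P := siteSum i (fun x => q x * f x) x with hPdef
  have hP : 0 < P := by
    rw [hPdef, ← blockSum_singleton]
    exact blockSum_mul_pos hq hf (by rwa [blockSum_singleton])
  have h1 : siteSum i (fun x => q x * f x * siteDist (fun x => q x * f x) κ i x ^ 2) x =
      P * siteDist (fun x => q x * f x) κ i x ^ 2 := by
    rw [hPdef]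
    simp only [siteSum, siteDist_update h, Finset.sum_mul]
  have h2 : siteDist (fun x => q x * f x) κ i x ^ 2 ≤ _ :=
    sq_dTV_le (fun a => q (Function.update x i a) * f (Function.update x i a) / P) (κ i x)
      (fun a => div_nonneg (hp _) hP.le) (h.nonneg i x)
      (by rw [← Finset.sum_div]; exact div_self hP.ne') (h.sum_eq_one i x)
      (fun a ha => by rw [h.consistent, ha]; simp)
  rw [h1]
  refine (mul_le_mul_of_nonneg_left h2 hP.le).trans (le_of_eq ?_)
  rw [Finset.mul_sum, siteSum]
  refine Finset.sum_congr rfl fun a _ => ?_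
  rw [localEnt, blockAvg, blockSum_singleton, blockSum_singleton, siteSum_update, siteSum_update,
    ← hPdef]
  rcases (hq (Function.update x i a)).eq_or_lt with h3 | h3
  · simp [← h3]
  have h4 : κ i x a = q (Function.update x i a) / siteSum i q x := by
    rw [h.consistent]; field_simp
  have h5 := hf (Function.update x i a)
  rw [← Real.log_div h5.ne' (by positivity), h4]
  have h6 : q (Function.update x i a) * f (Function.update x i a) / P /
      (q (Function.update x i a) / siteSum i q x) =
      f (Function.update x i a) / (P / siteSum i q x) := by
    field_simp
  rw [h6]
  field_simp

/-- The entropy of a one-site marginal is controlled by the distance of the marginals. -/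
theorem blockSum_log_blockAvg_sub_le {q f : (I → X) → ℝ} {b : ℝ} (hb : 0 < b)
    (hmarg : MarginalLowerBound q b) (hq : ∀ x, 0 ≤ q x) (hf : ∀ x, 0 < f x) {J : Finset I}
    {y : I → X} {i : I} (hi : i ∈ J) (hQ : 0 < blockSum J q y) :
    blockSum J (fun x => q x * f x *
      (Real.log (blockAvg (J.erase i) q f x) - Real.log (blockAvg J q f x))) y ≤
      blockSum J (fun x => q x * f x) y * (b⁻¹ * ∑ a,
        (blockSum (J.erase i) (fun x => q x * f x) (Function.update y i a) /
            blockSum J (fun x => q x * f x) y -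
          blockSum (J.erase i) q (Function.update y i a) / blockSum J q y) ^ 2) := by
  have hp : ∀ x, 0 ≤ q x * f x := fun x => mul_nonneg (hq x) (hf x).le
  have hP := blockSum_mul_pos hq hf hQ
  set P := blockSum J (fun x => q x * f x) y with hPdef
  set Q := blockSum J q y with hQdef
  set Pa : X → ℝ := fun a => blockSum (J.erase i) (fun x => q x * f x) (Function.update y i a)
    with hPa
  set Qa : X → ℝ := fun a => blockSum (J.erase i) q (Function.update y i a) with hQa
  have hPaQa : ∀ a, Qa a = 0 → Pa a = 0 := fun a ha => blockSum_mul_eq_zero hq ha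
  have hPa0 : ∀ a, 0 ≤ Pa a := fun a => blockSum_nonneg hp
  have hQa0 : ∀ a, 0 ≤ Qa a := fun a => blockSum_nonneg hq
  have hPs : ∑ a, Pa a = P := (blockSum_eq_sum_update hi _ y).symm
  have hQs : ∑ a, Qa a = Q := (blockSum_eq_sum_update hi _ y).symm
  -- Up to the total mass `P`, the left side is the relative entropy of the law of the spin at `i`
  -- under `q f` with respect to its law under `q`.
  have e : blockSum J (fun x => q x * f x *
      (Real.log (blockAvg (J.erase i) q f x) - Real.log (blockAvg J q f x))) y =
      P * ∑ a, Pa a / P * Real.log (Pa a / P / (Qa a / Q)) := by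
    rw [blockSum_eq_sum_update hi, Finset.mul_sum]
    refine Finset.sum_congr rfl fun a _ => ?_
    have e1 : blockSum (J.erase i) (fun x => q x * f x *
        (Real.log (blockAvg (J.erase i) q f x) - Real.log (blockAvg J q f x)))
          (Function.update y i a) = Pa a * (Real.log (Pa a / Qa a) - Real.log (P / Q)) := by
      rw [hPa, ← blockSum_mul_const]
      refine blockSum_congr fun x hx => ?_
      rw [blockAvg_eq_of_agree q f hx, blockAvg_eq_of_agree (x := x) (y := y) q f fun k hk => ?_]
      · rfl
      · have hki : k ≠ i := fun h => hk (h ▸ hi)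
        simpa [hki] using hx k (by simp [hk])
    rw [e1]
    rcases (hPa0 a).eq_or_lt with h0 | h0
    · simp [← h0]
    have h1 : 0 < Qa a := lt_of_le_of_ne (hQa0 a) fun h => h0.ne' (hPaQa a h.symm)
    rw [← Real.log_div (by positivity) (by positivity)]
    have h2 : Pa a / P / (Qa a / Q) = Pa a / Qa a / (P / Q) := by field_simp
    rw [h2]
    field_simp
  rw [e]
  refine mul_le_mul_of_nonneg_left (sum_mul_log_div_le _ _ hb (fun a => ?_) ?_ ?_ ?_ ?_) hP.le
  · exact div_nonneg (hPa0 a) hP.le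
  · rw [← Finset.sum_div, hPs, div_self hP.ne']
  · rw [← Finset.sum_div, hQs, div_self hQ.ne']
  · intro a ha
    rcases div_eq_zero_iff.1 ha with h | h
    · rw [hPaQa a h, zero_div]
    · exact absurd h hQ.ne'
  · intro a
    rcases hmarg J y i hi a with h | h
    · left; simp only [hQa, h, zero_div]
    · right; rwa [le_div_iff₀ hQ]

theorem blockAvg_indicator {J : Finset I} {i : I} (hi : i ∈ J) (p : (I → X) → ℝ) (y : I → X)
    (a : X) : blockAvg J p (fun x => if x i = a then 1 else 0) y =
      blockSum (J.erase i) p (Function.update y i a) / blockSum J p y := by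
  rw [blockAvg, blockSum_eq_blockSum_siteSum hi, blockSum_update (Finset.notMem_erase i J)]
  congr 1
  refine blockSum_congr fun x _ => ?_
  simp [siteSum]

/-- Under Dobrushin's condition the marginals of a density are close to those of `q`, on average,
if the conditional distributions are. -/
theorem sum_sq_marginal_sub_le {p q : (I → X) → ℝ} {κ : I → (I → X) → X → ℝ}
    (h : IsSpecification q κ) {A : I → I → ℝ} {δ : ℝ} (hA : IsDobrushin κ A δ)
    {J : Finset I} {y : I → X} (hp : ∀ x, 0 ≤ p x) (hq : ∀ x, 0 ≤ q x)
    (hP : 0 < blockSum J p y) (hQ : 0 < blockSum J q y) :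
    blockSum J p y * ∑ i ∈ J, ∑ a, (blockSum (J.erase i) p (Function.update y i a) / blockSum J p y -
        blockSum (J.erase i) q (Function.update y i a) / blockSum J q y) ^ 2 ≤
      Fintype.card X * (δ ^ 2)⁻¹ * ∑ i ∈ J, blockSum J (fun x => p x * siteDist p κ i x ^ 2) y := by
  rcases J.eq_empty_or_nonempty with rfl | hJ
  · simp
  obtain ⟨a, ha0, ha, hab⟩ := exists_isEstimate h hA hp hq hP hQ hJ
  have h1 : ∀ i ∈ J, ∀ s, (blockSum (J.erase i) p (Function.update y i s) / blockSum J p y -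
        blockSum (J.erase i) q (Function.update y i s) / blockSum J q y) ^ 2 ≤ a i ^ 2 := by
    intro i hi s
    rw [← blockAvg_indicator hi, ← blockAvg_indicator hi, ← sq_abs]
    refine pow_le_pow_left₀ (abs_nonneg _) ?_ 2
    -- The indicator of the spin `s` at `i` oscillates only at `i`, and by at most 1, so its
    -- estimate is `a i`.
    refine (ha _ (fun j => if j = i then 1 else 0) fun j hj x b => ?_).trans (le_of_eq ?_)
    · by_cases hji : j = i
      · simp only [if_pos hji]
        split_ifs <;> simp
      · simp [hji, Function.update_of_ne (Ne.symm hji)]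
    · simp [hi]
  have h2 := sum_sq_le_of_eq_add hA.pos hA.nonneg hA.row hA.col hab
  -- Nonnegativity of a variance bounds the squared mean of the distance by the mean of its square,
  -- to which Pinsker's inequality applies.
  have h3 : ∀ i, blockSum J p y * blockAvg J p (siteDist p κ i) y ^ 2 ≤
      blockSum J (fun x => p x * siteDist p κ i x ^ 2) y := by
    intro i
    set m := blockAvg J p (siteDist p κ i) y with hm
    have e : blockSum J (fun x => p x * siteDist p κ i x) y = m * blockSum J p y := by
      rw [hm, blockAvg]; field_simp
    have h4 : 0 ≤ blockSum J (fun x => p x * (siteDist p κ i x - m) ^ 2) y :=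
      blockSum_nonneg fun x => mul_nonneg (hp x) (sq_nonneg _)
    have e2 : (fun x => p x * (siteDist p κ i x - m) ^ 2) = fun x =>
        p x * siteDist p κ i x ^ 2 - p x * siteDist p κ i x * (2 * m) + p x * m ^ 2 := by
      ext x; ring
    rw [e2, blockSum_add, blockSum_sub, blockSum_mul_const, blockSum_mul_const, e] at h4
    nlinarith
  have h5 : ∑ i ∈ J, ∑ s, (blockSum (J.erase i) p (Function.update y i s) / blockSum J p y -
        blockSum (J.erase i) q (Function.update y i s) / blockSum J q y) ^ 2 ≤
      Fintype.card X * ((δ ^ 2)⁻¹ * ∑ i ∈ J, blockAvg J p (siteDist p κ i) y ^ 2) := by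
    refine le_trans ?_ (mul_le_mul_of_nonneg_left h2 (Nat.cast_nonneg _))
    rw [Finset.mul_sum]
    refine Finset.sum_le_sum fun i hi => ?_
    refine (Finset.sum_le_sum fun s _ => h1 i hi s).trans (le_of_eq ?_)
    simp
  have h6 := Finset.sum_le_sum fun i (_ : i ∈ J) => h3 i
  rw [← Finset.mul_sum] at h6
  have h7 : (0 : ℝ) ≤ Fintype.card X * (δ ^ 2)⁻¹ := by positivity
  calc _ ≤ blockSum J p y * (Fintype.card X * ((δ ^ 2)⁻¹ *
        ∑ i ∈ J, blockAvg J p (siteDist p κ i) y ^ 2)) := mul_le_mul_of_nonneg_left h5 hP.le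
    _ = Fintype.card X * (δ ^ 2)⁻¹ * (blockSum J p y *
        ∑ i ∈ J, blockAvg J p (siteDist p κ i) y ^ 2) := by ring
    _ ≤ _ := mul_le_mul_of_nonneg_left h6 h7

/-- Approximate tensorization of entropy, in all pinned systems. -/
theorem blockSum_localEnt_le {q f : (I → X) → ℝ} {κ : I → (I → X) → X → ℝ}
    (h : IsSpecification q κ) {A : I → I → ℝ} {δ b : ℝ} (hA : IsDobrushin κ A δ) (hb : 0 < b)
    (hmarg : MarginalLowerBound q b) (hq : ∀ x, 0 ≤ q x) (hf : ∀ x, 0 < f x) (J : Finset I)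
    (y : I → X) :
    blockSum J (localEnt q f J) y ≤
      Fintype.card X * (b * δ ^ 2)⁻¹ * ∑ j ∈ J, blockSum J (localEnt q f {j}) y := by
  set K : ℝ := Fintype.card X * (b * δ ^ 2)⁻¹ with hK
  induction hn : J.card generalizing J y with
  | zero =>
    rw [Finset.card_eq_zero] at hn
    subst hn
    simp only [blockSum_empty, Finset.sum_empty, mul_zero, localEnt, blockAvg]
    rcases eq_or_ne (q y) 0 with h0 | h0
    · simp [h0]
    · rw [mul_div_cancel_left₀ _ h0, sub_self, mul_zero]
  | succ n ih =>
    have hp : ∀ x, 0 ≤ q x * f x := fun x => mul_nonneg (hq x) (hf x).le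
    rcases (blockSum_nonneg (J := J) (y := y) hq).eq_or_lt with h0 | hQ
    · simp [blockSum_localEnt_eq_zero hq h0.symm]
    have hP := blockSum_mul_pos hq hf hQ
    set T : ℝ := ∑ j ∈ J, blockSum J (localEnt q f {j}) y with hT
    have hKb : K = b⁻¹ * (Fintype.card X * (δ ^ 2)⁻¹) := by
      rw [hK, mul_inv]; ring
    -- the chain rule
    have h1 : ∀ i ∈ J, blockSum J (localEnt q f J) y =
        blockSum J (localEnt q f (J.erase i)) y + blockSum J (fun x => q x * f x *
          (Real.log (blockAvg (J.erase i) q f x) - Real.log (blockAvg J q f x))) y := by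
      intro i _
      rw [← blockSum_add]
      exact blockSum_congr fun x _ => by rw [localEnt, localEnt]; ring
    -- The induction hypothesis is applied after pinning the spin at `i` to each value `a`; this is
    -- why the statement ranges over all boundary conditions `y`.
    have h2 : ∀ i ∈ J, blockSum J (localEnt q f (J.erase i)) y ≤
        K * (T - blockSum J (localEnt q f {i}) y) := by
      intro i hi
      have e : T - blockSum J (localEnt q f {i}) y =
          ∑ j ∈ J.erase i, ∑ a, blockSum (J.erase i) (localEnt q f {j})
            (Function.update y i a) := by
        rw [hT, ← Finset.add_sum_erase _ _ hi, add_sub_cancel_left]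
        exact Finset.sum_congr rfl fun j _ => blockSum_eq_sum_update hi _ y
      rw [e, blockSum_eq_sum_update hi, Finset.sum_comm, Finset.mul_sum]
      refine Finset.sum_le_sum fun a _ => ih (J.erase i) (Function.update y i a) ?_
      rw [Finset.card_erase_of_mem hi, hn]; rfl
    -- The marginal entropies together cost at most `K * T`: entropy to squared distance with factor
    -- `b⁻¹`, Dobrushin comparison with factor `|X| / δ ^ 2`, and Pinsker back to the local
    -- entropies.
    have h3 : ∑ i ∈ J, blockSum J (fun x => q x * f x *
          (Real.log (blockAvg (J.erase i) q f x) - Real.log (blockAvg J q f x))) y ≤ K * T := by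
      refine (Finset.sum_le_sum fun i hi =>
        blockSum_log_blockAvg_sub_le hb hmarg hq hf hi hQ).trans ?_
      rw [← Finset.mul_sum, ← Finset.mul_sum, mul_left_comm, hKb, mul_assoc]
      refine mul_le_mul_of_nonneg_left ?_ (inv_nonneg.2 hb.le)
      refine (sum_sq_marginal_sub_le h hA hp hq hP hQ).trans ?_
      refine mul_le_mul_of_nonneg_left (Finset.sum_le_sum fun i hi => ?_) (by positivity)
      rw [blockSum_eq_blockSum_siteSum hi, blockSum_eq_blockSum_siteSum hi]
      exact blockSum_mono fun x _ => siteSum_siteDist_sq_le h hq hf i x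
    -- Each site is missing from exactly one of the blocks `J.erase i`, so the induction leaves one
    -- unused copy of `K * T`. It pays for `h3` exactly, and the constant does not grow with the
    -- block.
    have h4 : ∑ i ∈ J, blockSum J (localEnt q f J) y ≤ K * (J.card * T - T) + K * T := by
      rw [Finset.sum_congr rfl h1, Finset.sum_add_distrib]
      refine add_le_add ((Finset.sum_le_sum h2).trans (le_of_eq ?_)) h3
      rw [← Finset.mul_sum, Finset.sum_sub_distrib, Finset.sum_const, nsmul_eq_mul]
    rw [Finset.sum_const, nsmul_eq_mul] at h4
    have h5 : (0 : ℝ) < J.card := by rw [hn]; positivity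
    refine le_of_mul_le_mul_left (h4.trans (le_of_eq ?_)) h5
    ring

/-- On the support, `q` is bounded below. -/
theorem MarginalLowerBound.pow_mul_le {q : (I → X) → ℝ} {b : ℝ} (hmarg : MarginalLowerBound q b)
    (hb : 0 < b) (hq : ∀ x, 0 ≤ q x) {y : I → X} (hy : 0 < q y) (J : Finset I) :
    b ^ J.card * blockSum J q y ≤ q y := by
  induction J using Finset.induction_on with
  | empty => simp [blockSum_empty]
  | insert i J hi ih =>
    -- Pinning the site `i` at `y i` loses at most a factor `b`; the alternative of zero mass is
    -- excluded because the pinned block still contains `y`.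
    have h := hmarg (insert i J) y i (Finset.mem_insert_self i J) (y i)
    rw [Finset.erase_insert hi, Function.update_eq_self] at h
    rcases h with h | h
    · exact absurd (hy.trans_le (le_blockSum hq y)) (by rw [h]; exact lt_irrefl 0)
    · rw [Finset.card_insert_of_notMem hi, pow_succ, mul_assoc]
      exact (mul_le_mul_of_nonneg_left h (pow_nonneg hb.le _)).trans ih

end SpinSystem

/-! ### Decay of entropy and mixing of reversible chains -/

namespace MarkovChain

variable {Ω : Type*} [Fintype Ω] [DecidableEq Ω]

/-- A stochastic matrix which is reversible with respect to the positive probability mass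
function `μ`. -/
structure IsReversibleChain (P : Matrix Ω Ω ℝ) (μ : Ω → ℝ) : Prop where
  pos : ∀ x, 0 < μ x
  sum_eq_one : ∑ x, μ x = 1
  nonneg : ∀ x y, 0 ≤ P x y
  row_sum : ∀ x, ∑ y, P x y = 1
  reversible : ∀ x y, μ x * P x y = μ y * P y x

/-! ### Derivatives and entries of the matrix exponential -/

section

open scoped Matrix.Norms.Operator

theorem hasDerivAt_semigroup (P : Matrix Ω Ω ℝ) (t : ℝ) :
    HasDerivAt (semigroup P) (generator P * semigroup P t) t :=
  hasDerivAt_exp_smul_const' (generator P) t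

theorem hasDerivAt_semigroup' (P : Matrix Ω Ω ℝ) (t : ℝ) :
    HasDerivAt (semigroup P) (semigroup P t * generator P) t :=
  hasDerivAt_exp_smul_const (generator P) t

theorem hasSum_exp_apply (A : Matrix Ω Ω ℝ) (x y : Ω) :
    HasSum (fun n : ℕ => (n.factorial : ℝ)⁻¹ * (A ^ n) x y) (NormedSpace.exp A x y) := by
  have h := NormedSpace.exp_series_hasSum_exp' (𝕂 := ℝ) A
  have h2 := Pi.hasSum.1 (Pi.hasSum.1 h x) y
  exact h2

theorem hasDerivAt_apply {u : ℝ → Matrix Ω Ω ℝ} {u' : Matrix Ω Ω ℝ} {t : ℝ}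
    (h : HasDerivAt u u' t) (x y : Ω) : HasDerivAt (fun s => u s x y) (u' x y) t :=
  hasDerivAt_pi.1 (hasDerivAt_pi.1 h x) y

end

theorem semigroup_zero (P : Matrix Ω Ω ℝ) : semigroup P 0 = 1 := by
  simp [semigroup]

theorem hasDerivAt_semigroup_mulVec (P : Matrix Ω Ω ℝ) (f : Ω → ℝ) (t : ℝ) (x : Ω) :
    HasDerivAt (fun s => (semigroup P s).mulVec f x)
      ((generator P).mulVec ((semigroup P t).mulVec f) x) t := by
  rw [Matrix.mulVec_mulVec]
  exact HasDerivAt.fun_sum fun y _ =>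
    (hasDerivAt_apply (hasDerivAt_semigroup P t) x y).mul_const (f y)

/-- Since `P_t = e^{-t} exp(t P)`, the power series of the exponential of `t P` has nonnegative
entries. -/
theorem semigroup_nonneg {P : Matrix Ω Ω ℝ} (hP : ∀ x y, 0 ≤ P x y) {t : ℝ} (ht : 0 ≤ t)
    (x y : Ω) : 0 ≤ semigroup P t x y := by
  have e : t • generator P = (-t) • (1 : Matrix Ω Ω ℝ) + t • P := by
    rw [generator, smul_sub, neg_smul]; abel
  have hc : Commute ((-t) • (1 : Matrix Ω Ω ℝ)) (t • P) :=
    ((Commute.one_left P).smul_left (-t)).smul_right t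
  have hd : (-t) • (1 : Matrix Ω Ω ℝ) = Matrix.diagonal (fun _ => -t) :=
    Matrix.smul_one_eq_diagonal (-t)
  rw [semigroup, e, Matrix.exp_add_of_commute _ _ hc, hd, Matrix.exp_diagonal,
    Matrix.diagonal_mul]
  refine mul_nonneg ?_ ?_
  · rw [Pi.coe_exp, ← Real.exp_eq_exp_ℝ]
    exact (Real.exp_pos _).le
  · refine (hasSum_exp_apply (t • P) x y).nonneg fun n => mul_nonneg (by positivity) ?_
    have : ∀ n : ℕ, ∀ x y, 0 ≤ ((t • P) ^ n) x y := by
      intro n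
      induction n with
      | zero => intro x y; rw [pow_zero, Matrix.one_apply]; split_ifs <;> norm_num
      | succ n ih =>
        intro x y
        rw [pow_succ, Matrix.mul_apply]
        exact Finset.sum_nonneg fun z _ => mul_nonneg (ih x z) (mul_nonneg ht (hP z y))
    exact this n x y

namespace IsReversibleChain

variable {P : Matrix Ω Ω ℝ} {μ : Ω → ℝ}

theorem mulVec_one_apply (M : Matrix Ω Ω ℝ) (x : Ω) : M.mulVec 1 x = ∑ y, M x y := by
  simp [Matrix.mulVec, dotProduct]

theorem generator_mulVec_one (h : IsReversibleChain P μ) : (generator P).mulVec 1 = 0 := by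
  ext x
  simp [mulVec_one_apply, generator, Matrix.one_apply, h.row_sum]

/-- The row sums are constant in time, since `P_t L 1 = 0`. -/
theorem semigroup_row_sum (h : IsReversibleChain P μ) (t : ℝ) (x : Ω) :
    ∑ y, semigroup P t x y = 1 := by
  have hd : ∀ s, HasDerivAt (fun s => ∑ y, semigroup P s x y) 0 s := fun s => by
    have h1 := HasDerivAt.fun_sum (u := Finset.univ) fun y _ =>
      hasDerivAt_apply (hasDerivAt_semigroup' P s) x y
    have h2 : ∑ y, (semigroup P s * generator P) x y = 0 := by
      have := congrFun (Matrix.mulVec_mulVec 1 (semigroup P s) (generator P)) x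
      rw [h.generator_mulVec_one, Matrix.mulVec_zero, mulVec_one_apply] at this
      exact this.symm
    rwa [h2] at h1
  have := is_const_of_deriv_eq_zero (fun s => (hd s).differentiableAt)
    (fun s => (hd s).deriv) t 0
  rw [this, semigroup_zero]
  simp [Matrix.one_apply]

theorem semigroup_mulVec_pos (h : IsReversibleChain P μ) {t : ℝ} (ht : 0 ≤ t) {f : Ω → ℝ}
    (hf : ∀ x, 0 < f x) (x : Ω) : 0 < (semigroup P t).mulVec f x := by
  have h0 : ∀ y, 0 ≤ semigroup P t x y * f y := fun y =>
    mul_nonneg (semigroup_nonneg h.nonneg ht x y) (hf y).le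
  refine lt_of_le_of_ne (Finset.sum_nonneg fun y _ => h0 y) fun he => ?_
  have h1 := (Finset.sum_eq_zero_iff_of_nonneg fun y _ => h0 y).1 he.symm
  have h2 := h.semigroup_row_sum t x
  rw [Finset.sum_eq_zero fun y hy => (mul_eq_zero.1 (h1 y hy)).resolve_right (hf y).ne'] at h2
  exact zero_ne_one h2

theorem generator_reversible (h : IsReversibleChain P μ) (x y : Ω) :
    μ x * generator P x y = μ y * generator P y x := by
  rw [generator, Matrix.sub_apply, Matrix.sub_apply, mul_sub, mul_sub, h.reversible,
    Matrix.one_apply, Matrix.one_apply]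
  by_cases hxy : x = y
  · subst hxy; rfl
  · simp [hxy, Ne.symm hxy]

theorem expect_mul_generator (h : IsReversibleChain P μ) (f g : Ω → ℝ) :
    ∑ x, μ x * ((generator P).mulVec f x * g x) =
      ∑ x, μ x * (f x * (generator P).mulVec g x) := by
  simp only [Matrix.mulVec, dotProduct, Finset.mul_sum, Finset.sum_mul]
  rw [Finset.sum_comm]
  refine Finset.sum_congr rfl fun x _ => Finset.sum_congr rfl fun y _ => ?_
  have := h.generator_reversible x y
  linear_combination (-(f x * g y)) * this

theorem sum_generator_mulVec (h : IsReversibleChain P μ) (f : Ω → ℝ) :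
    ∑ x, μ x * (generator P).mulVec f x = 0 := by
  have := h.expect_mul_generator f 1
  rw [h.generator_mulVec_one] at this
  simpa using this

/-- Detailed balance passes to the powers of the generator, because a power may be split off on
either side, and hence to the exponential series. -/
theorem semigroup_reversible (h : IsReversibleChain P μ) (t : ℝ) (x y : Ω) :
    μ x * semigroup P t x y = μ y * semigroup P t y x := by
  have hpow : ∀ (n : ℕ) (x y : Ω), μ x * ((t • generator P) ^ n) x y =
      μ y * ((t • generator P) ^ n) y x := by
    intro n
    induction n with
    | zero =>
      intro x y
      by_cases hxy : x = y
      · subst hxy; rfl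
      · simp [hxy, Ne.symm hxy]
    | succ n ih =>
      intro x y
      rw [pow_succ, Matrix.mul_apply, ← pow_succ, pow_succ', Matrix.mul_apply, Finset.mul_sum,
        Finset.mul_sum]
      refine Finset.sum_congr rfl fun z _ => ?_
      have h1 := ih x z
      have h2 := h.generator_reversible z y
      simp only [Matrix.smul_apply, smul_eq_mul]
      linear_combination (t * generator P z y) * h1 + (t * ((t • generator P) ^ n) z x) * h2
  have h1 := (hasSum_exp_apply (t • generator P) x y).mul_left (μ x)
  have h2 := (hasSum_exp_apply (t • generator P) y x).mul_left (μ y)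
  refine h1.unique ?_
  convert! h2 using 2 with n
  have := hpow n x y
  linear_combination ((n.factorial : ℝ)⁻¹) * this

/-- For `u = P_t f` the derivative is `E[L u (log u + 1)]`. Stationarity, `E[L u] = 0`, removes both
the constant 1 and the contribution of the total mass, and reversibility moves `L` onto `log u`.
Positivity of `u` is needed to differentiate the logarithm. -/
theorem hasDerivAt_entropy (h : IsReversibleChain P μ) {t : ℝ} (ht : 0 ≤ t) {f : Ω → ℝ}
    (hf : ∀ x, 0 < f x) :
    HasDerivAt (fun s => entropy μ ((semigroup P s).mulVec f))
      (-dirichletForm P μ ((semigroup P t).mulVec f)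
        (fun x => Real.log ((semigroup P t).mulVec f x))) t := by
  set u : ℝ → Ω → ℝ := fun s => (semigroup P s).mulVec f with hu
  have hpos : ∀ x, 0 < u t x := h.semigroup_mulVec_pos ht hf
  have hd : ∀ x, HasDerivAt (fun s => u s x) ((generator P).mulVec (u t) x) t :=
    hasDerivAt_semigroup_mulVec P f t
  rcases isEmpty_or_nonempty Ω with hΩ | hΩ
  · have := h.sum_eq_one
    simp at this
  have hm : 0 < expect μ (u t) :=
    Finset.sum_pos (fun x _ => mul_pos (h.pos x) (hpos x)) Finset.univ_nonempty
  have h1 : HasDerivAt (fun s => expect μ (fun x => u s x * Real.log (u s x)))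
      (∑ x, μ x * ((generator P).mulVec (u t) x * (Real.log (u t x) + 1))) t :=
    HasDerivAt.fun_sum fun x _ => by
      have := ((Real.hasDerivAt_mul_log (hpos x).ne').comp t (hd x)).const_mul (μ x)
      convert! this using 1
      ring
  have h2 : HasDerivAt (fun s => expect μ (u s)) (∑ x, μ x * (generator P).mulVec (u t) x) t :=
    HasDerivAt.fun_sum fun x _ => (hd x).const_mul (μ x)
  have h3 := h1.sub ((Real.hasDerivAt_mul_log hm.ne').comp t h2)
  convert! h3 using 1
  rw [h.sum_generator_mulVec, mul_zero, sub_zero]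
  simp only [mul_add, mul_one, Finset.sum_add_distrib, h.sum_generator_mulVec, add_zero]
  rw [h.expect_mul_generator]
  simp [dirichletForm, expect, hu]

/-- Grönwall's argument: the inequality makes `exp (2 t / ρ) * Ent(P_t f)` nonincreasing. -/
theorem entropy_semigroup_le (h : IsReversibleChain P μ) {ρ : ℝ} (hρ : 0 < ρ)
    (hmlsi : MLSI P μ ρ) {f : Ω → ℝ} (hf : ∀ x, 0 < f x) {t : ℝ} (ht : 0 ≤ t) :
    entropy μ ((semigroup P t).mulVec f) ≤ Real.exp (-2 * t / ρ) * entropy μ f := by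
  set F : ℝ → ℝ := fun s => entropy μ ((semigroup P s).mulVec f) with hF
  have hd : ∀ s, 0 ≤ s → HasDerivAt (fun s => Real.exp (2 / ρ * s) * F s)
      (Real.exp (2 / ρ * s) * (2 / ρ) * F s + Real.exp (2 / ρ * s) *
        (-dirichletForm P μ ((semigroup P s).mulVec f)
          (fun x => Real.log ((semigroup P s).mulVec f x)))) s := fun s hs => by
    have h1 : HasDerivAt (fun s => Real.exp (2 / ρ * s)) (Real.exp (2 / ρ * s) * (2 / ρ)) s := by
      simpa using ((hasDerivAt_id s).const_mul (2 / ρ)).exp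
    exact h1.mul (h.hasDerivAt_entropy hs hf)
  have hanti : AntitoneOn (fun s => Real.exp (2 / ρ * s) * F s) (Set.Ici 0) := by
    refine antitoneOn_of_deriv_nonpos (convex_Ici 0)
      (fun s hs => (hd s hs).continuousAt.continuousWithinAt)
      (fun s hs => (hd s (interior_subset hs)).differentiableAt.differentiableWithinAt)
      fun s hs => ?_
    have hs0 : 0 ≤ s := interior_subset hs
    rw [(hd s hs0).deriv]
    have h2 := hmlsi _ (h.semigroup_mulVec_pos hs0 hf)
    have h3 : 2 / ρ * F s ≤ dirichletForm P μ ((semigroup P s).mulVec f)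
          (fun x => Real.log ((semigroup P s).mulVec f x)) := by
      rw [div_mul_eq_mul_div, div_le_iff₀ hρ]
      simp only [hF]
      linarith
    nlinarith [Real.exp_pos (2 / ρ * s)]
  have h4 := hanti (Set.mem_Ici.2 le_rfl) ht ht
  simp only [mul_zero, Real.exp_zero, one_mul] at h4
  have h5 : F 0 = entropy μ f := by
    simp only [hF, semigroup_zero, Matrix.one_mulVec]
  rw [h5] at h4
  have e : -2 * t / ρ = -(2 / ρ * t) := by ring
  rw [e, Real.exp_neg, ← div_eq_inv_mul, le_div_iff₀ (Real.exp_pos _), mul_comm]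
  exact h4

theorem continuous_entropy (μ : Ω → ℝ) : Continuous (entropy μ) := by
  have h1 : Continuous fun f : Ω → ℝ => expect μ (fun x => f x * Real.log (f x)) :=
    continuous_finsetSum _ fun x _ =>
      continuous_const.mul (Real.continuous_mul_log.comp (continuous_apply x))
  have h2 : Continuous fun f : Ω → ℝ => expect μ f :=
    continuous_finsetSum _ fun x _ => continuous_const.mul (continuous_apply x)
  exact h1.sub (Real.continuous_mul_log.comp h2)

/-- The modified logarithmic Sobolev inequality implies exponential decay of entropy. -/
theorem entropyDecay (h : IsReversibleChain P μ) {ρ : ℝ} (hρ : 0 < ρ) (hmlsi : MLSI P μ ρ) :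
    EntropyDecay P μ ρ := by
  intro f hf t ht
  -- A density may vanish, so the decay is proved for `f + ε` and passed to the limit `ε → 0`;
  -- continuity of entropy includes zero values because `z log z` is continuous at 0.
  have hc : Continuous fun ε : ℝ => (fun x => f x + ε : Ω → ℝ) := by fun_prop
  have h1 : Continuous fun ε : ℝ => entropy μ ((semigroup P t).mulVec fun x => f x + ε) :=
    (continuous_entropy μ).comp (continuous_const.matrix_mulVec hc)
  have h2 : Continuous fun ε : ℝ => Real.exp (-2 * t / ρ) * entropy μ fun x => f x + ε :=
    continuous_const.mul ((continuous_entropy μ).comp hc)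
  have h3 := le_of_tendsto_of_tendsto (b := nhdsWithin (0 : ℝ) (Set.Ioi 0))
    (h1.continuousWithinAt.tendsto) (h2.continuousWithinAt.tendsto)
    (Filter.eventually_of_mem self_mem_nhdsWithin fun ε hε =>
      h.entropy_semigroup_le hρ hmlsi (f := fun x => f x + ε)
        (fun x => add_pos_of_nonneg_of_pos (hf.1 x) hε) ht)
  simpa using h3

/-- Apply the decay to the density of the point mass at `y`, whose entropy is `-log (μ y)`. By
reversibility its evolution is the density of the row `P_t(y, ·)`, and Pinsker's inequality turns
entropy into distance. -/
theorem sq_dTV_semigroup_le (h : IsReversibleChain P μ) {ρ : ℝ} (hdec : EntropyDecay P μ ρ)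
    {t : ℝ} (ht : 0 ≤ t) (y : Ω) :
    dTV (semigroup P t y) μ ^ 2 ≤ Real.exp (-2 * t / ρ) * -Real.log (μ y) := by
  have hy := h.pos y
  have hdens : IsDensity μ (fun x => if x = y then (μ y)⁻¹ else 0) := by
    refine ⟨fun x => ?_, ?_⟩
    · dsimp only; split_ifs
      · exact (inv_pos.2 hy).le
      · rfl
    · simp [expect, hy.ne']
  have hent : entropy μ (fun x => if x = y then (μ y)⁻¹ else 0) = -Real.log (μ y) := by
    rw [entropy, hdens.2]
    simp only [expect, ite_mul, zero_mul, mul_ite, mul_zero, Finset.sum_ite_eq', Finset.mem_univ,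
      if_true, Real.log_one, sub_zero, Real.log_inv]
    field_simp
  have hsg : ∀ x, (semigroup P t).mulVec (fun x => if x = y then (μ y)⁻¹ else 0) x =
      semigroup P t y x / μ x := fun x => by
    have h1 := h.semigroup_reversible t x y
    have hx := h.pos x
    simp only [Matrix.mulVec, dotProduct, mul_ite, mul_zero, Finset.sum_ite_eq', Finset.mem_univ,
      if_true]
    field_simp
    linarith
  have h1 := hdec _ hdens t ht
  rw [hent] at h1
  refine le_trans (le_trans (sq_dTV_le _ μ (semigroup_nonneg h.nonneg ht y)
    (fun x => (h.pos x).le) (h.semigroup_row_sum t y) h.sum_eq_one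
    (fun x hx => absurd hx (h.pos x).ne')) (le_of_eq ?_)) h1
  have hexp : ∑ x, μ x * (semigroup P t y x / μ x) = 1 := by
    rw [← h.semigroup_row_sum t y]
    exact Finset.sum_congr rfl fun x _ => mul_div_cancel₀ _ (h.pos x).ne'
  simp only [entropy, expect, hsg, hexp, Real.log_one, mul_zero, sub_zero]
  refine Finset.sum_congr rfl fun x _ => ?_
  rw [← mul_assoc, mul_div_cancel₀ _ (h.pos x).ne']

/-- The exponent is `-2` because the entropy controls the square of the distance, which is to be at
most `e⁻¹`. -/
theorem mixingTime_le (h : IsReversibleChain P μ) {ρ : ℝ} (hdec : EntropyDecay P μ ρ)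
    {t : ℝ} (ht : 0 ≤ t) (hμ : ∀ y, Real.exp (-2 * t / ρ) * -Real.log (μ y) ≤ Real.exp (-2)) :
    mixingTime P μ ≤ ENNReal.ofReal t := by
  refine iInf₂_le_of_le ⟨t, ht⟩ (fun y => ?_) (le_of_eq ?_)
  · have h1 := (h.sq_dTV_semigroup_le hdec ht y).trans (hμ y)
    have e : Real.exp (-2) = Real.exp (-1) ^ 2 := by rw [← Real.exp_nat_mul]; norm_num
    rw [e] at h1
    exact (abs_le_of_sq_le_sq' h1 (Real.exp_pos _).le).2
  · rw [ENNReal.ofReal, Real.toNNReal_of_nonneg ht]; rfl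

end IsReversibleChain

end MarkovChain

/-! ### Glauber dynamics -/

namespace SpinSystem

open MarkovChain

variable {I X : Type*} [Fintype I] [DecidableEq I] [Fintype X] [DecidableEq X]

theorem sum_supp {μ : (I → X) → ℝ} {g : (I → X) → ℝ} (h : ∀ x, ¬ 0 < μ x → g x = 0) :
    ∑ x : Supp μ, g x.1 = ∑ x, g x := by
  rw [← Fintype.sum_subtype_add_sum_subtype (fun x => 0 < μ x) g,
    Finset.sum_eq_zero fun (x : {x // ¬ 0 < μ x}) _ => h x.1 x.2, add_zero]

theorem prod_erase_ite (i : I) (x y : I → X) :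
    (∏ j ∈ Finset.univ.erase i, if x j = y j then (1 : ℝ) else 0) =
      if ∀ k, k ∉ ({i} : Finset I) → y k = x k then 1 else 0 := by
  rw [Finset.prod_ite_zero]
  have : (∀ j ∈ Finset.univ.erase i, x j = y j) ↔
      ∀ k, k ∉ ({i} : Finset I) → y k = x k := by
    simp [eq_comm]
  simp only [this, Finset.prod_const_one]

theorem update_eq_of_agree {i : I} {x y : I → X} (h : ∀ k, k ∉ ({i} : Finset I) → y k = x k) :
    Function.update x i (y i) = y := by
  ext k
  by_cases hk : k = i
  · subst hk; simp
  · simp [hk, h k (by simpa using hk)]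

/-- The Glauber kernel is the average over the sites of the one-site conditional expectations. The
sum over the support extends to all configurations since no transition leads out of the support. -/
theorem sum_glauber_mul {μ : (I → X) → ℝ} (hμ : ∀ x, 0 ≤ μ x) (x : Supp μ) (g : (I → X) → ℝ) :
    ∑ y : Supp μ, glauber μ x y * g y.1 =
      (Fintype.card I : ℝ)⁻¹ * ∑ i, blockAvg {i} μ g x.1 := by
  have h1 := sum_supp (μ := μ) (g := fun y => (Fintype.card I : ℝ)⁻¹ *
    (∑ i, condProb μ i (y i) x.1 * ∏ j ∈ Finset.univ.erase i, if x.1 j = y j then 1 else 0) * g y)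
    (fun y hy => by
      rw [Finset.sum_eq_zero fun i _ => ?_, mul_zero, zero_mul]
      rw [prod_erase_ite]
      split_ifs with h
      · rw [condProb, update_eq_of_agree h, le_antisymm (not_lt.1 hy) (hμ y), zero_div, zero_mul]
      · rw [mul_zero])
  refine h1.trans ?_
  simp only [mul_assoc, ← Finset.mul_sum, Finset.sum_mul]
  rw [Finset.sum_comm]
  congr 1
  refine Finset.sum_congr rfl fun i _ => ?_
  have h2 : blockSum {i} (fun y => condProb μ i (y i) x.1 * g y) x.1 =
      ∑ y, condProb μ i (y i) x.1 *
        ((∏ j ∈ Finset.univ.erase i, if x.1 j = y j then 1 else 0) * g y) := by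
    refine Finset.sum_congr rfl fun y _ => ?_
    rw [prod_erase_ite]
    split_ifs <;> simp
  rw [← h2, blockAvg, blockSum_singleton, blockSum_singleton, blockSum_singleton, siteSum,
    siteSum, Finset.sum_div]
  refine Finset.sum_congr rfl fun a _ => ?_
  simp only [Function.update_self, condProb, siteSum]
  ring

theorem isReversibleChain_glauber [Nonempty I] {μ : (I → X) → ℝ} (hμ : ∀ x, 0 ≤ μ x)
    (hsum : ∑ x, μ x = 1) : IsReversibleChain (glauber μ) (onSupp μ) where
  pos x := x.2
  sum_eq_one := by
    rw [← hsum]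
    exact sum_supp fun x hx => le_antisymm (not_lt.1 hx) (hμ x)
  nonneg x y := by
    refine mul_nonneg (by positivity) (Finset.sum_nonneg fun i _ => mul_nonneg ?_ ?_)
    · exact div_nonneg (hμ _) (Finset.sum_nonneg fun _ _ => hμ _)
    · exact Finset.prod_nonneg fun j _ => by split_ifs <;> norm_num
  row_sum x := by
    have h := sum_glauber_mul hμ x (fun _ => 1)
    simp only [mul_one] at h
    rw [h]
    have h1 : ∀ i, blockAvg {i} μ (fun _ => 1) x.1 = 1 := fun i => by
      simp only [blockAvg, mul_one]
      exact div_self (x.2.trans_le (le_blockSum hμ x.1)).ne'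
    have hI : (Fintype.card I : ℝ) ≠ 0 := by exact_mod_cast Fintype.card_ne_zero
    simp [h1, hI]
  reversible x y := by
    simp only [glauber, onSupp]
    rw [mul_left_comm, mul_left_comm (μ y.1)]
    refine congrArg ((Fintype.card I : ℝ)⁻¹ * ·) ?_
    rw [Finset.mul_sum, Finset.mul_sum]
    refine Finset.sum_congr rfl fun i _ => ?_
    rw [prod_erase_ite, prod_erase_ite]
    by_cases h : ∀ k, k ∉ ({i} : Finset I) → y.1 k = x.1 k
    · have h' : ∀ k, k ∉ ({i} : Finset I) → x.1 k = y.1 k := fun k hk => (h k hk).symm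
      have e : siteSum i μ x.1 = siteSum i μ y.1 := by
        rw [← update_eq_of_agree h, siteSum_update]
      rw [if_pos h, if_pos h', condProb, condProb, update_eq_of_agree h, update_eq_of_agree h']
      change μ x.1 * (μ y.1 / siteSum i μ x.1 * 1) = μ y.1 * (μ x.1 / siteSum i μ y.1 * 1)
      rw [e]; ring
    · have h' : ¬ ∀ k, k ∉ ({i} : Finset I) → x.1 k = y.1 k :=
        fun h' => h fun k hk => (h' k hk).symm
      rw [if_neg h, if_neg h']; simp

/-! ### From approximate tensorization of entropy to rapid mixing -/

/-- `q` satisfies the approximate tensorization of entropy with constant `K`. -/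
def ApproxTensorization (q : (I → X) → ℝ) (K : ℝ) : Prop :=
  ∀ f : (I → X) → ℝ, (∀ x, 0 < f x) →
    ∑ x, localEnt q f Finset.univ x ≤ K * ∑ i, ∑ x, localEnt q f {i} x

/-- Jensen's inequality, obtained from the tangent line `log s ≤ log m + s / m - 1` at the mean `m`.
-/
theorem blockAvg_log_le {q f : (I → X) → ℝ} {J : Finset I} {y : I → X} (hq : ∀ x, 0 ≤ q x)
    (hf : ∀ x, 0 < f x) (hQ : 0 < blockSum J q y) :
    blockAvg J q (fun x => Real.log (f x)) y ≤ Real.log (blockAvg J q f y) := by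
  set m := blockAvg J q f y with hm
  have hm0 : 0 < m := div_pos (blockSum_mul_pos hq hf hQ) hQ
  have e : blockSum J (fun x => q x * f x) y = m * blockSum J q y := by
    rw [hm, blockAvg]; field_simp
  rw [blockAvg, div_le_iff₀ hQ]
  calc blockSum J (fun x => q x * Real.log (f x)) y
      ≤ blockSum J (fun x => q x * Real.log m + (q x * f x * m⁻¹ - q x)) y :=
        blockSum_mono fun x _ => by
          have h1 : Real.log (f x / m) ≤ f x / m - 1 :=
            Real.log_le_sub_one_of_pos (div_pos (hf x) hm0)
          rw [Real.log_div (hf x).ne' hm0.ne'] at h1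
          have h2 := mul_le_mul_of_nonneg_left h1 (hq x)
          rw [div_eq_mul_inv] at h2
          linarith
    _ = Real.log m * blockSum J q y := by
        rw [blockSum_add, blockSum_sub, blockSum_mul_const, blockSum_mul_const, e]
        field_simp
        ring

/-- The Dirichlet form equals `|I|⁻¹ ∑_i E[f (log f - E_i log f)]`. By Jensen's inequality, `E_i log
f ≤ log E_i f`, so each summand is at least the mean local entropy at `i`. The factor 2 offsets the
half in the definition of `MLSI`. -/
theorem mLSI_glauber [Nonempty I] {q : (I → X) → ℝ} (hq : ∀ x, 0 ≤ q x) (hsum : ∑ x, q x = 1)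
    {K : ℝ} (hK : 0 ≤ K) (hat : ApproxTensorization q K) :
    MLSI (glauber q) (onSupp q) (2 * K * Fintype.card I) := by
  intro f hf
  -- The values of `F` off the support carry no mass; 1 is chosen only to keep `F` positive.
  set F : (I → X) → ℝ := fun x => if h : 0 < q x then f ⟨x, h⟩ else 1 with hF
  have hFpos : ∀ x, 0 < F x := fun x => by
    simp only [hF]; split_ifs; exacts [hf _, one_pos]
  have hFf : ∀ x : Supp q, f x = F x.1 := fun x => by simp [hF, x.2]
  have hI : (Fintype.card I : ℝ) ≠ 0 := by exact_mod_cast Fintype.card_ne_zero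
  have hzero : ∀ x, ¬ 0 < q x → q x = 0 := fun x hx => le_antisymm (not_lt.1 hx) (hq x)
  have hex : ∀ g : (I → X) → ℝ, expect (onSupp q) (fun x => g x.1) = ∑ x, q x * g x := fun g =>
    sum_supp (μ := q) (g := fun x => q x * g x) fun x hx => by rw [hzero x hx, zero_mul]
  have h1 : entropy (onSupp q) f = ∑ x, localEnt q F Finset.univ x := by
    have e1 : expect (onSupp q) f = ∑ x, q x * F x := by
      rw [← hex]; exact congrArg _ (funext hFf)
    have e2 : expect (onSupp q) (fun x => f x * Real.log (f x)) =
        ∑ x, q x * (F x * Real.log (F x)) := by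
      rw [← hex]; simp only [hFf]
    have e3 : ∀ x, blockAvg Finset.univ q F x = ∑ x, q x * F x := fun x => by
      rw [blockAvg, blockSum_univ, blockSum_univ, hsum, div_one]
    rw [entropy, e1, e2, Finset.sum_mul]
    simp only [localEnt, e3, mul_sub, Finset.sum_sub_distrib, mul_assoc]
  have h2 : dirichletForm (glauber q) (onSupp q) f (fun x => Real.log (f x)) =
      (Fintype.card I : ℝ)⁻¹ * ∑ i, ∑ x, q x * (F x * (Real.log (F x) -
        blockAvg {i} q (fun x => Real.log (F x)) x)) := by
    have e1 : ∀ x : Supp q, f x * (-(generator (glauber q)).mulVec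
        (fun x => Real.log (f x)) x) = F x.1 * (Real.log (F x.1) -
          (Fintype.card I : ℝ)⁻¹ * ∑ i, blockAvg {i} q (fun x => Real.log (F x)) x.1) := by
      intro x
      rw [hFf, ← sum_glauber_mul hq x]
      have e : (generator (glauber q)).mulVec (fun x => Real.log (f x)) x =
          ∑ y, glauber q x y * Real.log (F y.1) - Real.log (F x.1) := by
        rw [generator, Matrix.sub_mulVec, Matrix.one_mulVec, Pi.sub_apply, hFf]
        simp only [hFf, Matrix.mulVec, dotProduct]
      rw [e, neg_sub]
    rw [dirichletForm, funext e1, hex fun x => F x * (Real.log (F x) -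
          (Fintype.card I : ℝ)⁻¹ * ∑ i, blockAvg {i} q (fun x => Real.log (F x)) x),
      Finset.sum_comm, Finset.mul_sum]
    refine Finset.sum_congr rfl fun x _ => ?_
    simp only [mul_sub, Finset.sum_sub_distrib, ← Finset.mul_sum, Finset.sum_const, nsmul_eq_mul,
      Finset.card_univ]
    field_simp
  have h3 : ∀ i x, localEnt q F {i} x ≤ q x * (F x * (Real.log (F x) -
        blockAvg {i} q (fun x => Real.log (F x)) x)) := fun i x => by
    rw [localEnt, mul_assoc]
    rcases (hq x).eq_or_lt with h | h
    · simp [← h]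
    · have := blockAvg_log_le hq hFpos (h.trans_le (le_blockSum (J := {i}) hq x))
      exact mul_le_mul_of_nonneg_left
        (mul_le_mul_of_nonneg_left (by linarith) (hFpos x).le) h.le
  rw [h1, h2]
  refine (hat F hFpos).trans ?_
  have e : 2 * K * Fintype.card I / 2 * ((Fintype.card I : ℝ)⁻¹ * ∑ i, ∑ x, q x * (F x *
      (Real.log (F x) - blockAvg {i} q (fun x => Real.log (F x)) x))) = K * ∑ i, ∑ x, q x * (F x *
      (Real.log (F x) - blockAvg {i} q (fun x => Real.log (F x)) x)) := by
    field_simp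
  rw [e]
  exact mul_le_mul_of_nonneg_left
    (Finset.sum_le_sum fun i _ => Finset.sum_le_sum fun x _ => h3 i x) hK

/-- The constant in the rapid mixing of a spin system with approximate tensorization constant `K`
and conditional probabilities at least `b`. -/
noncomputable def mixingConst (K b : ℝ) : ℝ :=
  K * (2 + (2 + |Real.log b|) / Real.log 2)

/-- With `n` sites, `hlow` bounds the initial entropy `-log μ(y)` by `n |log b|`. The time is chosen
so that the decay factor is at most `n⁻¹ e^{-2} e^{-|log b|}`, which suffices because `m e^{-m} ≤
1`. -/
theorem rapidMixingWith_of_approxTensorization [Nonempty I] {q : (I → X) → ℝ}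
    (hq : ∀ x, 0 ≤ q x) (hsum : ∑ x, q x = 1) {K b : ℝ} (hK : 0 < K) (hb : 0 < b)
    (hat : ApproxTensorization q K) (hlow : ∀ x, 0 < q x → b ^ Fintype.card I ≤ q x) :
    RapidMixingWith q (mixingConst K b) := by
  have hrev := isReversibleChain_glauber hq hsum
  have hI : (0 : ℝ) < Fintype.card I := by exact_mod_cast Fintype.card_pos
  have hlog2 : 0 < Real.log 2 := Real.log_pos (by norm_num)
  have hmlsi := mLSI_glauber hq hsum hK.le hat
  have hρ : 0 < 2 * K * Fintype.card I := by positivity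
  have hfrac : 0 ≤ (2 + |Real.log b|) / Real.log 2 := by positivity
  refine ⟨⟨2 * K * Fintype.card I, hρ, ?_, hmlsi⟩, fun ρ₀ h0 h => hrev.entropyDecay h0 h, ?_⟩
  · refine mul_le_mul_of_nonneg_right ?_ hI.le
    rw [mixingConst]
    nlinarith [mul_nonneg hK.le hfrac]
  · intro hcard
    set n : ℝ := ((Fintype.card I : ℕ) : ℝ) with hn
    have hn2 : (2 : ℝ) ≤ n := by rw [hn]; exact_mod_cast hcard
    have hlogn : Real.log 2 ≤ Real.log n := Real.log_le_log (by norm_num) hn2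
    set m := |Real.log b| with hm
    refine hrev.mixingTime_le (hrev.entropyDecay hρ hmlsi) ?_ fun y => ?_
    · rw [mixingConst]; positivity
    have h1 : -Real.log (onSupp q y) ≤ n * m := by
      have h2 := Real.log_le_log (by positivity) (hlow y.1 y.2)
      rw [Real.log_pow] at h2
      have h3 : -m ≤ Real.log b := neg_abs_le _
      have h4 : n * (-m) ≤ n * Real.log b := mul_le_mul_of_nonneg_left h3 hI.le
      rw [onSupp]
      linarith
    -- The first 2 in `mixingConst` gives `2 * K ≤ C` for the first property and more than `log n`
    -- here; the second summand, together with `log n ≥ log 2`, gives `2 + m`.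
    have h5 : -2 * (mixingConst K b * (n * Real.log n)) / (2 * K * n) ≤
        -Real.log n + (-2 + -m) := by
      have e : -2 * (mixingConst K b * (n * Real.log n)) / (2 * K * n) =
          -((2 + (2 + m) / Real.log 2) * Real.log n) := by
        rw [mixingConst, ← hm]; field_simp
      rw [e]
      have h6 : 2 + m ≤ (2 + m) / Real.log 2 * Real.log n := by
        calc 2 + m = (2 + m) / Real.log 2 * Real.log 2 := by field_simp
          _ ≤ _ := mul_le_mul_of_nonneg_left hlogn hfrac
      nlinarith
    have h7 : m * Real.exp (-m) ≤ 1 := by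
      have h8 : m ≤ Real.exp m := by linarith [Real.add_one_le_exp m]
      calc m * Real.exp (-m) ≤ Real.exp m * Real.exp (-m) :=
            mul_le_mul_of_nonneg_right h8 (Real.exp_pos _).le
        _ = 1 := by rw [← Real.exp_add, add_neg_cancel, Real.exp_zero]
    calc Real.exp (-2 * (mixingConst K b * (n * Real.log n)) / (2 * K * n)) *
          -Real.log (onSupp q y)
        ≤ Real.exp (-2 * (mixingConst K b * (n * Real.log n)) / (2 * K * n)) * (n * m) :=
          mul_le_mul_of_nonneg_left h1 (Real.exp_pos _).le
      _ ≤ Real.exp (-Real.log n + (-2 + -m)) * (n * m) :=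
          mul_le_mul_of_nonneg_right (Real.exp_le_exp.2 h5) (by positivity)
      _ = Real.exp (-2) * (m * Real.exp (-m)) := by
          rw [Real.exp_add, Real.exp_add, Real.exp_neg, Real.exp_log hI]
          field_simp
      _ ≤ Real.exp (-2) := mul_le_of_le_one_right (Real.exp_pos _).le h7

theorem RapidMixingWith.mono {q : (I → X) → ℝ} {C C' : ℝ} (h : RapidMixingWith q C)
    (hC : C ≤ C') : RapidMixingWith q C' := by
  obtain ⟨⟨ρ, h1, h2, h3⟩, h4, h5⟩ := h
  refine ⟨⟨ρ, h1, h2.trans ?_, h3⟩, h4, fun hI => (h5 hI).trans (ENNReal.ofReal_le_ofReal ?_)⟩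
  · exact mul_le_mul_of_nonneg_right hC (Nat.cast_nonneg _)
  · exact mul_le_mul_of_nonneg_right hC
      (mul_nonneg (Nat.cast_nonneg _) (Real.log_natCast_nonneg _))

/-- Dobrushin's condition implies rapid mixing. -/
theorem rapidMixingWith_of_isDobrushin [Nonempty I] {q : (I → X) → ℝ}
    (hq : ∀ x, 0 ≤ q x) (hsum : ∑ x, q x = 1) {κ : I → (I → X) → X → ℝ}
    (h : IsSpecification q κ) {A : I → I → ℝ} {δ b : ℝ} (hA : IsDobrushin κ A δ) (hb : 0 < b)
    (hmarg : MarginalLowerBound q b) :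
    RapidMixingWith q (mixingConst (Fintype.card X * (b * δ ^ 2)⁻¹) b) := by
  have hX : Nonempty X := by
    by_contra hX
    rw [not_nonempty_iff] at hX
    simp at hsum
  have hδ := hA.pos
  have hcard : (0 : ℝ) < Fintype.card X := by exact_mod_cast Fintype.card_pos
  obtain ⟨y₀⟩ : Nonempty (I → X) := inferInstance
  refine rapidMixingWith_of_approxTensorization hq hsum (by positivity) hb (fun f hf => ?_)
    fun y hy => ?_
  · have := blockSum_localEnt_le h hA hb hmarg hq hf Finset.univ y₀
    simpa only [blockSum_univ] using this
  · have := hmarg.pow_mul_le hb hq hy Finset.univ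
    rwa [blockSum_univ, hsum, mul_one, Finset.card_univ] at this

/-! ### Lower bounds for the marginals of pinned systems -/

/-- A lower bound for the marginals of all pinned systems in terms of the conditional
distributions: the spin `a` at `i` is forbidden exactly by the spins `b` at the neighbours of `i`
with `bad a b`, and each neighbour takes another spin with conditional probability at
least `c`. -/
theorem marginalLowerBound_of_forbidden {q : (I → X) → ℝ} (hq : ∀ x, 0 ≤ q x)
    (N : I → Finset I) {D : ℕ} (hD : ∀ i, (N i).card ≤ D) (hN : ∀ i, i ∉ N i)
    (bad : X → X → Prop) [DecidableRel bad] {c : ℝ} (hc : 0 < c) (hc1 : c ≤ 1)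
    (h1 : ∀ i a x, (∃ j ∈ N i, bad a (x j)) → q (Function.update x i a) = 0)
    (h2 : ∀ i a x, (∀ j ∈ N i, ¬ bad a (x j)) → c * siteSum i q x ≤ q (Function.update x i a))
    (h3 : ∀ i, ∀ j ∈ N i, ∀ a x,
      c * siteSum j q x ≤ ∑ b, if bad a b then 0 else q (Function.update x j b)) :
    MarginalLowerBound q (c ^ (D + 1)) := by
  intro J y i hi a
  rw [blockSum_update (Finset.notMem_erase i J)]
  -- A neighbour outside `J` has its spin fixed by `y`. If that spin forbids `a`, the mass is zero;
  -- otherwise only the neighbours inside `J` can obstruct `a`.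
  by_cases hb : ∃ j ∈ N i, j ∉ J ∧ bad a (y j)
  · left
    obtain ⟨j, hj, hjJ, hbad⟩ := hb
    rw [blockSum_eq_zero_iff fun x => hq _]
    intro x hx
    refine h1 i a x ⟨j, hj, ?_⟩
    rwa [hx j fun h => hjJ (Finset.mem_of_mem_erase h)]
  · right
    push Not at hb
    set E : Finset I → (I → X) → Prop := fun M x => ∀ j ∈ M, ¬ bad a (x j) with hE
    -- The neighbours in `M` are resampled one at a time, each avoiding the spins that forbid `a` at
    -- the price of a factor `c`. There are at most `D` of them, and setting the spin at `i` to `a`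
    -- costs one more factor, whence `D + 1`.
    have key : ∀ M : Finset I, M ⊆ N i → M ⊆ J → c ^ M.card * blockSum J q y ≤
        blockSum J (fun x => if E M x then q x else 0) y := by
      intro M
      induction M using Finset.induction_on with
      | empty => intro _ _; simp [hE]
      | insert j M hj ih =>
        intro hMN hMJ
        have ih' := ih ((Finset.subset_insert j M).trans hMN) ((Finset.subset_insert j M).trans hMJ)
        have hjN := hMN (Finset.mem_insert_self j M)
        have hjJ := hMJ (Finset.mem_insert_self j M)
        rw [Finset.card_insert_of_notMem hj, pow_succ', mul_assoc]
        refine (mul_le_mul_of_nonneg_left ih' hc.le).trans ?_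
        rw [← blockSum_const_mul, blockSum_eq_blockSum_siteSum hjJ,
          blockSum_eq_blockSum_siteSum hjJ]
        refine blockSum_mono fun x _ => ?_
        have hEu : ∀ b, E M (Function.update x j b) ↔ E M x := fun b =>
          forall₂_congr fun k hk => by
            rw [Function.update_of_ne (ne_of_mem_of_not_mem hk hj)]
        have hEi : ∀ b, E (insert j M) (Function.update x j b) ↔ E M x ∧ ¬ bad a b := fun b => by
          rw [← hEu b]
          simp [hE, and_comm]
        simp only [siteSum, hEu, hEi, ← Finset.mul_sum]
        by_cases hEM : E M x
        · simp only [hEM, if_true, true_and, ite_not]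
          exact h3 i j hjN a x
        · simp [hEM]
    set M := N i ∩ J with hM
    have hkey := key M Finset.inter_subset_left Finset.inter_subset_right
    have hMD : M.card ≤ D := (Finset.card_le_card Finset.inter_subset_left).trans (hD i)
    have hQ : 0 ≤ blockSum J q y := blockSum_nonneg hq
    calc c ^ (D + 1) * blockSum J q y = c * (c ^ D * blockSum J q y) := by ring
      _ ≤ c * (c ^ M.card * blockSum J q y) :=
        mul_le_mul_of_nonneg_left (mul_le_mul_of_nonneg_right
          (pow_le_pow_of_le_one hc.le hc1 hMD) hQ) hc.le
      _ ≤ c * blockSum J (fun x => if E M x then q x else 0) y :=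
        mul_le_mul_of_nonneg_left hkey hc.le
      _ ≤ _ := by
        rw [← blockSum_const_mul, blockSum_eq_blockSum_siteSum hi]
        refine blockSum_mono fun x hx => ?_
        have hiM : i ∉ M := fun h => hN i (Finset.mem_inter.1 h).1
        have hEu : ∀ b, E M (Function.update x i b) ↔ E M x := fun b =>
          forall₂_congr fun k hk => by
            rw [Function.update_of_ne (ne_of_mem_of_not_mem hk hiM)]
        simp only [siteSum, hEu, ← Finset.mul_sum]
        by_cases hEM : E M x
        · simp only [hEM, if_true]
          refine h2 i a x fun j hj => ?_
          by_cases hjJ : j ∈ J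
          · exact hEM j (Finset.mem_inter.2 ⟨hj, hjJ⟩)
          · rw [hx j fun h => hjJ (Finset.mem_of_mem_erase h)]
            exact hb j hj hjJ
        · simp only [hEM, if_false, Finset.sum_const_zero, mul_zero]
          exact hq _

/-- The case without forbidden spins: empty neighbourhoods and `D = 0`. -/
theorem marginalLowerBound_of_condProb {q : (I → X) → ℝ} (hq : ∀ x, 0 ≤ q x) {c : ℝ} (hc : 0 < c)
    (hc1 : c ≤ 1) (h : ∀ i a x, c * siteSum i q x ≤ q (Function.update x i a)) :
    MarginalLowerBound q c := by
  have := marginalLowerBound_of_forbidden hq (fun _ => ∅) (D := 0) (by simp) (by simp)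
    (fun _ _ => False) hc hc1 (by simp) (fun i a x _ => h i a x) (by simp)
  simpa using this

/-! ### Comparison of two weights -/

/-- The Holley-Stroock comparison principle. -/
theorem blockSum_localEnt_le_mul {w w' f : (I → X) → ℝ} (hw : ∀ x, 0 < w x) (hw' : ∀ x, 0 < w' x)
    (hf : ∀ x, 0 < f x) {r : ℝ} (hr : ∀ x, w x ≤ r * w' x) (J : Finset I) (y : I → X) :
    blockSum J (localEnt w f J) y ≤ r * blockSum J (localEnt w' f J) y := by
  have hW : 0 < blockSum J w y := (hw y).trans_le (le_blockSum (fun x => (hw x).le) y)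
  have hW' : 0 < blockSum J w' y := (hw' y).trans_le (le_blockSum (fun x => (hw' x).le) y)
  set c := blockAvg J w' f y with hcdef
  set A := blockAvg J w f y with hAdef
  have hc : 0 < c := div_pos (blockSum_mul_pos (fun x => (hw' x).le) hf hW') hW'
  have hA : 0 < A := div_pos (blockSum_mul_pos (fun x => (hw x).le) hf hW) hW
  -- The variational form of entropy: the sum of `v Φ` is the entropy under `v` plus a nonnegative
  -- term, which vanishes for `v = w'` because `c` is the mean under `w'`. As `Φ ≥ 0`, the weights
  -- can be compared pointwise.
  set Φ : (I → X) → ℝ := fun x => f x * (Real.log (f x) - Real.log c) - f x + c with hΦ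
  have hconv : ∀ s, 0 < s → 0 ≤ s * (Real.log s - Real.log c) - s + c := fun s hs => by
    have h1 : Real.log (c / s) ≤ c / s - 1 := Real.log_le_sub_one_of_pos (div_pos hc hs)
    rw [Real.log_div hc.ne' hs.ne'] at h1
    have h2 := mul_le_mul_of_nonneg_left h1 hs.le
    have h3 : s * (c / s - 1) = c - s := by field_simp
    linarith
  have e : ∀ (v : (I → X) → ℝ) (B : ℝ), (∀ x, 0 < v x) → blockAvg J v f y = B →
      blockSum J (fun x => v x * Φ x) y = blockSum J (localEnt v f J) y +
        blockSum J v y * (B * (Real.log B - Real.log c) - B + c) := fun v B hv hB => by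
    have hV : 0 < blockSum J v y := (hv y).trans_le (le_blockSum (fun x => (hv x).le) y)
    have e1 : blockSum J (fun x => v x * f x) y = B * blockSum J v y := by
      rw [← hB, blockAvg]; field_simp
    have e2 : blockSum J (localEnt v f J) y =
        blockSum J (fun x => v x * f x * (Real.log (f x) - Real.log B)) y :=
      blockSum_congr fun x hx => by rw [localEnt, blockAvg_eq_of_agree v f hx, hB]
    have e3 : (fun x => v x * Φ x) = fun x => (v x * f x * (Real.log (f x) - Real.log B) +
        v x * f x * (Real.log B - Real.log c - 1)) + v x * c := by
      ext x; simp only [hΦ]; ring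
    rw [e3, blockSum_add, blockSum_add, blockSum_mul_const, blockSum_mul_const, e1, e2]
    ring
  have h1 := e w A hw rfl
  have h2 := e w' c hw' rfl
  have h3 : blockSum J (fun x => w x * Φ x) y ≤ r * blockSum J (fun x => w' x * Φ x) y := by
    rw [← blockSum_const_mul]
    refine blockSum_mono fun x _ => ?_
    rw [← mul_assoc]
    exact mul_le_mul_of_nonneg_right (hr x) (hconv (f x) (hf x))
  rw [h1, h2] at h3
  have h4 := mul_nonneg hW.le (hconv A hA)
  simp only [sub_self, mul_zero, zero_sub, neg_add_cancel, add_zero] at h3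
  linarith

/-- For independent uniform spins the influence matrix is zero and `δ = 1`. This is the reference
for the comparison with an arbitrary positive weight. -/
theorem exists_approxTensorization_one [Nonempty X] :
    ∃ K : ℝ, 0 < K ∧ ApproxTensorization (fun _ : I → X => 1) K := by
  have hX : (0 : ℝ) < Fintype.card X := by exact_mod_cast Fintype.card_pos
  have hX1 : (1 : ℝ) ≤ Fintype.card X := by exact_mod_cast Fintype.card_pos (α := X)
  have hb : 0 < (Fintype.card X : ℝ)⁻¹ := inv_pos.2 hX
  have hspec : IsSpecification (fun _ : I → X => (1 : ℝ)) (fun _ _ _ => (Fintype.card X : ℝ)⁻¹) :=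
    { nonneg := fun _ _ _ => hb.le
      sum_eq_one := fun _ _ => by simp
      update := fun _ _ _ => rfl
      consistent := fun _ _ _ => by simp [siteSum] }
  have hdob : IsDobrushin (fun (_ : I) (_ : I → X) (_ : X) => (Fintype.card X : ℝ)⁻¹)
      (fun _ _ => 0) 1 :=
    { pos := one_pos
      nonneg := fun _ _ => le_rfl
      influence := fun _ _ _ _ _ => by simp [dTV]
      row := fun _ => by simp
      col := fun _ => by simp }
  have hmarg : MarginalLowerBound (fun _ : I → X => (1 : ℝ)) (Fintype.card X : ℝ)⁻¹ :=
    marginalLowerBound_of_condProb (fun _ => zero_le_one) hb (inv_le_one_of_one_le₀ hX1)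
      fun _ _ _ => by simp [siteSum]
  obtain ⟨y₀⟩ : Nonempty (I → X) := inferInstance
  refine ⟨Fintype.card X * ((Fintype.card X : ℝ)⁻¹ * 1 ^ 2)⁻¹, by positivity, fun f hf => ?_⟩
  have := blockSum_localEnt_le hspec hdob hb hmarg (fun _ => zero_le_one) hf Finset.univ y₀
  simpa only [blockSum_univ] using this

/-- Every spin system with full support mixes rapidly, with some constant. -/
theorem exists_rapidMixingWith_of_pos [Nonempty I] {q : (I → X) → ℝ} (hq : ∀ x, 0 < q x)
    (hsum : ∑ x, q x = 1) : ∃ C, RapidMixingWith q C := by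
  have hne : Nonempty (I → X) := by
    by_contra h
    rw [not_nonempty_iff] at h
    simp at hsum
  have hX : Nonempty X := hne.map fun x => x (Classical.arbitrary I)
  obtain ⟨K, hK, hat⟩ := exists_approxTensorization_one (I := I) (X := X)
  obtain ⟨x₀, -, hmin⟩ := Finset.exists_min_image Finset.univ q Finset.univ_nonempty
  have hq1 : ∀ x, q x ≤ 1 := fun x =>
    hsum ▸ Finset.single_le_sum (fun y _ => (hq y).le) (Finset.mem_univ x)
  set m := q x₀ with hm
  have hm0 : 0 < m := hq x₀
  refine ⟨_, rapidMixingWith_of_approxTensorization (fun x => (hq x).le) hsum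
    -- The bound `q ≤ 1` compares the global entropy with that of the weight 1, and `1 ≤ m⁻¹ * q`
    -- compares the local entropies in the opposite direction. The minimum `m` also serves as `b`,
    -- since `m ^ |I| ≤ m ≤ q y`.
    (K := K * m⁻¹) (b := m) (by positivity) hm0 (fun f hf => ?_) fun y _ => ?_⟩
  · have h1 := blockSum_localEnt_le_mul (w' := fun _ => 1) hq (fun _ => one_pos) hf (r := 1)
      (fun x => by simpa using hq1 x) Finset.univ x₀
    rw [blockSum_univ, blockSum_univ, one_mul] at h1
    refine h1.trans ((hat f hf).trans ?_)
    rw [mul_assoc]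
    refine mul_le_mul_of_nonneg_left ?_ hK.le
    rw [Finset.mul_sum]
    refine Finset.sum_le_sum fun i _ => ?_
    rw [← blockSum_univ _ x₀, ← blockSum_univ _ x₀, blockSum_eq_blockSum_siteSum (Finset.mem_univ i),
      blockSum_eq_blockSum_siteSum (Finset.mem_univ i), ← blockSum_const_mul]
    refine blockSum_mono fun x _ => ?_
    rw [← blockSum_singleton, ← blockSum_singleton]
    exact blockSum_localEnt_le_mul (w := fun _ => 1) (fun _ => one_pos) hq hf
      (fun y => by rw [← div_eq_inv_mul]; exact (one_le_div hm0).2 (hmin y (Finset.mem_univ y))) _ _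
  · exact (pow_le_of_le_one hm0.le (hq1 x₀) Fintype.card_ne_zero).trans (hmin y (Finset.mem_univ y))

end SpinSystem

/-! ### Gibbs measures -/

namespace SpinSystem

open MarkovChain

section Gibbs

variable {I X : Type*} [Fintype I] [DecidableEq I] [Fintype X] [DecidableEq X]

theorem sum_exp_pos [Nonempty X] (H : (I → X) → ℝ) : 0 < ∑ τ, Real.exp (H τ) :=
  Finset.sum_pos (fun _ _ => Real.exp_pos _) Finset.univ_nonempty

theorem gibbs_pos [Nonempty X] (H : (I → X) → ℝ) (σ : I → X) : 0 < gibbs H σ :=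
  div_pos (Real.exp_pos _) (sum_exp_pos H)

theorem sum_gibbs [Nonempty X] (H : (I → X) → ℝ) : ∑ σ, gibbs H σ = 1 := by
  simp only [gibbs, ← Finset.sum_div]
  exact div_self (sum_exp_pos H).ne'

/-- The conditional distributions of a Gibbs measure. -/
noncomputable def gibbsCond (H : (I → X) → ℝ) (i : I) (x : I → X) (a : X) : ℝ :=
  Real.exp (H (Function.update x i a)) / ∑ b, Real.exp (H (Function.update x i b))

theorem isSpecification_gibbs [Nonempty X] (H : (I → X) → ℝ) :
    IsSpecification (gibbs H) (gibbsCond H) := by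
  have hpos : ∀ i x, 0 < ∑ b, Real.exp (H (Function.update x i b)) := fun i x =>
    Finset.sum_pos (fun _ _ => Real.exp_pos _) Finset.univ_nonempty
  refine ⟨fun i x a => div_nonneg (Real.exp_pos _).le (hpos i x).le, fun i x => ?_,
    fun i x b => ?_, fun i x a => ?_⟩
  · simp only [gibbsCond, ← Finset.sum_div]
    exact div_self (hpos i x).ne'
  · ext a; simp [gibbsCond]
  · have := hpos i x
    simp only [gibbs, gibbsCond, siteSum, ← Finset.sum_div]
    field_simp

/-- The discrete derivative of `H` in the spin at `i`. -/
def flipDiff (H : (I → Fin 2) → ℝ) (i : I) (x : I → Fin 2) : ℝ :=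
  H (Function.update x i 1) - H (Function.update x i 0)

theorem gibbsCond_one (H : (I → Fin 2) → ℝ) (i : I) (x : I → Fin 2) :
    gibbsCond H i x 1 = Real.sigmoid (flipDiff H i x) := by
  rw [gibbsCond, flipDiff, Real.sigmoid_def, Fin.sum_univ_two, neg_sub, Real.exp_sub]
  have h1 := Real.exp_pos (H (Function.update x i 1))
  have h0 := Real.exp_pos (H (Function.update x i 0))
  field_simp
  ring

theorem gibbsCond_zero (H : (I → Fin 2) → ℝ) (i : I) (x : I → Fin 2) :
    gibbsCond H i x 0 = Real.sigmoid (-flipDiff H i x) := by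
  have := (isSpecification_gibbs H).sum_eq_one i x
  rw [Fin.sum_univ_two, gibbsCond_one] at this
  rw [Real.sigmoid_neg]
  linarith

theorem dTV_fin_two {u v : Fin 2 → ℝ} (hu : ∑ a, u a = 1) (hv : ∑ a, v a = 1) :
    dTV u v = |u 1 - v 1| := by
  rw [Fin.sum_univ_two] at hu hv
  have e : u 0 - v 0 = -(u 1 - v 1) := by linarith
  rw [dTV, Fin.sum_univ_two, e, abs_neg]
  ring

/-- For two spins the conditional law is given by the sigmoid of the discrete derivative of `H`, so
influences are differences of sigmoids, and a bound `B` on this derivative keeps both conditional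
probabilities above `sigmoid (-B)`. -/
theorem rapidMixingWith_gibbs [Nonempty I] {H : (I → Fin 2) → ℝ} {A : I → I → ℝ} {δ B : ℝ}
    (hδ : 0 < δ) (hA0 : ∀ i j, 0 ≤ A i j)
    (hA : ∀ i j x b, i ≠ j → |Real.sigmoid (flipDiff H i x) -
      Real.sigmoid (flipDiff H i (Function.update x j b))| ≤ A i j)
    (hrow : ∀ i, ∑ j, A i j ≤ 1 - δ) (hcol : ∀ j, ∑ i, A i j ≤ 1 - δ)
    (hB : ∀ i x, |flipDiff H i x| ≤ B) :
    RapidMixingWith (gibbs H) (mixingConst (2 * (Real.sigmoid (-B) * δ ^ 2)⁻¹)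
      (Real.sigmoid (-B))) := by
  have hspec := isSpecification_gibbs H
  have hdob : IsDobrushin (gibbsCond H) A δ := ⟨hδ, hA0, fun i j x b hij => by
    rw [dTV_fin_two (hspec.sum_eq_one i _) (hspec.sum_eq_one i _), gibbsCond_one, gibbsCond_one]
    exact hA i j x b hij, hrow, hcol⟩
  have hlow : ∀ i x a, Real.sigmoid (-B) ≤ gibbsCond H i x a := fun i x a => by
    have h1 := abs_le.1 (hB i x)
    fin_cases a
    · change _ ≤ gibbsCond H i x 0
      rw [gibbsCond_zero]; exact Real.sigmoid_le (by linarith)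
    · change _ ≤ gibbsCond H i x 1
      rw [gibbsCond_one]; exact Real.sigmoid_le (by linarith)
  have hmarg : MarginalLowerBound (gibbs H) (Real.sigmoid (-B)) :=
    marginalLowerBound_of_condProb (fun x => (gibbs_pos H x).le) (Real.sigmoid_pos _)
      (Real.sigmoid_le_one _) fun i a x => by
        rw [hspec.consistent]
        exact mul_le_mul_of_nonneg_right (hlow i x a)
          (siteSum_nonneg fun x => (gibbs_pos H x).le)
  have := rapidMixingWith_of_isDobrushin (fun x => (gibbs_pos H x).le) (sum_gibbs H) hspec hdob
    (Real.sigmoid_pos _) hmarg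
  simpa using this

/-- The derivative `σ (1 - σ)` is at most 1/4. This constant produces the factor 1/2 in the
condition on the random graph model. -/
theorem abs_sigmoid_sub_le (s t : ℝ) : |Real.sigmoid s - Real.sigmoid t| ≤ 1 / 4 * |s - t| := by
  have h := Convex.norm_image_sub_le_of_norm_hasDerivWithin_le (f := Real.sigmoid)
    (f' := fun x => Real.sigmoid x * (1 - Real.sigmoid x)) (s := Set.univ) (x := t) (y := s)
    (C := 1 / 4) (fun x _ => (Real.hasDerivAt_sigmoid x).hasDerivWithinAt) (fun x _ => ?_)
    convex_univ (Set.mem_univ _) (Set.mem_univ _)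
  · simpa [Real.norm_eq_abs] using h
  · have h0 := Real.sigmoid_nonneg x
    have h1 := Real.sigmoid_le_one x
    rw [Real.norm_eq_abs, abs_of_nonneg (mul_nonneg h0 (by linarith))]
    nlinarith [sq_nonneg (Real.sigmoid x - 1 / 2)]

end Gibbs

/-! ### Exponential random graphs -/

section ERGM

variable {V : Type*} {n : ℕ}

/-- The pair `e` is the image of an edge of `G`. -/
def Hits (G : SimpleGraph V) (φ : V → Fin n) (e : EdgeSite n) : Prop :=
  ∃ u v, G.Adj u v ∧ φ u = e.1.1 ∧ φ v = e.1.2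

theorem toGraph_adj_of_lt {x : EdgeSite n → Fin 2} {a b : Fin n} (h : a < b) :
    (toGraph x).Adj a b ↔ x ⟨(a, b), h⟩ = 1 := by
  rw [toGraph, SimpleGraph.fromRel_adj]
  constructor
  · rintro ⟨-, ⟨_, h1⟩ | ⟨h2, _⟩⟩
    · exact h1
    · exact absurd h2 h.not_gt
  · exact fun h1 => ⟨h.ne, Or.inl ⟨h, h1⟩⟩

/-- Rewrites embeddings in terms of sites, which are ordered pairs `i < j`. Injectivity keeps the
ends of an edge distinct, so its image is a site in one of the two orders. -/
theorem isCopy_iff (G : SimpleGraph V) (φ : V → Fin n) (x : EdgeSite n → Fin 2) :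
    (Function.Injective φ ∧ ∀ a b, G.Adj a b → (toGraph x).Adj (φ a) (φ b)) ↔
      Function.Injective φ ∧ ∀ e, Hits G φ e → x e = 1 := by
  refine and_congr_right fun hφ => ⟨?_, fun h a b hab => ?_⟩
  · rintro h ⟨⟨a, b⟩, hlt⟩ ⟨u, v, huv, rfl, rfl⟩
    exact (toGraph_adj_of_lt hlt).1 (h u v huv)
  · rcases lt_or_gt_of_ne (hφ.ne hab.ne) with hlt | hlt
    · exact (toGraph_adj_of_lt hlt).2 (h ⟨(φ a, φ b), hlt⟩ ⟨a, b, hab, rfl, rfl⟩)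
    · exact ((toGraph_adj_of_lt hlt).2 (h ⟨(φ b, φ a), hlt⟩ ⟨b, a, hab.symm, rfl, rfl⟩)).symm

open Classical in
/-- The indicator function of the event that `φ` embeds `G` into the graph of `x`. -/
noncomputable def copyInd (G : SimpleGraph V) (φ : V → Fin n) (x : EdgeSite n → Fin 2) : ℝ :=
  if Function.Injective φ ∧ ∀ e, Hits G φ e → x e = 1 then 1 else 0

open Classical in
theorem injHomCount_eq_sum [Fintype V] (G : SimpleGraph V) (x : EdgeSite n → Fin 2) :
    (injHomCount G (toGraph x) : ℝ) = ∑ φ : V → Fin n, copyInd G φ x := by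
  rw [injHomCount, Nat.card_eq_fintype_card, Fintype.card_subtype, Finset.card_filter,
    Nat.cast_sum]
  refine Finset.sum_congr rfl fun φ _ => ?_
  by_cases h : Function.Injective φ ∧ ∀ e, Hits G φ e → x e = 1
  · rw [copyInd, if_pos h, if_pos ((isCopy_iff G φ x).2 h), Nat.cast_one]
  · rw [copyInd, if_neg h, if_neg (mt (isCopy_iff G φ x).1 h), Nat.cast_zero]

theorem copyInd_nonneg (G : SimpleGraph V) (φ : V → Fin n) (x : EdgeSite n → Fin 2) :
    0 ≤ copyInd G φ x := by
  rw [copyInd]; split_ifs <;> norm_num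

theorem copyInd_le_one (G : SimpleGraph V) (φ : V → Fin n) (x : EdgeSite n → Fin 2) :
    copyInd G φ x ≤ 1 := by
  rw [copyInd]; split_ifs <;> norm_num

theorem copyInd_update_of_not_hits {G : SimpleGraph V} {φ : V → Fin n} {e : EdgeSite n}
    (h : ¬ Hits G φ e) (x : EdgeSite n → Fin 2) (s : Fin 2) :
    copyInd G φ (Function.update x e s) = copyInd G φ x := by
  have : (∀ f, Hits G φ f → Function.update x e s f = 1) ↔ ∀ f, Hits G φ f → x f = 1 :=
    forall₂_congr fun f hf => by
      have hfe : f ≠ e := fun hfe => h (by rwa [← hfe])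
      rw [Function.update_of_ne hfe]
  simp only [copyInd]
  congr 1
  exact propext (and_congr_right fun _ => this)

theorem copyInd_update_zero {G : SimpleGraph V} {φ : V → Fin n} {e : EdgeSite n}
    (h : Hits G φ e) (x : EdgeSite n → Fin 2) : copyInd G φ (Function.update x e 0) = 0 := by
  rw [copyInd, if_neg]
  rintro ⟨-, h1⟩
  simpa using h1 e h

theorem abs_flipDiff_copyInd_le (G : SimpleGraph V) (φ : V → Fin n) (e : EdgeSite n)
    (x : EdgeSite n → Fin 2) [Decidable (Hits G φ e)] :
    |flipDiff (copyInd G φ) e x| ≤ if Hits G φ e then 1 else 0 := by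
  rw [flipDiff]
  split_ifs with h
  · rw [copyInd_update_zero h, sub_zero, abs_of_nonneg (copyInd_nonneg G φ _)]
    exact copyInd_le_one G φ _
  · rw [copyInd_update_of_not_hits h, copyInd_update_of_not_hits h, sub_self, abs_zero]

/-- For injective `φ`, the indicator is a monomial in the spins at the pairs hit by `φ`, so its
mixed difference at `e` and `f` vanishes unless both are hit. -/
theorem abs_flipDiff_copyInd_sub_le (G : SimpleGraph V) (φ : V → Fin n) {e f : EdgeSite n}
    (hef : e ≠ f) (x : EdgeSite n → Fin 2) (s : Fin 2)
    [Decidable (Hits G φ e ∧ Hits G φ f)] :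
    |flipDiff (copyInd G φ) e x - flipDiff (copyInd G φ) e (Function.update x f s)| ≤
      if Hits G φ e ∧ Hits G φ f then 1 else 0 := by
  rw [flipDiff, flipDiff]
  split_ifs with h
  · rw [copyInd_update_zero h.1, copyInd_update_zero h.1, sub_zero, sub_zero]
    have h1 := copyInd_nonneg G φ (Function.update x e 1)
    have h2 := copyInd_le_one G φ (Function.update x e 1)
    have h3 := copyInd_nonneg G φ (Function.update (Function.update x f s) e 1)
    have h4 := copyInd_le_one G φ (Function.update (Function.update x f s) e 1)
    rw [abs_le]; constructor <;> linarith
  · rw [not_and_or] at h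
    rcases h with h | h
    · simp only [copyInd_update_of_not_hits h, sub_self, abs_zero, le_refl]
    · rw [Function.update_comm hef.symm, Function.update_comm hef.symm,
        copyInd_update_of_not_hits h, copyInd_update_of_not_hits h, sub_self, abs_zero]

open Classical in
/-- The number of maps with prescribed values at two points. -/
theorem sq_mul_card_le [Fintype V] {u v : V} (huv : u ≠ v) (a b : Fin n) :
    n ^ 2 * (Finset.univ.filter fun φ : V → Fin n => φ u = a ∧ φ v = b).card ≤
      n ^ Fintype.card V := by
  have e1 : n ^ 2 = (Finset.univ : Finset (Fin n × Fin n)).card := by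
    simp [Fintype.card_prod, sq]
  have e2 : n ^ Fintype.card V = (Finset.univ : Finset (V → Fin n)).card := by
    simp
  rw [e1, e2, ← Finset.card_product]
  -- Overwriting the values at `u` and `v` by an arbitrary pair is injective, since the erased
  -- values are the prescribed `a` and `b`. Multiplying by `n ^ 2` avoids the exponent `|V| - 2`.
  refine Finset.card_le_card_of_injOn
    (fun p => Function.update (Function.update p.2 u p.1.1) v p.1.2)
    (fun _ _ => Finset.mem_coe.2 (Finset.mem_univ _)) ?_
  rintro ⟨⟨a₁, b₁⟩, φ⟩ h1 ⟨⟨a₂, b₂⟩, ψ⟩ h2 h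
  simp only [Finset.coe_product, Set.mem_prod, Finset.mem_coe, Finset.mem_filter, Finset.mem_univ,
    true_and] at h1 h2
  simp only at h
  have hu := congrFun h u
  have hv := congrFun h v
  simp only [Function.update_of_ne huv, Function.update_self] at hu hv
  have hφ : φ = ψ := by
    ext w
    by_cases hwu : w = u
    · rw [hwu, h1.1, h2.1]
    by_cases hwv : w = v
    · rw [hwv, h1.2, h2.2]
    have := congrFun h w
    simp only [Function.update_of_ne hwu, Function.update_of_ne hwv] at this
    rw [this]
  rw [hu, hv, hφ]

open Classical in
/-- The number of maps for which a given pair is the image of an edge. -/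
theorem sq_mul_card_hits_le [Fintype V] (G : SimpleGraph V) (e : EdgeSite n) :
    n ^ 2 * (Finset.univ.filter fun φ : V → Fin n => Hits G φ e).card ≤
      2 * Nat.card G.edgeSet * n ^ Fintype.card V := by
  -- Oriented edges are used because either end may be mapped to the smaller vertex of `e`; hence
  -- the factor 2.
  have h1 : (Finset.univ.filter fun φ : V → Fin n => Hits G φ e) ⊆
      (Finset.univ : Finset G.Dart).biUnion fun d =>
        Finset.univ.filter fun φ : V → Fin n => φ d.fst = e.1.1 ∧ φ d.snd = e.1.2 := by
    intro φ hφ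
    obtain ⟨u, v, huv, h1, h2⟩ := (Finset.mem_filter.1 hφ).2
    simp only [Finset.mem_biUnion, Finset.mem_univ, true_and, Finset.mem_filter]
    exact ⟨⟨(u, v), huv⟩, h1, h2⟩
  calc n ^ 2 * (Finset.univ.filter fun φ : V → Fin n => Hits G φ e).card
      ≤ n ^ 2 * ∑ d : G.Dart,
          (Finset.univ.filter fun φ : V → Fin n => φ d.fst = e.1.1 ∧ φ d.snd = e.1.2).card :=
        Nat.mul_le_mul_left _ ((Finset.card_le_card h1).trans Finset.card_biUnion_le)
    _ ≤ ∑ _d : G.Dart, n ^ Fintype.card V := by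
        rw [Finset.mul_sum]
        exact Finset.sum_le_sum fun d _ => sq_mul_card_le d.adj.ne _ _
    _ = _ := by
        rw [Finset.sum_const, Finset.card_univ, SimpleGraph.dart_card_eq_twice_card_edges,
          smul_eq_mul, Nat.card_eq_fintype_card, SimpleGraph.edgeFinset_card]

open Classical in
/-- The number of pairs which are images of edges. -/
theorem card_hits_le [Fintype V] (G : SimpleGraph V) (φ : V → Fin n) :
    (Finset.univ.filter fun f : EdgeSite n => Hits G φ f).card ≤ Nat.card G.edgeSet := by
  rw [Nat.card_eq_fintype_card, ← SimpleGraph.edgeFinset_card]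
  -- An edge has only one site as its image: reversing it would contradict the order of the two
  -- vertices of a site.
  refine Finset.card_le_card_of_forall_subsingleton
    (fun f E => ∃ u v, E = s(u, v) ∧ φ u = f.1.1 ∧ φ v = f.1.2) (fun f hf => ?_) ?_
  · obtain ⟨u, v, huv, h1, h2⟩ := (Finset.mem_filter.1 hf).2
    exact ⟨s(u, v), SimpleGraph.mem_edgeFinset.2 huv, u, v, rfl, h1, h2⟩
  · rintro E - f ⟨-, u, v, rfl, h1, h2⟩ f' ⟨-, u', v', he, h1', h2'⟩
    rcases Sym2.eq_iff.1 he with ⟨rfl, rfl⟩ | ⟨rfl, rfl⟩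
    · exact Subtype.ext (Prod.ext (h1.symm.trans h1') (h2.symm.trans h2'))
    · have h3 := f.2
      have h4 := f'.2
      rw [← h1, ← h2] at h3
      rw [← h1', ← h2'] at h4
      exact absurd h3 h4.not_gt

open Classical in
/-- The number of pairs consisting of a map with `e` in the image of `G`, and of another pair in
this image. -/
theorem sq_mul_sum_card_hits_le [Fintype V] (G : SimpleGraph V) (e : EdgeSite n) :
    (n : ℝ) ^ 2 * ∑ f, (if e = f then (0 : ℝ) else
      ∑ φ : V → Fin n, if Hits G φ e ∧ Hits G φ f then 1 else 0) ≤
      2 * (Nat.card G.edgeSet * (Nat.card G.edgeSet - 1)) * (n : ℝ) ^ Fintype.card V := by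
  set m : ℝ := (Nat.card G.edgeSet : ℝ) with hm
  -- Exchanging the sums, each map that hits `e` is counted once for every other pair it hits, hence
  -- the `- 1`.
  have h1 : ∑ f, (if e = f then (0 : ℝ) else
      ∑ φ : V → Fin n, if Hits G φ e ∧ Hits G φ f then 1 else 0) =
      ∑ φ : V → Fin n, if Hits G φ e then
        (((Finset.univ.filter fun f : EdgeSite n => Hits G φ f).card : ℝ) - 1) else 0 := by
    have : ∀ f, (if e = f then (0 : ℝ) else
      ∑ φ : V → Fin n, if Hits G φ e ∧ Hits G φ f then 1 else 0) =
      ∑ φ : V → Fin n, if e = f then (0 : ℝ) else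
        if Hits G φ e ∧ Hits G φ f then 1 else 0 := fun f => by split_ifs <;> simp
    simp only [this]
    rw [Finset.sum_comm]
    refine Finset.sum_congr rfl fun φ _ => ?_
    split_ifs with h
    · rw [Finset.card_filter, Nat.cast_sum, ← Finset.add_sum_erase _ _ (Finset.mem_univ e),
        ← Finset.add_sum_erase _ (fun f => (((if Hits G φ f then 1 else 0 : ℕ)) : ℝ))
          (Finset.mem_univ e)]
      simp only [if_true, h, Nat.cast_one, zero_add, add_sub_cancel_left, true_and]
      refine Finset.sum_congr rfl fun f hf => ?_
      rw [if_neg (Finset.ne_of_mem_erase hf).symm]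
      split_ifs <;> simp
    · simp [h]
  have h2 : ∑ φ : V → Fin n, (if Hits G φ e then
        (((Finset.univ.filter fun f : EdgeSite n => Hits G φ f).card : ℝ) - 1) else 0) ≤
      (Finset.univ.filter fun φ : V → Fin n => Hits G φ e).card * (m - 1) := by
    rw [Finset.card_filter, Nat.cast_sum, Finset.sum_mul]
    refine Finset.sum_le_sum fun φ _ => ?_
    split_ifs
    · have : ((Finset.univ.filter fun f : EdgeSite n => Hits G φ f).card : ℝ) ≤ m := by
        rw [hm]; exact_mod_cast card_hits_le G φ
      push_cast
      linarith
    · simp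
  have h3 : ((n : ℝ) ^ 2 * (Finset.univ.filter fun φ : V → Fin n => Hits G φ e).card) ≤
      2 * m * (n : ℝ) ^ Fintype.card V := by
    rw [hm]; exact_mod_cast sq_mul_card_hits_le G e
  rw [h1]
  have h4 := mul_le_mul_of_nonneg_left h2 (sq_nonneg (n : ℝ))
  rcases Nat.eq_zero_or_pos (Nat.card G.edgeSet) with h0 | h0
  -- Without edges `m - 1` is negative, so `h3` cannot be multiplied by it; but then no map hits
  -- `e`.
  · have hm0 : m = 0 := by rw [hm, h0, Nat.cast_zero]
    have h5 : (n : ℝ) ^ 2 * (Finset.univ.filter fun φ : V → Fin n => Hits G φ e).card = 0 :=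
      le_antisymm (by rw [hm0] at h3; simpa using h3) (by positivity)
    rw [← mul_assoc, h5] at h4
    rw [hm0]
    linarith
  · have hm1 : 0 ≤ m - 1 := by
      rw [hm, sub_nonneg]; exact_mod_cast h0
    have h5 := mul_le_mul_of_nonneg_right h3 hm1
    linarith

open Classical in
theorem flipDiff_ergmHamiltonian {s : ℕ} {V : Fin s → Type*} [∀ i, Fintype (V i)]
    (G : ∀ i, SimpleGraph (V i)) (β : Fin s → ℝ) (e : EdgeSite n) (x : EdgeSite n → Fin 2) :
    flipDiff (ergmHamiltonian G β n) e x = ∑ i, β i * ((n : ℝ) ^ 2 / (n : ℝ) ^ Fintype.card (V i) *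
      ∑ φ : V i → Fin n, flipDiff (copyInd (G i) φ) e x) := by
  simp only [flipDiff, ergmHamiltonian]
  rw [← mul_sub, ← Finset.sum_sub_distrib, Finset.mul_sum]
  refine Finset.sum_congr rfl fun i _ => ?_
  rw [injHomCount_eq_sum, injHomCount_eq_sum, Finset.sum_sub_distrib, Nat.card_eq_fintype_card]
  ring

/-- The truncated exponent `|E_i| - 1` is harmless: for `|E_i| = 0` the coefficient vanishes. -/
theorem deriv_ergmPhi_one {s : ℕ} {V : Fin s → Type*} (G : ∀ i, SimpleGraph (V i))
    (β : Fin s → ℝ) : deriv (ergmPhi G β) 1 =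
      ∑ i, β i * (Nat.card (G i).edgeSet * (Nat.card (G i).edgeSet - 1)) := by
  have h : HasDerivAt (ergmPhi G β) (∑ i, β i * (Nat.card (G i).edgeSet : ℝ) *
      (((Nat.card (G i).edgeSet - 1 : ℕ) : ℝ) * 1 ^ (Nat.card (G i).edgeSet - 1 - 1))) 1 :=
    HasDerivAt.fun_sum fun i _ => (hasDerivAt_pow _ 1).const_mul _
  rw [h.deriv]
  refine Finset.sum_congr rfl fun i _ => ?_
  rcases Nat.eq_zero_or_pos (Nat.card (G i).edgeSet) with h0 | h0
  · simp [h0]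
  · rw [Nat.cast_sub h0, one_pow, Nat.cast_one]; ring

/-- Rapid mixing of exponential random graphs. -/
theorem exists_rapidMixingWith_ergm {s : ℕ} {V : Fin s → Type*} [∀ i, Finite (V i)]
    (G : ∀ i, SimpleGraph (V i)) (β : Fin s → ℝ)
    (hβ : 1 / 2 * deriv (ergmPhi G (fun i => |β i|)) 1 < 1) :
    ∃ C : ℝ, ∀ n : ℕ, 2 ≤ n → RapidMixingWith (ergm G β n) C := by
  classical
  have : ∀ i, Fintype (V i) := fun i => Fintype.ofFinite (V i)
  set m : Fin s → ℝ := fun i => (Nat.card (G i).edgeSet : ℝ) with hm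
  set δ : ℝ := 1 - 1 / 2 * deriv (ergmPhi G (fun i => |β i|)) 1 with hδdef
  have hδ : 0 < δ := by linarith
  set B : ℝ := ∑ i, |β i| * (2 * m i) with hB
  refine ⟨mixingConst (2 * (Real.sigmoid (-B) * δ ^ 2)⁻¹) (Real.sigmoid (-B)), fun n hn => ?_⟩
  have : Nonempty (EdgeSite n) :=
    ⟨⟨(⟨0, by omega⟩, ⟨1, by omega⟩), by simp [Fin.lt_def]⟩⟩
  have hn0 : (0 : ℝ) < n := by exact_mod_cast (by omega : 0 < n)
  set r : Fin s → ℝ := fun i => (n : ℝ) ^ 2 / (n : ℝ) ^ Fintype.card (V i) with hr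
  have hr0 : ∀ i, 0 ≤ r i := fun i => by simp only [hr]; positivity
  -- The factor 1/4 is the Lipschitz constant of the sigmoid; the rest counts the embeddings through
  -- both `e` and `f`. The matrix is symmetric, so the row bound also serves for the columns.
  set A : EdgeSite n → EdgeSite n → ℝ := fun e f => if e = f then 0 else
    1 / 4 * ∑ i, |β i| * (r i *
      ∑ φ : V i → Fin n, if Hits (G i) φ e ∧ Hits (G i) φ f then (1 : ℝ) else 0) with hA
  have hsymm : ∀ e f, A e f = A f e := fun e f => by
    simp only [hA, eq_comm (a := e), and_comm (a := Hits _ _ e)]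
  have hrow : ∀ e, ∑ f, A e f ≤ 1 - δ := by
    intro e
    have e1 : ∀ f, A e f = ∑ i, 1 / 4 * (|β i| * (r i * if e = f then (0 : ℝ) else
        ∑ φ : V i → Fin n, if Hits (G i) φ e ∧ Hits (G i) φ f then (1 : ℝ) else 0)) := by
      intro f
      simp only [hA]
      split_ifs
      · simp
      · rw [Finset.mul_sum]
    simp only [e1]
    rw [Finset.sum_comm, hδdef, sub_sub_cancel, deriv_ergmPhi_one, Finset.mul_sum]
    refine Finset.sum_le_sum fun i _ => ?_
    rw [← Finset.mul_sum, ← Finset.mul_sum, ← Finset.mul_sum]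
    have h1 := sq_mul_sum_card_hits_le (G i) e
    have h2 : r i * ∑ f, (if e = f then (0 : ℝ) else
        ∑ φ : V i → Fin n, if Hits (G i) φ e ∧ Hits (G i) φ f then (1 : ℝ) else 0) ≤
        2 * (m i * (m i - 1)) := by
      simp only [hr]
      rw [div_mul_eq_mul_div, div_le_iff₀ (by positivity)]
      exact h1
    have h3 := mul_le_mul_of_nonneg_left h2 (abs_nonneg (β i))
    simp only [hm] at h3
    linarith
  refine rapidMixingWith_gibbs hδ (fun e f => ?_) (fun e f x b hef => ?_) hrow (fun f => ?_)
    fun e x => ?_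
  · simp only [hA]
    split_ifs
    · rfl
    · refine mul_nonneg (by norm_num) (Finset.sum_nonneg fun i _ => mul_nonneg (abs_nonneg _)
        (mul_nonneg (hr0 i) (Finset.sum_nonneg fun φ _ => ?_)))
      split_ifs <;> norm_num
  · refine (abs_sigmoid_sub_le _ _).trans ?_
    simp only [hA, if_neg hef]
    refine mul_le_mul_of_nonneg_left ?_ (by norm_num)
    rw [flipDiff_ergmHamiltonian, flipDiff_ergmHamiltonian, ← Finset.sum_sub_distrib]
    refine (Finset.abs_sum_le_sum_abs _ _).trans (Finset.sum_le_sum fun i _ => ?_)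
    rw [← mul_sub, ← mul_sub, ← Finset.sum_sub_distrib, abs_mul, abs_mul, abs_of_nonneg (hr0 i)]
    refine mul_le_mul_of_nonneg_left (mul_le_mul_of_nonneg_left ?_ (hr0 i)) (abs_nonneg _)
    exact (Finset.abs_sum_le_sum_abs _ _).trans
      (Finset.sum_le_sum fun φ _ => abs_flipDiff_copyInd_sub_le (G i) φ hef x b)
  · simp only [hsymm _ f]; exact hrow f
  · rw [flipDiff_ergmHamiltonian]
    refine (Finset.abs_sum_le_sum_abs _ _).trans (Finset.sum_le_sum fun i _ => ?_)
    rw [abs_mul, abs_mul, abs_of_nonneg (hr0 i)]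
    refine mul_le_mul_of_nonneg_left ?_ (abs_nonneg _)
    have h1 : |∑ φ : V i → Fin n, flipDiff (copyInd (G i) φ) e x| ≤
        ((Finset.univ.filter fun φ : V i → Fin n => Hits (G i) φ e).card : ℝ) := by
      rw [Finset.card_filter, Nat.cast_sum]
      refine (Finset.abs_sum_le_sum_abs _ _).trans (Finset.sum_le_sum fun φ _ => ?_)
      refine (abs_flipDiff_copyInd_le (G i) φ e x).trans (le_of_eq ?_)
      split_ifs <;> simp
    refine (mul_le_mul_of_nonneg_left h1 (hr0 i)).trans ?_
    simp only [hr]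
    rw [div_mul_eq_mul_div, div_le_iff₀ (by positivity)]
    simp only [hm]; exact_mod_cast sq_mul_card_hits_le (G i) e

end ERGM

end SpinSystem

/-! ### Vertex-weighted exponential random graphs -/

namespace SpinSystem

section VertexWeighted

variable {n : ℕ}

theorem spin_mul_self (a : Fin 2) : ((a : ℕ) : ℝ) * ((a : ℕ) : ℝ) = ((a : ℕ) : ℝ) := by
  fin_cases a <;> simp

/-- Removing coincident indices from the full sums and using `a * a = a` for spins turns the sums
over distinct indices into the falling factorials of the number `T` of ones. -/
theorem vertexWeightedHamiltonian_eq (β₁ β₂ p : ℝ) (σ : Fin n → Fin 2) {T : ℝ}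
    (hT : T = ∑ i, ((σ i : ℕ) : ℝ)) :
    vertexWeightedHamiltonian β₁ β₂ p n σ = Real.log (p / (1 - p)) * T
      + β₁ / n * (T * (T - 1)) + β₂ / (n : ℝ) ^ 2 * (T * (T - 1) * (T - 2)) := by
  set a : Fin n → ℝ := fun i => ((σ i : ℕ) : ℝ) with ha
  have haa : ∀ i, a i * a i = a i := fun i => spin_mul_self (σ i)
  have h2 : ∑ i, ∑ j, (if i ≠ j then a i * a j else 0) = T * (T - 1) := by
    have : ∀ i, ∑ j, (if i ≠ j then a i * a j else 0) = a i * (T - 1) := fun i => by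
      have e : ∀ j, (if i ≠ j then a i * a j else 0) =
          a i * a j - if i = j then a i * a j else 0 := fun j => by
        by_cases h : i = j <;> simp [h]
      simp only [e, Finset.sum_sub_distrib, ← Finset.mul_sum, Finset.sum_ite_eq, Finset.mem_univ,
        if_true, haa, ← hT]
      ring
    simp only [this, ← Finset.sum_mul, ← hT]
  have h3 : ∑ i, ∑ j, ∑ k, (if i ≠ j ∧ j ≠ k ∧ i ≠ k then a i * a j * a k else 0) =
      T * (T - 1) * (T - 2) := by
    have : ∀ i j, ∑ k, (if i ≠ j ∧ j ≠ k ∧ i ≠ k then a i * a j * a k else 0) =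
        (if i ≠ j then a i * a j else 0) * (T - 2) := fun i j => by
      by_cases hij : i = j
      · simp [hij]
      · have e : ∀ k, (if i ≠ j ∧ j ≠ k ∧ i ≠ k then a i * a j * a k else 0) =
            a i * a j * a k - (if j = k then a i * a j * a k else 0) -
              if i = k then a i * a j * a k else 0 := fun k => by
          by_cases hjk : j = k
          · subst hjk; simp [hij]
          · by_cases hik : i = k
            · subst hik; simp [hjk]
            · simp [hij, hjk, hik]
        rw [Finset.sum_congr rfl fun k _ => e k, if_pos hij]
        simp only [Finset.sum_sub_distrib, ← Finset.mul_sum, Finset.sum_ite_eq,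
          Finset.mem_univ, if_true, ← hT]
        linear_combination (-a i) * haa j - a j * haa i
    simp only [this, ← Finset.sum_mul, h2]
  rw [vertexWeightedHamiltonian]
  change Real.log (p / (1 - p)) * ∑ i, a i +
    β₁ / n * ∑ i, ∑ j, (if i ≠ j then a i * a j else 0) + β₂ / (n : ℝ) ^ 2 *
    ∑ i, ∑ j, ∑ k, (if i ≠ j ∧ j ≠ k ∧ i ≠ k then a i * a j * a k else 0) = _
  rw [h2, h3, ← hT]

/-- The number of ones away from the site `i`. -/
def otherSum (i : Fin n) (x : Fin n → Fin 2) : ℝ :=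
  ∑ j ∈ Finset.univ.erase i, ((x j : ℕ) : ℝ)

/-- The exponent of `vertexWeightedPhi` with a linear perturbation of size `ε`. -/
noncomputable def vertexWeightedExponent (β₁ β₂ p ε s : ℝ) : ℝ :=
  2 * β₁ * s + 3 * β₂ * s ^ 2 + Real.log (p / (1 - p)) - ε * s

/-- With `S` ones at the other sites, the cubic term contributes `3 β₂ S (S - 1) / n²`; the
difference from `3 β₂ (S / n)²` is the perturbation with `ε = 3 β₂ / n`. -/
theorem flipDiff_vertexWeightedHamiltonian (β₁ β₂ p : ℝ) (hn : n ≠ 0) (i : Fin n)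
    (x : Fin n → Fin 2) : flipDiff (vertexWeightedHamiltonian β₁ β₂ p n) i x =
      vertexWeightedExponent β₁ β₂ p (3 * β₂ / n) (otherSum i x / n) := by
  have e : ∀ b : Fin 2, otherSum i x + ((b : ℕ) : ℝ) =
      ∑ j, ((Function.update x i b j : ℕ) : ℝ) := fun b => by
    rw [← Finset.add_sum_erase _ _ (Finset.mem_univ i), Function.update_self, otherSum, add_comm]
    congr 1
    refine Finset.sum_congr rfl fun j hj => ?_
    rw [Function.update_of_ne (Finset.ne_of_mem_erase hj)]
  have hn' : (n : ℝ) ≠ 0 := by exact_mod_cast hn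
  rw [flipDiff, vertexWeightedHamiltonian_eq β₁ β₂ p _ (e 1),
    vertexWeightedHamiltonian_eq β₁ β₂ p _ (e 0), vertexWeightedExponent]
  simp only [Fin.val_one, Fin.val_zero, Nat.cast_one, Nat.cast_zero]
  field_simp
  ring

theorem spin_nonneg (a : Fin 2) : (0 : ℝ) ≤ ((a : ℕ) : ℝ) := Nat.cast_nonneg _

theorem spin_le_one (a : Fin 2) : ((a : ℕ) : ℝ) ≤ 1 := by
  exact_mod_cast Nat.lt_succ_iff.1 a.2

theorem otherSum_div_mem (hn : n ≠ 0) (i : Fin n) (x : Fin n → Fin 2) :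
    otherSum i x / n ∈ Set.Icc (0 : ℝ) 1 := by
  have hn' : (0 : ℝ) < n := by exact_mod_cast Nat.pos_of_ne_zero hn
  refine ⟨div_nonneg (Finset.sum_nonneg fun j _ => spin_nonneg _) hn'.le, ?_⟩
  rw [div_le_one hn', otherSum]
  refine (Finset.sum_le_sum fun j _ => spin_le_one (x j)).trans ?_
  rw [Finset.sum_const, nsmul_eq_mul, mul_one, Finset.card_erase_of_mem (Finset.mem_univ i),
    Finset.card_univ, Fintype.card_fin]
  exact_mod_cast Nat.sub_le n 1

theorem abs_otherSum_sub_le {i j : Fin n} (hij : i ≠ j) (x : Fin n → Fin 2) (b : Fin 2) :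
    |otherSum i x - otherSum i (Function.update x j b)| ≤ 1 := by
  have hj : j ∈ Finset.univ.erase i := Finset.mem_erase.2 ⟨hij.symm, Finset.mem_univ j⟩
  rw [otherSum, otherSum, ← Finset.add_sum_erase _ _ hj, ← Finset.add_sum_erase _ _ hj,
    Function.update_self]
  have e : ∑ k ∈ (Finset.univ.erase i).erase j, ((Function.update x j b k : ℕ) : ℝ) =
      ∑ k ∈ (Finset.univ.erase i).erase j, ((x k : ℕ) : ℝ) :=
    Finset.sum_congr rfl fun k hk => by
      rw [Function.update_of_ne (Finset.ne_of_mem_erase hk)]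
  rw [e, add_sub_add_right_eq_sub, abs_le]
  constructor <;> linarith [spin_nonneg (x j), spin_le_one (x j), spin_nonneg b, spin_le_one b]

theorem vertexWeightedPhi_eq (β₁ β₂ p : ℝ) :
    vertexWeightedPhi β₁ β₂ p = fun s =>
      Real.sigmoid (vertexWeightedExponent β₁ β₂ p 0 s) := by
  ext s
  rw [vertexWeightedPhi, vertexWeightedExponent, zero_mul, sub_zero, Real.sigmoid_def,
    Real.exp_neg]
  have := Real.exp_pos (2 * β₁ * s + 3 * β₂ * s ^ 2 + Real.log (p / (1 - p)))
  field_simp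
  ring

/-- The derivative of the sigmoid function. -/
noncomputable def sigmoidDeriv (t : ℝ) : ℝ :=
  Real.sigmoid t * (1 - Real.sigmoid t)

theorem sigmoidDeriv_nonneg (t : ℝ) : 0 ≤ sigmoidDeriv t :=
  mul_nonneg (Real.sigmoid_nonneg t) (sub_nonneg.2 (Real.sigmoid_le_one t))

theorem sigmoidDeriv_le_one (t : ℝ) : sigmoidDeriv t ≤ 1 :=
  mul_le_one₀ (Real.sigmoid_le_one t) (sub_nonneg.2 (Real.sigmoid_le_one t))
    (sub_le_self 1 (Real.sigmoid_nonneg t))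

theorem abs_sigmoidDeriv_sub_le (s t : ℝ) : |sigmoidDeriv s - sigmoidDeriv t| ≤ |s - t| := by
  have h := abs_sigmoid_sub_le s t
  have e : sigmoidDeriv s - sigmoidDeriv t = (Real.sigmoid s - Real.sigmoid t) *
      (1 - Real.sigmoid s - Real.sigmoid t) := by
    rw [sigmoidDeriv, sigmoidDeriv]; ring
  have h1 : |1 - Real.sigmoid s - Real.sigmoid t| ≤ 1 := by
    rw [abs_le]
    constructor <;> linarith [Real.sigmoid_nonneg s, Real.sigmoid_le_one s, Real.sigmoid_nonneg t,
      Real.sigmoid_le_one t]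
  rw [e, abs_mul]
  calc _ ≤ |Real.sigmoid s - Real.sigmoid t| * 1 := mul_le_mul_of_nonneg_left h1 (abs_nonneg _)
    _ ≤ |s - t| := by linarith [abs_nonneg (s - t)]

theorem hasDerivAt_sigmoid_exponent (β₁ β₂ p ε s : ℝ) :
    HasDerivAt (fun s => Real.sigmoid (vertexWeightedExponent β₁ β₂ p ε s))
      (sigmoidDeriv (vertexWeightedExponent β₁ β₂ p ε s) * (2 * β₁ + 6 * β₂ * s - ε)) s := by
  have h1 : HasDerivAt (vertexWeightedExponent β₁ β₂ p ε) (2 * β₁ + 6 * β₂ * s - ε) s := by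
    have h2 := ((((hasDerivAt_id s).const_mul (2 * β₁)).add
      ((hasDerivAt_pow 2 s).const_mul (3 * β₂))).add_const (Real.log (p / (1 - p)))).sub
      ((hasDerivAt_id s).const_mul ε)
    convert! h2 using 1
    push_cast
    ring
  exact (Real.hasDerivAt_sigmoid _).comp s h1

theorem abs_slope_le {β₁ β₂ s : ℝ} (hs : s ∈ Set.Icc (0 : ℝ) 1) :
    |2 * β₁ + 6 * β₂ * s| ≤ 2 * |β₁| + 6 * |β₂| := by
  refine (abs_add_le _ _).trans ?_
  rw [abs_mul, abs_mul, abs_mul, abs_of_nonneg hs.1, abs_two,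
    abs_of_pos (by norm_num : (0 : ℝ) < 6)]
  have := mul_le_mul_of_nonneg_left hs.2 (abs_nonneg β₂)
  linarith

/-- The supremum of `|φ'|` over the open interval bounds `|φ'|` on the closed one. -/
theorem abs_deriv_phi_le (β₁ β₂ p : ℝ) {s : ℝ} (hs : s ∈ Set.Icc (0 : ℝ) 1) :
    |sigmoidDeriv (vertexWeightedExponent β₁ β₂ p 0 s) * (2 * β₁ + 6 * β₂ * s)| ≤
      ⨆ x : Set.Ioo (0 : ℝ) 1, |deriv (vertexWeightedPhi β₁ β₂ p) x| := by
  have hd : ∀ s, deriv (vertexWeightedPhi β₁ β₂ p) s =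
      sigmoidDeriv (vertexWeightedExponent β₁ β₂ p 0 s) * (2 * β₁ + 6 * β₂ * s) := fun s => by
    rw [vertexWeightedPhi_eq, (hasDerivAt_sigmoid_exponent β₁ β₂ p 0 s).deriv, sub_zero]
  -- Boundedness is essential: the supremum of an unbounded real family is 0 by convention and would
  -- bound nothing.
  have hbdd : BddAbove (Set.range fun x : Set.Ioo (0 : ℝ) 1 =>
      |deriv (vertexWeightedPhi β₁ β₂ p) x|) := by
    refine ⟨2 * |β₁| + 6 * |β₂|, ?_⟩
    rintro _ ⟨x, rfl⟩
    simp only [hd]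
    rw [abs_mul, abs_of_nonneg (sigmoidDeriv_nonneg _)]
    have h1 := abs_slope_le (β₁ := β₁) (β₂ := β₂) (Set.Ioo_subset_Icc_self x.2)
    exact (mul_le_of_le_one_left (abs_nonneg _) (sigmoidDeriv_le_one _)).trans h1
  have hcont : Continuous fun s =>
      |sigmoidDeriv (vertexWeightedExponent β₁ β₂ p 0 s) * (2 * β₁ + 6 * β₂ * s)| := by
    have h1 : Continuous (vertexWeightedExponent β₁ β₂ p 0) := by
      unfold vertexWeightedExponent; fun_prop
    have h2 : Continuous sigmoidDeriv :=
      continuous_sigmoid.mul (continuous_const.sub continuous_sigmoid)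
    exact ((h2.comp h1).mul (by fun_prop)).abs
  have hsub : closure (Set.Ioo (0 : ℝ) 1) ⊆ {s : ℝ |
      |sigmoidDeriv (vertexWeightedExponent β₁ β₂ p 0 s) * (2 * β₁ + 6 * β₂ * s)| ≤
      ⨆ x : Set.Ioo (0 : ℝ) 1, |deriv (vertexWeightedPhi β₁ β₂ p) x|} := by
    refine closure_minimal (fun s hs => ?_) (isClosed_le hcont continuous_const)
    have h := le_ciSup hbdd ⟨s, hs⟩
    simp only at h
    rw [hd s] at h
    exact h
  rw [closure_Ioo (by norm_num)] at hsub
  exact hsub hs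

/-- Mean value inequality. Relative to `ε = 0`, the derivative changes in two ways: the sigmoid
derivative is evaluated at a point shifted by at most `|ε|`, and the slope of the exponent changes
by `ε`. -/
theorem abs_sigmoid_exponent_sub_le {β₁ β₂ p ε θ : ℝ}
    (hθ : ∀ s ∈ Set.Icc (0 : ℝ) 1,
      |sigmoidDeriv (vertexWeightedExponent β₁ β₂ p 0 s) * (2 * β₁ + 6 * β₂ * s)| ≤ θ)
    {s t : ℝ} (hs : s ∈ Set.Icc (0 : ℝ) 1) (ht : t ∈ Set.Icc (0 : ℝ) 1) :
    |Real.sigmoid (vertexWeightedExponent β₁ β₂ p ε s) -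
      Real.sigmoid (vertexWeightedExponent β₁ β₂ p ε t)| ≤
      (θ + |ε| * (2 * |β₁| + 6 * |β₂| + 1)) * |s - t| := by
  refine Convex.norm_image_sub_le_of_norm_hasDerivWithin_le
    (f := fun s => Real.sigmoid (vertexWeightedExponent β₁ β₂ p ε s))
    (fun x _ => (hasDerivAt_sigmoid_exponent β₁ β₂ p ε x).hasDerivWithinAt) (fun x hx => ?_)
    (convex_Icc 0 1) ht hs
  rw [Real.norm_eq_abs]
  set u := vertexWeightedExponent β₁ β₂ p ε x with hu
  set v := vertexWeightedExponent β₁ β₂ p 0 x with hv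
  have huv : |u - v| ≤ |ε| := by
    have e : u - v = -(ε * x) := by
      rw [hu, hv, vertexWeightedExponent, vertexWeightedExponent]; ring
    rw [e, abs_neg, abs_mul, abs_of_nonneg hx.1]
    exact mul_le_of_le_one_right (abs_nonneg ε) hx.2
  have e : sigmoidDeriv u * (2 * β₁ + 6 * β₂ * x - ε) =
      sigmoidDeriv v * (2 * β₁ + 6 * β₂ * x) +
      (sigmoidDeriv u - sigmoidDeriv v) * (2 * β₁ + 6 * β₂ * x) + -(sigmoidDeriv u * ε) := by ring
  have h1 : |(sigmoidDeriv u - sigmoidDeriv v) * (2 * β₁ + 6 * β₂ * x)| ≤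
      |ε| * (2 * |β₁| + 6 * |β₂|) := by
    rw [abs_mul]
    exact mul_le_mul ((abs_sigmoidDeriv_sub_le u v).trans huv) (abs_slope_le hx) (abs_nonneg _)
      (abs_nonneg _)
  have h2 : |-(sigmoidDeriv u * ε)| ≤ |ε| := by
    rw [abs_neg, abs_mul, abs_of_nonneg (sigmoidDeriv_nonneg u)]
    exact mul_le_of_le_one_left (abs_nonneg ε) (sigmoidDeriv_le_one u)
  rw [e]
  refine (abs_add_le _ _).trans ?_
  have h3 := abs_add_le (sigmoidDeriv v * (2 * β₁ + 6 * β₂ * x))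
    ((sigmoidDeriv u - sigmoidDeriv v) * (2 * β₁ + 6 * β₂ * x))
  have h4 := hθ x hx
  linarith

/-- Rapid mixing of vertex-weighted exponential random graphs. -/
theorem exists_rapidMixingWith_vertexWeighted (β₁ β₂ p : ℝ)
    (hβ : (⨆ x : Set.Ioo (0 : ℝ) 1, |deriv (vertexWeightedPhi β₁ β₂ p) x|) < 1) :
    ∃ C : ℝ, ∀ n : ℕ, 1 ≤ n → RapidMixingWith (vertexWeighted β₁ β₂ p n) C := by
  set θ := ⨆ x : Set.Ioo (0 : ℝ) 1, |deriv (vertexWeightedPhi β₁ β₂ p) x| with hθdef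
  have hθ0 : 0 ≤ θ := Real.iSup_nonneg fun _ => abs_nonneg _
  -- Half of the gap `1 - θ` absorbs the perturbation `c / n` once `n ≥ c / δ`; the other half
  -- remains as the Dobrushin gap.
  set δ := (1 - θ) / 2 with hδdef
  have hδ : 0 < δ := by rw [hδdef]; linarith
  set c := 3 * |β₂| * (2 * |β₁| + 6 * |β₂| + 1) with hc
  have hc0 : 0 ≤ c := by positivity
  set B := |Real.log (p / (1 - p))| + 2 * |β₁| + 6 * |β₂| with hB
  obtain ⟨n₀, hn₀⟩ := exists_nat_ge (c / δ)
  have hlarge : ∀ n : ℕ, 1 ≤ n → n₀ ≤ n → RapidMixingWith (vertexWeighted β₁ β₂ p n)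
      (mixingConst (2 * (Real.sigmoid (-B) * δ ^ 2)⁻¹) (Real.sigmoid (-B))) := by
    intro n hn1 hn
    have hn0 : n ≠ 0 := by omega
    have hnpos : (0 : ℝ) < n := by exact_mod_cast hn1
    have hn1' : (1 : ℝ) ≤ n := by exact_mod_cast hn1
    have : Nonempty (Fin n) := ⟨⟨0, hn1⟩⟩
    have hε : |3 * β₂ / n| = 3 * |β₂| / n := by
      rw [abs_div, abs_mul, abs_of_pos hnpos, abs_of_pos (by norm_num : (0 : ℝ) < 3)]
    have hcn : c / n ≤ δ := by
      rw [div_le_iff₀ hnpos, ← div_le_iff₀' hδ]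
      exact hn₀.trans (by exact_mod_cast hn)
    have hsum : ∑ _j : Fin n, (θ + c / n) / n ≤ 1 - δ := by
      rw [Finset.sum_const, Finset.card_univ, Fintype.card_fin, nsmul_eq_mul,
        mul_div_cancel₀ _ hnpos.ne']
      rw [hδdef] at hcn ⊢
      linarith
    refine rapidMixingWith_gibbs (A := fun _ _ => (θ + c / n) / n) hδ (fun _ _ => by positivity)
      (fun i j x b hij => ?_) (fun _ => hsum) (fun _ => hsum) (fun i x => ?_)
    · rw [flipDiff_vertexWeightedHamiltonian β₁ β₂ p hn0,
        flipDiff_vertexWeightedHamiltonian β₁ β₂ p hn0]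
      refine (abs_sigmoid_exponent_sub_le (fun s hs => abs_deriv_phi_le β₁ β₂ p hs)
        (otherSum_div_mem hn0 i x) (otherSum_div_mem hn0 i _)).trans ?_
      rw [hε, ← sub_div, abs_div, abs_of_pos hnpos, ← hθdef]
      have e : θ + 3 * |β₂| / n * (2 * |β₁| + 6 * |β₂| + 1) = θ + c / n := by rw [hc]; ring
      rw [e, ← mul_div_assoc]
      exact div_le_div_of_nonneg_right
        (mul_le_of_le_one_right (by positivity) (abs_otherSum_sub_le hij x b)) hnpos.le
    · rw [flipDiff_vertexWeightedHamiltonian β₁ β₂ p hn0]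
      obtain ⟨hs0, hs1⟩ := otherSum_div_mem hn0 i x
      set s := otherSum i x / n
      have h1 : |2 * β₁ * s| ≤ 2 * |β₁| := by
        rw [abs_mul, abs_mul, abs_two, abs_of_nonneg hs0]
        exact mul_le_of_le_one_right (by positivity) hs1
      have h2 : |3 * β₂ * s ^ 2| ≤ 3 * |β₂| := by
        rw [abs_mul, abs_mul, abs_of_pos (by norm_num : (0 : ℝ) < 3),
          abs_of_nonneg (sq_nonneg s)]
        exact mul_le_of_le_one_right (by positivity) (pow_le_one₀ hs0 hs1)
      have h3 : |3 * β₂ / n * s| ≤ 3 * |β₂| := by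
        rw [abs_mul, hε, abs_of_nonneg hs0]
        exact (mul_le_of_le_one_right (by positivity) hs1).trans
          (div_le_self (by positivity) hn1')
      rw [vertexWeightedExponent, hB]
      refine (abs_sub _ _).trans ?_
      have h4 := abs_add_le (2 * β₁ * s + 3 * β₂ * s ^ 2) (Real.log (p / (1 - p)))
      have h5 := abs_add_le (2 * β₁ * s) (3 * β₂ * s ^ 2)
      linarith
  -- For the finitely many `n < n₀`, any constant suffices, and full support provides one.
  have hsmall : ∀ n : ℕ, ∃ C, 1 ≤ n → RapidMixingWith (vertexWeighted β₁ β₂ p n) C := by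
    intro n
    by_cases hn : 1 ≤ n
    · have : Nonempty (Fin n) := ⟨⟨0, hn⟩⟩
      obtain ⟨C, hC⟩ := exists_rapidMixingWith_of_pos
        (gibbs_pos (vertexWeightedHamiltonian β₁ β₂ p n)) (sum_gibbs _)
      exact ⟨C, fun _ => hC⟩
    · exact ⟨0, fun h => absurd h hn⟩
  choose C hC using hsmall
  set C₀ := mixingConst (2 * (Real.sigmoid (-B) * δ ^ 2)⁻¹) (Real.sigmoid (-B))
  have hS : 0 ≤ ∑ m ∈ Finset.range n₀, |C m| := Finset.sum_nonneg fun _ _ => abs_nonneg _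
  refine ⟨max C₀ (∑ m ∈ Finset.range n₀, |C m|), fun n hn => ?_⟩
  rcases lt_or_ge n n₀ with h | h
  · refine (hC n hn).mono ((le_abs_self _).trans (le_trans ?_ (le_max_right _ _)))
    exact Finset.single_le_sum (f := fun m => |C m|) (fun _ _ => abs_nonneg _)
      (Finset.mem_range.2 h)
  · exact (hlarge n hn h).mono (le_max_left _ _)

end VertexWeighted

end SpinSystem

/-! ### Random colorings -/

namespace SpinSystem

open MarkovChain

section Uniform

variable {X : Type*} [Fintype X] [DecidableEq X]

/-- The uniform distribution on a finite set. -/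
noncomputable def uniformOn (S : Finset X) (a : X) : ℝ :=
  if a ∈ S then (S.card : ℝ)⁻¹ else 0

theorem uniformOn_nonneg (S : Finset X) (a : X) : 0 ≤ uniformOn S a := by
  rw [uniformOn]; split_ifs <;> positivity

theorem sum_uniformOn {S : Finset X} (hS : S.Nonempty) : ∑ a, uniformOn S a = 1 := by
  have : (S.card : ℝ) ≠ 0 := by exact_mod_cast hS.card_ne_zero
  simp [uniformOn, this]

/-- If `S` is the larger set, its uniform weights are the smaller ones, so the positive part of the
difference lives on `S \ T`. This is at most one point, of mass `1 / |S|`. -/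
theorem dTV_uniformOn_le {S T : Finset X} {m : ℕ} (hm : 0 < m) (hS : m ≤ S.card)
    (hT : m ≤ T.card) (hST : (S \ T).card ≤ 1) (hTS : (T \ S).card ≤ 1) :
    dTV (uniformOn S) (uniformOn T) ≤ (m : ℝ)⁻¹ := by
  wlog h : T.card ≤ S.card generalizing S T
  · rw [dTV_comm]
    exact this hT hS hTS hST (le_of_not_ge h)
  have hS0 : 0 < S.card := hm.trans_le hS
  have hT0 : 0 < T.card := hm.trans_le hT
  have hS' : (0 : ℝ) < S.card := by exact_mod_cast hS0
  have hT' : (0 : ℝ) < T.card := by exact_mod_cast hT0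
  have hm' : (0 : ℝ) < m := by exact_mod_cast hm
  have h1 : dTV (uniformOn S) (uniformOn T) =
      ∑ a, max (uniformOn S a - uniformOn T a) 0 := by
    have e : ∀ z : ℝ, |z| = 2 * max z 0 - z := fun z => by
      rcases le_total 0 z with hz | hz
      · rw [abs_of_nonneg hz, max_eq_left hz]; ring
      · rw [abs_of_nonpos hz, max_eq_right hz]; ring
    simp only [dTV, e, Finset.sum_sub_distrib, ← Finset.mul_sum,
      sum_uniformOn (Finset.card_pos.1 hS0), sum_uniformOn (Finset.card_pos.1 hT0)]
    ring
  have h2 : ∀ a, max (uniformOn S a - uniformOn T a) 0 ≤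
      if a ∈ S \ T then (S.card : ℝ)⁻¹ else 0 := fun a => by
    have hle : (S.card : ℝ)⁻¹ ≤ (T.card : ℝ)⁻¹ := inv_anti₀ hT' (by exact_mod_cast h)
    have h0 : 0 ≤ (S.card : ℝ)⁻¹ := (inv_pos.2 hS').le
    have h0' : 0 ≤ (T.card : ℝ)⁻¹ := (inv_pos.2 hT').le
    by_cases haS : a ∈ S <;> by_cases haT : a ∈ T <;> simp [uniformOn, haS, haT, hle]
  rw [h1]
  refine (Finset.sum_le_sum fun a _ => h2 a).trans ?_
  rw [Finset.sum_ite_mem, Finset.univ_inter, Finset.sum_const, nsmul_eq_mul]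
  calc ((S \ T).card : ℝ) * (S.card : ℝ)⁻¹ ≤ 1 * (m : ℝ)⁻¹ :=
        mul_le_mul (by exact_mod_cast hST) (inv_anti₀ hm' (by exact_mod_cast hS))
          (inv_pos.2 hS').le zero_le_one
    _ = _ := one_mul _

end Uniform

section Graph

variable {V : Type*} [Fintype V] [DecidableEq V] (G : SimpleGraph V) [DecidableRel G.Adj]

/-- A matrix of influences supported on the edges of a graph of bounded degree. -/
theorem isDobrushin_of_adj {X : Type*} [Fintype X] [DecidableEq X]
    {κ : V → (V → X) → X → ℝ} {Δ : ℕ} (hΔ : G.maxDegree ≤ Δ) {α : ℝ} (hα : 0 ≤ α)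
    (hαΔ : Δ * α < 1)
    (hadj : ∀ v w x b, G.Adj v w → dTV (κ v x) (κ v (Function.update x w b)) ≤ α)
    (hnot : ∀ v w x b, v ≠ w → ¬ G.Adj v w → κ v (Function.update x w b) = κ v x) :
    IsDobrushin κ (fun v w => if G.Adj v w then α else 0) (1 - Δ * α) := by
  have hrow : ∀ v, ∑ w, (if G.Adj v w then α else 0) ≤ 1 - (1 - Δ * α) := fun v => by
    rw [← Finset.sum_filter, Finset.sum_const, nsmul_eq_mul, sub_sub_cancel,
      ← SimpleGraph.neighborFinset_eq_filter, SimpleGraph.card_neighborFinset_eq_degree]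
    exact mul_le_mul_of_nonneg_right
      (by exact_mod_cast (G.degree_le_maxDegree v).trans hΔ) hα
  refine ⟨by linarith, fun v w => ?_, fun v w x b hvw => ?_, hrow, fun w => ?_⟩
  · split_ifs
    · exact hα
    · rfl
  · split_ifs with h
    · exact hadj v w x b h
    · rw [hnot v w x b hvw h]; simp [dTV]
  · simp only [G.adj_comm _ w]; exact hrow w

theorem card_neighborFinset_le {Δ : ℕ} (hΔ : G.maxDegree ≤ Δ) (v : V) :
    (G.neighborFinset v).card ≤ Δ := by
  rw [SimpleGraph.card_neighborFinset_eq_degree]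
  exact (G.degree_le_maxDegree v).trans hΔ

section Coloring

variable {k : ℕ}

/-- The colors which do not appear at the neighbours of `v`. -/
def available (v : V) (x : V → Fin k) : Finset (Fin k) :=
  Finset.univ \ (G.neighborFinset v).image x

theorem mem_available {v : V} {x : V → Fin k} {a : Fin k} :
    a ∈ available G v x ↔ ∀ w, G.Adj v w → x w ≠ a := by
  simp [available]

theorem le_card_available {Δ : ℕ} (hΔ : G.maxDegree ≤ Δ) (hk : 2 * Δ + 1 ≤ k) (v : V)
    (x : V → Fin k) : Δ + 1 ≤ (available G v x).card := by
  have h1 := (Finset.card_image_le (s := G.neighborFinset v) (f := x)).trans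
    (card_neighborFinset_le G hΔ v)
  have h2 := Finset.le_card_sdiff ((G.neighborFinset v).image x) (Finset.univ : Finset (Fin k))
  rw [Finset.card_univ, Fintype.card_fin] at h2
  rw [available]
  omega

theorem available_update_of_not_adj {v w : V} (h : ¬ G.Adj v w) (x : V → Fin k) (b : Fin k) :
    available G v (Function.update x w b) = available G v x := by
  ext a
  rw [mem_available, mem_available]
  refine forall₂_congr fun u hu => ?_
  have huw : u ≠ w := fun huw => h (huw ▸ hu)
  rw [Function.update_of_ne huw]

theorem available_sdiff_subset {v w : V} (x : V → Fin k) (b : Fin k) :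
    available G v x \ available G v (Function.update x w b) ⊆ {b} := by
  intro a ha
  rw [Finset.mem_sdiff, mem_available, mem_available] at ha
  obtain ⟨h1, h2⟩ := ha
  push Not at h2
  obtain ⟨u, hu, h3⟩ := h2
  by_cases huw : u = w
  · subst huw
    rw [Function.update_self] at h3
    rw [Finset.mem_singleton, h3]
  · rw [Function.update_of_ne huw] at h3
    exact absurd h3 (h1 u hu)

/-- The edges not incident to `v` are properly colored. -/
def IsProperOff (v : V) (x : V → Fin k) : Prop :=
  ∀ u w, G.Adj u w → u ≠ v → w ≠ v → x u ≠ x w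

theorem isProper_update_iff (v : V) (x : V → Fin k) (a : Fin k) :
    IsProper G (Function.update x v a) ↔ IsProperOff G v x ∧ a ∈ available G v x := by
  rw [mem_available]
  constructor
  · intro h
    refine ⟨fun u w huw hu hw => ?_, fun w hw => ?_⟩
    · have := h u w huw
      rwa [Function.update_of_ne hu, Function.update_of_ne hw] at this
    · have := h v w hw
      rw [Function.update_self, Function.update_of_ne hw.ne'] at this
      exact this.symm
  · rintro ⟨h1, h2⟩ u w huw
    by_cases hu : u = v
    · subst hu
      rw [Function.update_self, Function.update_of_ne huw.ne']
      exact (h2 w huw).symm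
    by_cases hw : w = v
    · subst hw
      rw [Function.update_self, Function.update_of_ne hu]
      exact h2 u huw.symm
    · rw [Function.update_of_ne hu, Function.update_of_ne hw]
      exact h1 u w huw hu hw

/-- Greedy coloring: every vertex always has an available color. Existence is needed for the uniform
distribution to have total mass 1. -/
theorem exists_isProper {Δ : ℕ} (hΔ : G.maxDegree ≤ Δ) (hk : 2 * Δ + 1 ≤ k) :
    ∃ x : V → Fin k, IsProper G x := by
  have key : ∀ J : Finset V, ∃ x : V → Fin k,
      ∀ v w, G.Adj v w → v ∈ J → w ∈ J → x v ≠ x w := by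
    intro J
    induction J using Finset.induction_on with
    | empty => exact ⟨fun _ => ⟨0, by omega⟩, by simp⟩
    | insert u J hu ih =>
      obtain ⟨x, hx⟩ := ih
      obtain ⟨a, ha⟩ : (available G u x).Nonempty :=
        Finset.card_pos.1 (by have := le_card_available G hΔ hk u x; omega)
      rw [mem_available] at ha
      refine ⟨Function.update x u a, fun v w hvw hv hw => ?_⟩
      by_cases hvu : v = u
      · subst hvu
        rw [Function.update_self, Function.update_of_ne hvw.ne']
        exact (ha w hvw).symm
      by_cases hwu : w = u
      · subst hwu
        rw [Function.update_self, Function.update_of_ne hvu]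
        exact ha v hvw.symm
      · rw [Function.update_of_ne hvu, Function.update_of_ne hwu]
        exact hx v w hvw ((Finset.mem_insert.1 hv).resolve_left hvu)
          ((Finset.mem_insert.1 hw).resolve_left hwu)
  obtain ⟨x, hx⟩ := key Finset.univ
  exact ⟨x, fun v w hvw => hx v w hvw (Finset.mem_univ v) (Finset.mem_univ w)⟩

theorem randomColoring_nonneg (x : V → Fin k) : 0 ≤ randomColoring G k x := by
  rw [randomColoring]; split_ifs <;> positivity

theorem sum_randomColoring {Δ : ℕ} (hΔ : G.maxDegree ≤ Δ) (hk : 2 * Δ + 1 ≤ k) :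
    ∑ x, randomColoring G k x = 1 := by
  classical
  obtain ⟨x, hx⟩ := exists_isProper G hΔ hk
  have : Nonempty {τ : V → Fin k // IsProper G τ} := ⟨⟨x, hx⟩⟩
  have h1 : (Nat.card {τ : V → Fin k // IsProper G τ} : ℝ) ≠ 0 := by
    exact_mod_cast Nat.card_pos.ne'
  simp only [randomColoring]
  rw [← Finset.sum_filter, Finset.sum_const, nsmul_eq_mul]
  have h2 : (Finset.univ.filter fun τ : V → Fin k => IsProper G τ).card =
      Nat.card {τ : V → Fin k // IsProper G τ} := by
    rw [Nat.card_eq_fintype_card, Fintype.card_subtype]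
  rw [← h2] at h1 ⊢
  convert! mul_inv_cancel₀ h1

/-- If `x` is proper away from `v`, the proper recolorings at `v` are the available colors, all of
equal weight; otherwise both sides of the consistency relation vanish. -/
theorem isSpecification_randomColoring {Δ : ℕ} (hΔ : G.maxDegree ≤ Δ) (hk : 2 * Δ + 1 ≤ k) :
    IsSpecification (randomColoring G k) (fun v x => uniformOn (available G v x)) := by
  have hne : ∀ v (x : V → Fin k), (available G v x).Nonempty := fun v x =>
    Finset.card_pos.1 (by have := le_card_available G hΔ hk v x; omega)
  refine ⟨fun v x a => uniformOn_nonneg _ a, fun v x => sum_uniformOn (hne v x),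
    fun v x b => by rw [available_update_of_not_adj G (G.irrefl (v := v))], fun v x a => ?_⟩
  by_cases hP : IsProperOff G v x
  · have h1 : ∀ b, randomColoring G k (Function.update x v b) = if b ∈ available G v x then
        (Nat.card {τ : V → Fin k // IsProper G τ} : ℝ)⁻¹ else 0 := fun b => by
      simp only [randomColoring, isProper_update_iff, hP, true_and]
    have hc : ((available G v x).card : ℝ) ≠ 0 := by exact_mod_cast (hne v x).card_ne_zero
    simp only [siteSum, h1, uniformOn]
    rw [Finset.sum_ite_mem, Finset.univ_inter, Finset.sum_const, nsmul_eq_mul]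
    split_ifs
    · rw [inv_mul_cancel_left₀ hc]
    · rw [zero_mul]
  · have h1 : ∀ b, randomColoring G k (Function.update x v b) = 0 := fun b => by
      simp only [randomColoring, isProper_update_iff, hP, false_and, if_false]
    simp only [siteSum, h1, Finset.sum_const_zero, mul_zero]

/-- Rapid mixing of random colorings. -/
theorem rapidMixingWith_randomColoring [Nonempty V] {Δ : ℕ} (hΔ : G.maxDegree ≤ Δ)
    (hk : 2 * Δ + 1 ≤ k) :
    RapidMixingWith (randomColoring G k) (mixingConst
      (k * (((k : ℝ)⁻¹) ^ (Δ + 1) * (1 - Δ * ((Δ + 1 : ℕ) : ℝ)⁻¹) ^ 2)⁻¹)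
      (((k : ℝ)⁻¹) ^ (Δ + 1))) := by
  have hspec := isSpecification_randomColoring G hΔ hk
  have hk0 : (0 : ℝ) < k := by exact_mod_cast (by omega : 0 < k)
  have hk1 : (1 : ℝ) ≤ k := by exact_mod_cast (by omega : 1 ≤ k)
  have hΔ1 : (0 : ℝ) < ((Δ + 1 : ℕ) : ℝ) := by positivity
  have hq := randomColoring_nonneg G (k := k)
  have hS : ∀ v (x : V → Fin k), 0 ≤ siteSum v (randomColoring G k) x := fun v x =>
    siteSum_nonneg hq
  -- At least `k - Δ ≥ Δ + 1` colors are available, and one neighbour changes this set by at most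
  -- one color in each direction, so its influence is at most `1 / (Δ + 1)`.
  have hdob := isDobrushin_of_adj G (κ := fun v (x : V → Fin k) => uniformOn (available G v x))
    hΔ (α := ((Δ + 1 : ℕ) : ℝ)⁻¹) (inv_pos.2 hΔ1).le
    (by rw [← div_eq_mul_inv, div_lt_one hΔ1]; push_cast; linarith)
    (fun v w x b _ => by
      refine dTV_uniformOn_le (Nat.succ_pos Δ) (le_card_available G hΔ hk _ _)
        (le_card_available G hΔ hk _ _) ?_ ?_
      · exact (Finset.card_le_card (available_sdiff_subset G x b)).trans (by simp)
      · have := Finset.card_le_card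
          (available_sdiff_subset G (v := v) (w := w) (Function.update x w b) (x w))
        simpa using this)
    (fun v w x b _ h => by rw [available_update_of_not_adj G h])
  have hκ : ∀ v (x : V → Fin k) a, a ∈ available G v x →
      (k : ℝ)⁻¹ ≤ uniformOn (available G v x) a := fun v x a ha => by
    rw [uniformOn, if_pos ha]
    refine inv_anti₀ (by exact_mod_cast Finset.card_pos.2 ⟨a, ha⟩) ?_
    have := Finset.card_le_univ (available G v x)
    rw [Fintype.card_fin] at this
    exact_mod_cast this
  have hmarg : MarginalLowerBound (randomColoring G k) ((k : ℝ)⁻¹ ^ (Δ + 1)) := by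
    refine marginalLowerBound_of_forbidden hq (fun v => G.neighborFinset v)
      (card_neighborFinset_le G hΔ) (fun v => by simp) (fun a b => b = a) (inv_pos.2 hk0)
      (inv_le_one_of_one_le₀ hk1) ?_ ?_ ?_
    · rintro v a x ⟨w, hw, hwa⟩
      rw [hspec.consistent, uniformOn, if_neg, zero_mul]
      rw [mem_available]
      exact fun h => h w ((G.mem_neighborFinset v w).1 hw) hwa
    · intro v a x h
      rw [hspec.consistent]
      refine mul_le_mul_of_nonneg_right (hκ v x a ?_) (hS v x)
      rw [mem_available]
      exact fun w hw => h w ((G.mem_neighborFinset v w).2 hw)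
    · intro v w hw a x
      -- Since `v` has a neighbour, `Δ ≥ 1`, so `w` has at least two available colors and can avoid
      -- `a`.
      have hΔ0 : 0 < Δ := (Finset.card_pos.2 ⟨w, hw⟩).trans_le (card_neighborFinset_le G hΔ v)
      obtain ⟨b, hb, hba⟩ := Finset.exists_mem_ne
        (lt_of_lt_of_le (by omega) (le_card_available G hΔ hk w x)) a
      have h1 := Finset.single_le_sum
        (f := fun b => if b = a then 0 else randomColoring G k (Function.update x w b))
        (fun c _ => by split_ifs; exacts [le_rfl, hq _]) (Finset.mem_univ b)
      refine le_trans ?_ h1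
      simp only [if_neg hba]
      rw [hspec.consistent]
      exact mul_le_mul_of_nonneg_right (hκ w x b hb) (hS w x)
  have := rapidMixingWith_of_isDobrushin hq (sum_randomColoring G hΔ hk) hspec hdob
    (by positivity) hmarg
  simpa using this

end Coloring

/-! ### The hard-core model -/

section HardCore

variable {lam : ℝ}

theorem hardCoreWeight_nonneg (hlam : 0 < lam) (x : V → Fin 2) : 0 ≤ hardCoreWeight G lam x := by
  rw [hardCoreWeight]; split_ifs <;> positivity

theorem sum_hardCoreWeight_pos (hlam : 0 < lam) : 0 < ∑ x, hardCoreWeight G lam x := by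
  refine Finset.sum_pos' (fun x _ => hardCoreWeight_nonneg G hlam x)
    ⟨fun _ => 0, Finset.mem_univ _, ?_⟩
  have h : IsAdmissible G (fun _ : V => (0 : Fin 2)) := fun v w _ => by simp
  rw [hardCoreWeight, if_pos h]
  simp

/-- The definition enumerates the configurations with classical decidable equality on `V`; here the
partition function is expressed with the ambient instance. -/
theorem hardCore_eq (x : V → Fin 2) :
    hardCore G lam x = hardCoreWeight G lam x / ∑ τ, hardCoreWeight G lam τ := by
  rw [hardCore]
  congr!

theorem hardCore_nonneg (hlam : 0 < lam) (x : V → Fin 2) : 0 ≤ hardCore G lam x := by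
  rw [hardCore_eq]
  exact div_nonneg (hardCoreWeight_nonneg G hlam x) (sum_hardCoreWeight_pos G hlam).le

theorem sum_hardCore (hlam : 0 < lam) : ∑ x, hardCore G lam x = 1 := by
  simp only [hardCore_eq, ← Finset.sum_div]
  exact div_self (sum_hardCoreWeight_pos G hlam).ne'

/-- No neighbour of `v` is occupied. -/
def IsFree (v : V) (x : V → Fin 2) : Prop :=
  ∀ w, G.Adj v w → x w = 0

open Classical in
/-- The conditional distributions of the hard-core model. -/
noncomputable def hardCoreCond (lam : ℝ) (v : V) (x : V → Fin 2) (a : Fin 2) : ℝ :=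
  if a = 1 then (if IsFree G v x then lam / (1 + lam) else 0)
    else 1 - if IsFree G v x then lam / (1 + lam) else 0

theorem isFree_update_of_not_adj {v w : V} (h : ¬ G.Adj v w) (x : V → Fin 2) (b : Fin 2) :
    IsFree G v (Function.update x w b) ↔ IsFree G v x :=
  forall₂_congr fun u hu => by
    have huw : u ≠ w := fun huw => h (huw ▸ hu)
    rw [Function.update_of_ne huw]

theorem hardCoreCond_update_of_not_adj {v w : V} (h : ¬ G.Adj v w) (x : V → Fin 2) (b : Fin 2) :
    hardCoreCond G lam v (Function.update x w b) = hardCoreCond G lam v x := by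
  classical
  ext a
  simp only [hardCoreCond, isFree_update_of_not_adj G h]

theorem spin_mul_eq_zero (a b : Fin 2) : (a : ℕ) * (b : ℕ) = 0 ↔ a = 0 ∨ b = 0 := by
  revert a b; decide

/-- No edge which is not incident to `v` has two occupied ends. -/
def IsAdmissibleOff (v : V) (x : V → Fin 2) : Prop :=
  ∀ u w, G.Adj u w → u ≠ v → w ≠ v → x u = 0 ∨ x w = 0

theorem isAdmissible_update_iff (v : V) (x : V → Fin 2) (a : Fin 2) :
    IsAdmissible G (Function.update x v a) ↔
      IsAdmissibleOff G v x ∧ (a = 0 ∨ IsFree G v x) := by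
  simp only [IsAdmissible, spin_mul_eq_zero]
  constructor
  · intro h
    refine ⟨fun u w huw hu hw => ?_, ?_⟩
    · have := h u w huw
      rwa [Function.update_of_ne hu, Function.update_of_ne hw] at this
    · refine or_iff_not_imp_left.2 fun ha w hw => ?_
      have := h v w hw
      rw [Function.update_self, Function.update_of_ne hw.ne'] at this
      exact this.resolve_left ha
  · rintro ⟨h1, h2⟩ u w huw
    by_cases hu : u = v
    · subst hu
      rw [Function.update_self, Function.update_of_ne huw.ne']
      exact h2.imp id fun h => h w huw
    by_cases hw : w = v
    · subst hw
      rw [Function.update_self, Function.update_of_ne hu]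
      exact (h2.imp id fun h => h u huw.symm).symm
    · rw [Function.update_of_ne hu, Function.update_of_ne hw]
      exact h1 u w huw hu hw

theorem isSpecification_hardCore (hlam : 0 < lam) :
    IsSpecification (hardCore G lam) (hardCoreCond G lam) := by
  classical
  have hp0 : 0 ≤ lam / (1 + lam) := by positivity
  have hp1 : lam / (1 + lam) ≤ 1 := by rw [div_le_one (by positivity)]; linarith
  refine ⟨fun v x a => ?_, fun v x => ?_, fun v x b =>
    hardCoreCond_update_of_not_adj G (G.irrefl (v := v)) x b, fun v x a => ?_⟩
  · rw [hardCoreCond]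
    split_ifs <;> first | assumption | exact le_rfl | linarith
  · rw [Fin.sum_univ_two]
    simp [hardCoreCond]
  -- The weight splits into `lam ^ b` for the spin at `v` and a factor `W` of the other spins, which
  -- cancels from the conditional distribution.
  · set W : ℝ := ∏ u ∈ Finset.univ.erase v, lam ^ (x u : ℕ) with hW
    have hprod : ∀ b : Fin 2, ∏ u, lam ^ (Function.update x v b u : ℕ) = lam ^ (b : ℕ) * W := by
      intro b
      rw [← Finset.mul_prod_erase _ _ (Finset.mem_univ v), Function.update_self, hW]
      congr 1
      exact Finset.prod_congr rfl fun u hu => by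
        rw [Function.update_of_ne (Finset.ne_of_mem_erase hu)]
    have hw : ∀ b : Fin 2, hardCoreWeight G lam (Function.update x v b) =
        if IsAdmissibleOff G v x ∧ (b = 0 ∨ IsFree G v x) then
          lam ^ (b : ℕ) * W else 0 := fun b => by
      simp only [hardCoreWeight, isAdmissible_update_iff, hprod]
    have h1 : 1 + lam ≠ 0 := by positivity
    simp only [siteSum, hardCore_eq, ← Finset.sum_div]
    rw [Fin.sum_univ_two, hw, hw, hw, hardCoreCond, ← mul_div_assoc]
    congr 1
    by_cases hP : IsAdmissibleOff G v x
    · by_cases hF : IsFree G v x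
      · fin_cases a
        · simp only [hP, hF]; simp; field_simp; ring
        · simp only [hP, hF]; simp; field_simp
      · fin_cases a
        · simp only [hP, hF]; simp
        · simp only [hP, hF]; simp
    · simp only [hP]; simp

/-- Rapid mixing of the hard-core model. -/
theorem rapidMixingWith_hardCore [Nonempty V] {Δ : ℕ} (hΔ : G.maxDegree ≤ Δ) (hlam : 0 < lam)
    (hΔlam : lam * ((Δ : ℝ) - 1) < 1) :
    RapidMixingWith (hardCore G lam) (mixingConst
      (2 * ((lam / (1 + lam) * (1 / (1 + lam))) ^ (Δ + 1) * (1 - Δ * (lam / (1 + lam))) ^ 2)⁻¹)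
      ((lam / (1 + lam) * (1 / (1 + lam))) ^ (Δ + 1))) := by
  classical
  have hspec := isSpecification_hardCore G hlam
  have h1 : 0 < 1 + lam := by positivity
  set p := lam / (1 + lam) with hp
  set r := 1 / (1 + lam) with hr
  have hp0 : 0 < p := by positivity
  have hr0 : 0 < r := by positivity
  have hpr : p + r = 1 := by rw [hp, hr]; field_simp; ring
  have hq := hardCore_nonneg G hlam
  have hS : ∀ v (x : V → Fin 2), 0 ≤ siteSum v (hardCore G lam) x := fun v x =>
    siteSum_nonneg hq
  -- A neighbour can only switch the occupation probability between 0 and `p`, so its influence is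
  -- at most `p`; and `Δ * p < 1` is equivalent to `lam * (Δ - 1) < 1`.
  have hdob := isDobrushin_of_adj G (κ := hardCoreCond G lam) hΔ (α := p) hp0.le
    (by rw [hp, ← mul_div_assoc, div_lt_one h1]; linarith)
    (fun v w x b _ => by
      rw [dTV_fin_two (hspec.sum_eq_one v _) (hspec.sum_eq_one v _)]
      simp only [hardCoreCond, if_true, ← hp]
      split_ifs <;> simp [abs_of_pos hp0, hp0.le])
    (fun v w x b _ h => hardCoreCond_update_of_not_adj G h x b)
  have hprp : p * r ≤ p := mul_le_of_le_one_right hp0.le (by linarith)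
  have hprr : p * r ≤ r := mul_le_of_le_one_left hr0.le (by linarith)
  have hzero : ∀ v x, r ≤ hardCoreCond G lam v x 0 := fun v x => by
    simp only [hardCoreCond, ← hp]
    rw [if_neg (by decide)]
    split_ifs <;> linarith
  have hmarg : MarginalLowerBound (hardCore G lam) ((p * r) ^ (Δ + 1)) := by
    -- Only an occupied neighbour of an occupied site is forbidden. The product `p * r` lies below
    -- both `p`, the probability of occupying a free site, and `r`, a lower bound for that of
    -- leaving any site empty.
    refine marginalLowerBound_of_forbidden hq (fun v => G.neighborFinset v)
      (card_neighborFinset_le G hΔ) (fun v => by simp) (fun a b => a = 1 ∧ b = 1)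
      (mul_pos hp0 hr0) (by nlinarith) ?_ ?_ ?_
    · rintro v a x ⟨w, hw, rfl, hw1⟩
      rw [hspec.consistent, hardCoreCond, if_pos rfl, if_neg, zero_mul]
      intro h
      rw [h w ((G.mem_neighborFinset v w).1 hw)] at hw1
      exact absurd hw1 (by decide)
    · intro v a x h
      rw [hspec.consistent]
      refine mul_le_mul_of_nonneg_right ?_ (hS v x)
      by_cases ha : a = 1
      · subst ha
        rw [hardCoreCond, if_pos rfl, if_pos]
        · exact hprp
        · intro w hw
          have h2 := h w ((G.mem_neighborFinset v w).2 hw)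
          have h3 : x w ≠ 1 := fun h3 => h2 ⟨rfl, h3⟩
          omega
      · have ha0 : a = 0 := by omega
        subst ha0
        exact hprr.trans (hzero v x)
    · intro v w _ a x
      rw [Fin.sum_univ_two]
      have h2 : 0 ≤ if a = 1 ∧ (1 : Fin 2) = 1 then 0 else
          hardCore G lam (Function.update x w 1) := by
        split_ifs; exacts [le_rfl, hq _]
      have h3 : ¬ (a = 1 ∧ (0 : Fin 2) = 1) := by simp
      rw [if_neg h3, hspec.consistent]
      have h4 := mul_le_mul_of_nonneg_right (hprr.trans (hzero w x)) (hS w x)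
      linarith
  have := rapidMixingWith_of_isDobrushin hq (sum_hardCore G hlam) hspec hdob
    (by positivity) hmarg
  simpa using this

end HardCore

end Graph

end SpinSystem

theorem theorem2p1 :
    -- exponential random graph models
    (∀ (s : ℕ) (V : Fin s → Type*) [∀ i, Finite (V i)] (G : ∀ i, SimpleGraph (V i))
        (β : Fin s → ℝ), (∀ i, (G i).Connected) →
        1 / 2 * deriv (SpinSystem.ergmPhi G (fun i => |β i|)) 1 < 1 →
        ∃ C : ℝ, ∀ n : ℕ, 2 ≤ n →
          SpinSystem.RapidMixingWith (SpinSystem.ergm G β n) C) ∧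
    -- vertex-weighted exponential random graph models
    (∀ β₁ β₂ p : ℝ, 0 < p → p < 1 →
        (⨆ x : Set.Ioo (0 : ℝ) 1, |deriv (SpinSystem.vertexWeightedPhi β₁ β₂ p) x|) < 1 →
        ∃ C : ℝ, ∀ n : ℕ, 1 ≤ n →
          SpinSystem.RapidMixingWith (SpinSystem.vertexWeighted β₁ β₂ p n) C) ∧
    -- random colorings
    (∀ Δ k : ℕ, 2 * Δ + 1 ≤ k →
        ∃ C : ℝ, ∀ (V : Type*) [Fintype V] [DecidableEq V] [Nonempty V]
          (G : SimpleGraph V) [DecidableRel G.Adj], G.maxDegree ≤ Δ →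
          SpinSystem.RapidMixingWith (SpinSystem.randomColoring G k) C) ∧
    -- the hard-core model; `lam * (Δ - 1) < 1` is `lam < 1 / (Δ - 1)`, no condition if `Δ ≤ 1`
    (∀ (Δ : ℕ) (lam : ℝ), 0 < lam → lam * ((Δ : ℝ) - 1) < 1 →
        ∃ C : ℝ, ∀ (V : Type*) [Fintype V] [DecidableEq V] [Nonempty V]
          (G : SimpleGraph V) [DecidableRel G.Adj], G.maxDegree ≤ Δ →
          SpinSystem.RapidMixingWith (SpinSystem.hardCore G lam) C) := by
  refine ⟨fun s V _ G β _ hβ => SpinSystem.exists_rapidMixingWith_ergm G β hβ,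
    fun β₁ β₂ p _ _ hβ => SpinSystem.exists_rapidMixingWith_vertexWeighted β₁ β₂ p hβ,
    fun Δ k hk => ⟨_, fun V _ _ _ G _ hΔ =>
      SpinSystem.rapidMixingWith_randomColoring G hΔ hk⟩,
    fun Δ lam hlam hΔlam => ⟨_, fun V _ _ _ G _ hΔ =>
      SpinSystem.rapidMixingWith_hardCore G hΔ hlam hΔlam⟩⟩
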